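/- Let $\mathcal N^k$ be the distribution of $k$ independent standard Gaussian variables. For $\epsilon>0$ write $M=\max(2,1/\epsilon)$ (so $M=1/\epsilon$ when $\epsilon\le 1/2$). There are an absolute constant $C\in\mathbb N$ and two Turing machines $W$ and $E$ such that for every integer $k\ge 1$ and every real $\epsilon>0$ there are a rational $\delta>0$, a finite set $S\subseteq \mathbb Q^k\subseteq\mathbb R^k$ and a function $p\ge 0$ with the following properties. (1) $S$ is contained in the grid $(\delta(\mathbb Z+\tfrac12))^k$ and $|S|\le M^{Ck}$, that is, $|S|=(1/\epsilon)^{O(k)}$. (2) $p$ is a product weight with rational values, $p(x)=\prod_{i=1}^k w(x_i)$ with $w:\mathbb Q\to\mathbb Q_{\ge 0}$, and is computable in $\mathrm{poly}(k,1/\epsilon)$ time: for every $x\in S$, the machine $W$ on input $(k,\lceil M\rceil,x)$ outputs $p(x)$ exactly within $C(kM)^C$ steps. (3) For every semi-norm $\phi:\mathbb R^k\to\mathbb R_+$, $\phi$ is integrable with respect to $\mathcal N^k$ and $$(1-\epsilon)\sum_{x\in S}p(x)\phi(x)\;\le\;\mathbb E_{X\sim\mathcal N^k}[\phi(X)]\;\le\;(1+\epsilon)\sum_{x\in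 S}p(x)\phi(x).$$ (4) Successive elements of $S$ can be enumerated in $\mathrm{poly}(k,1/\epsilon)$ time and $O(k\log(1/\epsilon))$ space: the elements of $S$ can be listed without repetition as $x^{(1)},\dots,x^{(m)}$ so that the machine $E$ on input $(k,\lceil M\rceil,\text{"no point"})$ outputs $x^{(1)}$, on input $(k,\lceil M\rceil,x^{(i)})$ outputs $x^{(i+1)}$ for $i<m$, and on input $(k,\lceil M\rceil,x^{(m)})$ outputs "no point" (and if $m=0$ it outputs "no point" on the first input), each time within $C(kM)^C$ steps and using at most $C\,k\log M$ cells, input and output included. Here the machines are deterministic multi-stack Turing machines with finitely many states, stacks and symbols; integers are written in binary, rationals as sign, numerator and denominator in lowest terms, and points as the list of their coordinates. -/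

import Mathlib

open MeasureTheory ProbabilityTheory

namespace GaussianNet

/-! Strings over a fixed finite alphabet, the encodings of numbers and points, and resource-bounded
computation by Mathlib's multi-stack Turing machines `Turing.FinTM2`. -/

/-- The input and output alphabet: two bits, a separator, and a symbol meaning "no point". -/
inductive Sym
  | bit (b : Bool)
  | sep
  | noPoint
  deriving DecidableEq

/-- A natural number in binary (least significant bit first), closed by a separator. -/
def encNat (n : ℕ) : List Sym :=
  (Nat.bits n).map Sym.bit ++ [Sym.sep]

/-- A rational number in lowest terms: sign bit, absolute numerator, denominator. -/
def encRat (q : ℚ) : List Sym :=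
  Sym.bit (decide (q.num < 0)) :: (encNat q.num.natAbs ++ encNat q.den)

/-- A rational point of `ℝ^k`: the list of its coordinates. -/
def encPoint {k : ℕ} (x : Fin k → ℚ) : List Sym :=
  (List.ofFn x).flatMap encRat

/-- A rational point or the answer "no point". -/
def encOptPoint {k : ℕ} : Option (Fin k → ℚ) → List Sym
  | none => [Sym.noPoint]
  | some x => encPoint x

/-- The input `(k, N, o)`: the dimension and the precision parameter in binary, then a point or
"no point". -/
def encInput (k N : ℕ) (o : Option (Fin k → ℚ)) : List Sym :=
  encNat k ++ encNat N ++ encOptPoint o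

/-- The initial configuration of a machine on an input string. -/
def startCfg (M : Turing.TM2ComputableAux Sym Sym) (inp : List Sym) : M.tm.Cfg :=
  Turing.initList M.tm (inp.map M.inputAlphabet.symm)

/-- On input `inp` the machine halts after at most `t` steps, with output `out`. -/
def OutputsInTime (M : Turing.TM2ComputableAux Sym Sym) (inp out : List Sym) (t : ℕ) : Prop :=
  Nonempty (Turing.TM2OutputsInTime M.tm (inp.map M.inputAlphabet.symm)
    (some (out.map M.outputAlphabet.symm)) t)

/-- The number of cells in use in a configuration: all stacks, input and output included. -/
def cells (M : Turing.TM2ComputableAux Sym Sym) (c : M.tm.Cfg) : ℕ :=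
  ∑ j ∈ @Finset.univ M.tm.K M.tm.kFin, (c.stk j).length

/-- On input `inp` the machine never uses more than `s` cells. -/
def UsesSpace (M : Turing.TM2ComputableAux Sym Sym) (inp : List Sym) (s : ℕ) : Prop :=
  ∀ c : M.tm.Cfg, StateTransition.Reaches M.tm.step (startCfg M inp) c → cells M c ≤ s

/-- The entry that precedes position `i` in a list; `none` stands before the first entry. -/
def prevEntry {α : Type*} (L : List α) (i : ℕ) : Option α :=
  if i = 0 then none else L[i - 1]?

/-- `1/ε`, replaced by `2` when `ε > 1/2`, where bounds such as `(1/ε)^{O(k)}` and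
`O(k log (1/ε))` would degenerate. -/
noncomputable def invEps (ε : ℝ) : ℝ := max 2 (1 / ε)

/-- The distribution `𝒩^k` of `k` independent standard Gaussian variables. -/
noncomputable def stdGaussianPow (k : ℕ) : Measure (Fin k → ℝ) :=
  Measure.pi fun _ => gaussianReal 0 1

end GaussianNet

namespace GaussianNet

/-! Put `N = ⌈max 2 (1/ε)⌉` and let `n = Nat.size N`. The net consists of centres of cells of a grid
of spacing `2 / 2 ^ (6 n)`, and the weight of a point is a rational approximation of the Gaussian
mass of its cell.

Approximation. The Gaussian measure and the weighted net are both invariant under sign changes of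
the coordinates, so a semi-norm may be replaced by the sum of its compositions with all sign changes
(`integral_symmetrize`, `netSum_symmetrize`). The resulting semi-norm `φ` is monotone in the
absolute values of the coordinates (`Unconditional.mono`). Hence rounding every coordinate by at
most `r` changes `φ` by at most `r φ(1,…,1)`, without a factor `k`, and Jensen's inequality gives
`φ(1,…,1) ≤ 2 E φ` (`Unconditional.apply_one_le`), which turns absolute errors into relative ones. A
point whose cell is not in the net has 1-norm at least `16 k n` (`le_one_norm_of_notMem_Index`), and
an exponential moment bound makes its contribution negligible (`Unconditional.setIntegral_le`).

Cardinality. Membership is decided essentially by a bound `32 k n` on the total length of the binary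
codes of the coordinates. A box large enough to hold typical Gaussian points would have to grow with
`k`; a budget shared by all coordinates does not. As the lengths satisfy a Kraft inequality
(`sum_cost_le`), there are at most `4 ^ (32 k n)` points (`card_net_le`), whatever the cap on single
coordinates.

Weights. The mass of a cell is replaced by the probability that the number of heads among `2 m` fair
coins lies in a block of `2 p` consecutive values. The parameters make `2 p` standardized binomial
steps, each of length `√(2/m)`, exactly one grid cell. Wallis' product and the ratios of successive
binomial coefficients bound the relative error by `exp (1/(4kN))` for each coordinate
(`weight_bounds`), hence by `exp (1/(4N))` for a product of `k` of them. To compute the weight, a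
number `v` is multiplied by `(1 + 2^d)^(2m)`. If `d` is large enough, the digits of the result in
base `2^d` are the numbers `v * choose (2m) j`, and adding `2 p` of these digits multiplies `v` by
the numerator of the weight (`Weigh.bval_coordBits`). As `m` and `p` are polynomial in `k` and `N`,
they can be kept in unary.

Enumeration. In terms of coordinate indices the net is a down-set, so an odometer lists it: increase
the first coordinate that can be increased and reset those before it (`exists_orbit`). On codes this
is a binary increment, with the unused part of the budget kept as a stack of tokens. It takes time
`O(k n)`, and since a machine step adds at most one cell, the space bound follows from the time
bound.

The machines are obtained by compiling programs of a small structured language to `Turing.FinTM2`,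
step counts included (`Cmd.Runs.stepsTo`). -/

instance : Fintype Sym where
  elems := {Sym.bit false, Sym.bit true, Sym.sep, Sym.noPoint}
  complete := by rintro (_ | _) <;> simp

/-- Structured programs over stacks indexed by `K` whose entries are symbols. -/
inductive Cmd (K : Type) : Type
  | skip : Cmd K
  | push (k : K) (s : Sym) : Cmd K
  | pop (k : K) : Cmd K
  | seq (a b : Cmd K) : Cmd K
  | case (k : K) (f : Option Sym → Cmd K) : Cmd K
  | loop (k : K) (P : Option Sym → Bool) (c : Cmd K) : Cmd K

/-! ### Structured stack programs and their compilation to Turing machines. -/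

namespace Cmd

variable {K : Type} [DecidableEq K]

/-- `Runs c s t s'`: started on the stacks `s`, the program `c` ends after exactly `t` steps with
the stacks `s'`. -/
inductive Runs : Cmd K → (K → List Sym) → ℕ → (K → List Sym) → Prop
  | skip (s) : Runs skip s 1 s
  | push (k x s) : Runs (push k x) s 1 (Function.update s k (x :: s k))
  | pop (k s) : Runs (pop k) s 1 (Function.update s k (s k).tail)
  | seq {a b s s' s'' t t'} : Runs a s t s' → Runs b s' t' s'' → Runs (seq a b) s (t + t') s''
  | case {k f s s' t} : Runs (f (s k).head?) s t s' → Runs (case k f) s (t + 1) s'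
  | loop_end {k P c s} : P (s k).head? = false → Runs (loop k P c) s 1 s
  | loop_go {k P c s s' s'' t t'} : P (s k).head? = true → Runs c s t s' →
      Runs (loop k P c) s' t' s'' → Runs (loop k P c) s (t + t' + 1) s''

/-- The control positions of a program. -/
def Pos : Cmd K → Type
  | skip => Unit
  | push _ _ => Unit
  | pop _ => Unit
  | seq a b => Pos a ⊕ Pos b
  | case _ f => Unit ⊕ (Σ o, Pos (f o))
  | loop _ _ c => Unit ⊕ Pos c

/-- A program has finitely many control positions. -/
@[reducible]
def posFintype : (c : Cmd K) → Fintype (Pos c)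
  | skip => inferInstanceAs (Fintype Unit)
  | push _ _ => inferInstanceAs (Fintype Unit)
  | pop _ => inferInstanceAs (Fintype Unit)
  | seq a b =>
    letI := posFintype a
    letI := posFintype b
    inferInstanceAs (Fintype (Pos a ⊕ Pos b))
  | case _ f =>
    letI := fun o => posFintype (f o)
    inferInstanceAs (Fintype (Unit ⊕ (Σ o, Pos (f o))))
  | loop _ _ c =>
    letI := posFintype c
    inferInstanceAs (Fintype (Unit ⊕ Pos c))

/-- The position where a program starts. -/
def entry : (c : Cmd K) → Pos c
  | skip => ()
  | push _ _ => ()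
  | pop _ => ()
  | seq a _ => Sum.inl (entry a)
  | case _ _ => Sum.inl ()
  | loop _ _ _ => Sum.inl ()

/-- The statements of the machine, for a program whose positions are labelled by `ι` and which
continues at the label `e`. The local variable of the machine holds the last symbol inspected. -/
def code {Λ : Type} : (c : Cmd K) → (Pos c → Λ) → Λ → Pos c →
    Turing.TM2.Stmt (fun _ : K => Sym) Λ (Option Sym)
  | skip, _, e, _ => .goto fun _ => e
  | push k s, _, e, _ => .push k (fun _ => s) (.goto fun _ => e)
  | pop k, _, e, _ => .pop k (fun v _ => v) (.goto fun _ => e)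
  | seq a b, ι, e, p =>
    match p with
    | Sum.inl p => code a (fun q => ι (Sum.inl q)) (ι (Sum.inr (entry b))) p
    | Sum.inr p => code b (fun q => ι (Sum.inr q)) e p
  | case k f, ι, e, p =>
    match p with
    | Sum.inl _ => .peek k (fun _ o => o) (.goto fun o => ι (Sum.inr ⟨o, entry (f o)⟩))
    | Sum.inr ⟨o, p⟩ => code (f o) (fun q => ι (Sum.inr ⟨o, q⟩)) e p
  | loop k P c, ι, e, p =>
    match p with
    | Sum.inl _ => .peek k (fun _ o => o)
        (.goto fun o => if P o then ι (Sum.inr (entry c)) else e)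
    | Sum.inr p => code c (fun q => ι (Sum.inr q)) (ι (Sum.inl ())) p

/-- `t` steps of a machine. -/
def StepsTo {Λ : Type} (m : Λ → Turing.TM2.Stmt (fun _ : K => Sym) Λ (Option Sym)) :
    ℕ → Turing.TM2.Cfg (fun _ : K => Sym) Λ (Option Sym) →
      Turing.TM2.Cfg (fun _ : K => Sym) Λ (Option Sym) → Prop
  | 0, a, b => a = b
  | t + 1, a, b => ∃ c, Turing.TM2.step m a = some c ∧ StepsTo m t c b

theorem StepsTo.trans {Λ : Type} {m : Λ → Turing.TM2.Stmt (fun _ : K => Sym) Λ (Option Sym)}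
    {t t' : ℕ} {a b c : Turing.TM2.Cfg (fun _ : K => Sym) Λ (Option Sym)}
    (h : StepsTo m t a b) (h' : StepsTo m t' b c) : StepsTo m (t + t') a c := by
  induction t generalizing a with
  | zero => cases h; simpa using h'
  | succ t ih =>
    obtain ⟨d, hd, h⟩ := h
    rw [Nat.succ_add]
    exact ⟨d, hd, ih h⟩

/-- The labelling `ι` and the exit label `e` are arbitrary, because a subprogram sits inside the
machine of the whole program: its positions are a subset of the labels and its exit is the entry of
whatever follows, or the head of the enclosing loop. The step count is exact, since each primitive,
each `case` and each loop test is one machine step, whereas `seq` is free. -/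
theorem Runs.stepsTo {Λ : Type} {m : Λ → Turing.TM2.Stmt (fun _ : K => Sym) Λ (Option Sym)}
    {c : Cmd K} {s s' : K → List Sym} {t : ℕ} (h : Runs c s t s') (ι : Pos c → Λ) (e : Λ)
    (hm : ∀ p, m (ι p) = code c ι e p) (v : Option Sym) :
    ∃ v', StepsTo m t ⟨some (ι (entry c)), v, s⟩ ⟨some e, v', s'⟩ := by
  induction h generalizing e v with
  | skip s => exact ⟨v, _, by simp only [Turing.TM2.step, hm, code]; rfl, rfl⟩
  | push k x s => exact ⟨v, _, by simp only [Turing.TM2.step, hm, code]; rfl, rfl⟩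
  | pop k s => exact ⟨v, _, by simp only [Turing.TM2.step, hm, code]; rfl, rfl⟩
  | @seq a b _ _ _ _ _ _ _ iha ihb =>
    obtain ⟨v₁, h₁⟩ := iha (fun q => ι (Sum.inl q)) (ι (Sum.inr (entry b)))
      (fun p => hm (Sum.inl p)) v
    obtain ⟨v₂, h₂⟩ := ihb (fun q => ι (Sum.inr q)) e (fun p => hm (Sum.inr p)) v₁
    exact ⟨v₂, h₁.trans h₂⟩
  | @case k f s _ _ _ ih =>
    obtain ⟨v₁, h₁⟩ := ih (fun q => ι (Sum.inr ⟨(s k).head?, q⟩)) e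
      (fun p => hm (Sum.inr ⟨_, p⟩)) (s k).head?
    refine ⟨v₁, _, ?_, h₁⟩
    exact congrArg (fun q => some (Turing.TM2.stepAux q v s)) (hm (Sum.inl ()))
  | @loop_end k P c s hP =>
    refine ⟨(s k).head?, _, ?_, rfl⟩
    refine (congrArg (fun q => some (Turing.TM2.stepAux q v s)) (hm (Sum.inl ()))).trans ?_
    change some (Turing.TM2.Cfg.mk (some (if P (s k).head? = true then _ else e)) _ _) = _
    rw [hP, if_neg Bool.false_ne_true]
  | @loop_go k P c s _ _ _ _ hP _ _ ih₁ ih₂ =>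
    obtain ⟨v₁, h₁⟩ := ih₁ (fun q => ι (Sum.inr q)) (ι (Sum.inl ()))
      (fun p => hm (Sum.inr p)) (s k).head?
    obtain ⟨v₂, h₂⟩ := ih₂ ι e hm v₁
    refine ⟨v₂, _, ?_, h₁.trans h₂⟩
    refine (congrArg (fun q => some (Turing.TM2.stepAux q v s)) (hm (Sum.inl ()))).trans ?_
    change some (Turing.TM2.Cfg.mk (some (if P (s k).head? = true then _ else e)) _ _) = _
    rw [hP, if_pos rfl]

/-- The transition function of the machine that runs a program and then halts. -/
def transition (c : Cmd K) :
    Option (Pos c) → Turing.TM2.Stmt (fun _ : K => Sym) (Option (Pos c)) (Option Sym)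
  | none => .load (fun _ => none) .halt
  | some p => code c some none p

/-- The machine that runs a program, with input stack `k₀` and output stack `k₁`. -/
def machine [Fintype K] (c : Cmd K) (k₀ k₁ : K) : Turing.TM2ComputableAux Sym Sym where
  tm :=
    letI := posFintype c
    { K := K
      k₀ := k₀
      k₁ := k₁
      Γ := fun _ => Sym
      Λ := Option (Pos c)
      main := some (entry c)
      σ := Option Sym
      initialState := none
      Γk₀Fin := inferInstanceAs (Fintype Sym)
      m := transition c }
  inputAlphabet := Equiv.refl _
  outputAlphabet := Equiv.refl _

/-- The stacks that hold a single word. -/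
def single (k₀ : K) (w : List Sym) : K → List Sym := Function.update (fun _ => []) k₀ w

theorem StepsTo.iterate {Λ : Type} {m : Λ → Turing.TM2.Stmt (fun _ : K => Sym) Λ (Option Sym)}
    {t : ℕ} {a b : Turing.TM2.Cfg (fun _ : K => Sym) Λ (Option Sym)} (h : StepsTo m t a b) :
    (flip bind (Turing.TM2.step m))^[t] (some a) = some b := by
  induction t generalizing a with
  | zero => cases h; rfl
  | succ t ih =>
    obtain ⟨d, hd, h⟩ := h
    rw [Function.iterate_succ_apply, ← ih h]
    exact congrArg (flip bind (Turing.TM2.step m))^[t] hd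

/-- The machine is deterministic, so every reachable configuration lies on the unique run that leads
to the halting one. -/
theorem StepsTo.of_reaches {Λ : Type}
    {m : Λ → Turing.TM2.Stmt (fun _ : K => Sym) Λ (Option Sym)} {t : ℕ}
    {a b h : Turing.TM2.Cfg (fun _ : K => Sym) Λ (Option Sym)} (hs : StepsTo m t a h)
    (hh : Turing.TM2.step m h = none)
    (hr : StateTransition.Reaches (Turing.TM2.step m) a b) : ∃ i ≤ t, StepsTo m i a b := by
  induction hr using Relation.ReflTransGen.head_induction_on generalizing t with
  | refl => exact ⟨0, Nat.zero_le _, rfl⟩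
  | @head a c hac _ ih =>
    cases t with
    | zero =>
      cases hs
      rw [hh] at hac
      cases hac
    | succ t =>
      obtain ⟨d, hd, hs⟩ := hs
      rw [hd] at hac
      cases hac
      obtain ⟨i, hi, h'⟩ := ih hs
      exact ⟨i + 1, by omega, _, hd, h'⟩

/-- The number of cells in use. -/
def size [Fintype K] (s : K → List Sym) : ℕ := ∑ k, (s k).length

theorem size_update_le [Fintype K] (s : K → List Sym) (k : K) (w : List Sym)
    (h : w.length ≤ (s k).length + 1) : size (Function.update s k w) ≤ size s + 1 := by
  unfold size
  rw [← Finset.add_sum_erase _ _ (Finset.mem_univ k),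
    ← Finset.add_sum_erase (a := k) Finset.univ (fun k => (s k).length) (Finset.mem_univ k),
    Function.update_self, Finset.sum_congr rfl (g := fun k => (s k).length)]
  · omega
  · intro j hj
    rw [Function.update_of_ne (Finset.ne_of_mem_erase hj)]

/-- Every statement produced by `code` contains at most one push before its jump. -/
theorem size_stepAux_code_le [Fintype K] {Λ : Type} (c : Cmd K) (ι : Pos c → Λ) (e : Λ)
    (p : Pos c) (v : Option Sym) (s : K → List Sym) :
    size (Turing.TM2.stepAux (code c ι e p) v s).stk ≤ size s + 1 := by
  induction c generalizing e with
  | skip => exact Nat.le_succ _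
  | push k x => exact size_update_le _ _ _ (by simp)
  | pop k => exact size_update_le _ _ _ (by simp only [List.length_tail]; omega)
  | seq a b iha ihb =>
    rcases p with p | p
    · exact iha _ _ _
    · exact ihb _ _ _
  | case k f ih =>
    rcases p with p | ⟨o, p⟩
    · exact Nat.le_succ _
    · exact ih o _ _ _
  | loop k P c ih =>
    rcases p with p | p
    · exact Nat.le_succ _
    · exact ih _ _ _

theorem StepsTo.size_le [Fintype K] {Λ : Type}
    {m : Λ → Turing.TM2.Stmt (fun _ : K => Sym) Λ (Option Sym)}
    (hm : ∀ p v s, size (Turing.TM2.stepAux (m p) v s).stk ≤ size s + 1) {t : ℕ}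
    {a b : Turing.TM2.Cfg (fun _ : K => Sym) Λ (Option Sym)} (h : StepsTo m t a b) :
    size b.stk ≤ size a.stk + t := by
  induction t generalizing a with
  | zero => cases h; rfl
  | succ t ih =>
    obtain ⟨d, hd, h⟩ := h
    have h1 := ih h
    rcases a with ⟨_ | l, v, s⟩
    · cases hd
    · simp only [Turing.TM2.step, Option.some.injEq] at hd
      have h2 := hm l v s
      rw [hd] at h2
      simp only
      omega

theorem size_single [Fintype K] (k : K) (w : List Sym) : size (single k w) = w.length := by
  unfold size single
  rw [Finset.sum_eq_single k (by intro j _ hj; simp [Function.update_of_ne hj]) (by simp)]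
  simp

theorem startCfg_machine [Fintype K] (c : Cmd K) (k₀ k₁ : K) (inp : List Sym) :
    startCfg (machine c k₀ k₁) inp =
      (⟨some (some (entry c)), none, single k₀ inp⟩ :
        Turing.TM2.Cfg (fun _ : K => Sym) (Option (Pos c)) (Option Sym)) := by
  have : (fun k => @dite (List Sym) (k = k₀) (inferInstance) (fun h => List.map id inp)
      fun _ => []) = single k₀ inp := by
    funext k
    by_cases h : k = k₀
    · subst h
      simp [single]
    · simp [single, h]
  rw [← this]
  rfl

theorem haltList_machine [Fintype K] (c : Cmd K) (k₀ k₁ : K) (out : List Sym) :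
    Turing.haltList (machine c k₀ k₁).tm out =
      (⟨none, none, single k₁ out⟩ :
        Turing.TM2.Cfg (fun _ : K => Sym) (Option (Pos c)) (Option Sym)) := by
  have : (fun k => @dite (List Sym) (k = k₁) (inferInstance) (fun h => out)
      fun _ => []) = single k₁ out := by
    funext k
    by_cases h : k = k₁
    · subst h
      simp [single]
    · simp [single, h]
  rw [← this]
  rfl

theorem Runs.stepsTo_transition {c : Cmd K} {k₀ k₁ : K} {inp out : List Sym} {t : ℕ}
    (h : Runs c (single k₀ inp) t (single k₁ out)) :
    StepsTo (transition c) (t + 1) ⟨some (some (entry c)), none, single k₀ inp⟩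
      ⟨none, none, single k₁ out⟩ := by
  obtain ⟨v', h'⟩ := h.stepsTo (m := transition c) some none (fun p => rfl) none
  -- The additional step is the halting statement, which also resets the local variable as a halting
  -- configuration requires.
  exact h'.trans ⟨_, rfl, rfl⟩

theorem Runs.outputsInTime [Fintype K] {c : Cmd K} {k₀ k₁ : K} {inp out : List Sym} {t : ℕ}
    (h : Runs c (single k₀ inp) t (single k₁ out)) :
    OutputsInTime (machine c k₀ k₁) inp out (t + 1) := by
  refine ⟨⟨⟨t + 1, ?_⟩, le_rfl⟩⟩
  have h3 : Option.map (Turing.haltList (machine c k₀ k₁).tm)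
      (some (List.map (machine c k₀ k₁).outputAlphabet.symm out)) =
      some (⟨none, none, single k₁ out⟩ :
        Turing.TM2.Cfg (fun _ : K => Sym) (Option (Pos c)) (Option Sym)) := by
    rw [← haltList_machine c k₀ k₁ out]
    exact congrArg (fun w => some (Turing.haltList (machine c k₀ k₁).tm w)) (List.map_id out)
  rw [h3]
  refine Eq.trans ?_ h.stepsTo_transition.iterate
  exact congrArg (fun x => (flip bind (Turing.TM2.step (transition c)))^[t + 1] (some x))
    (startCfg_machine c k₀ k₁ inp)

/-- Space is bounded by input length plus time. This crude bound suffices because the enumerating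
program runs in time `O(k log N)`, not merely in polynomial time. -/
theorem Runs.usesSpace [Fintype K] {c : Cmd K} {k₀ k₁ : K} {inp out : List Sym} {t : ℕ}
    (h : Runs c (single k₀ inp) t (single k₁ out)) :
    UsesSpace (machine c k₀ k₁) inp (inp.length + (t + 1)) := by
  intro b hb
  rw [startCfg_machine] at hb
  obtain ⟨i, hi, h'⟩ := h.stepsTo_transition.of_reaches rfl hb
  have h2 := h'.size_le (by
    rintro (_ | p) v s
    · exact Nat.le_succ _
    · exact size_stepAux_code_le c _ _ _ _ _)
  have h4 := size_single k₀ inp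
  have h3 : cells (machine c k₀ k₁) b = size (K := K) b.stk := rfl
  change _ ≤ size (single k₀ inp) + i at h2
  exact h3.le.trans (h2.trans (by omega))

end Cmd
end GaussianNet

/-! ### Subroutines with time bounds: copying, unary doubling, binary addition. -/

namespace GaussianNet
namespace Cmd

variable {K : Type} [DecidableEq K]

/-- `RunsIn c s T s'`: started on the stacks `s`, the program `c` ends after at most `T` steps with
the stacks `s'`. -/
def RunsIn (c : Cmd K) (s : K → List Sym) (T : ℕ) (s' : K → List Sym) : Prop :=
  ∃ t ≤ T, Runs c s t s'

theorem RunsIn.mono {c : Cmd K} {s s' : K → List Sym} {T T' : ℕ} (h : RunsIn c s T s')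
    (hT : T ≤ T') : RunsIn c s T' s' := by
  obtain ⟨t, ht, h⟩ := h
  exact ⟨t, ht.trans hT, h⟩

theorem RunsIn.congr {c : Cmd K} {s s' s'' : K → List Sym} {T T' : ℕ} (h : RunsIn c s T s')
    (hs : s' = s'') (hT : T ≤ T') : RunsIn c s T' s'' := hs ▸ h.mono hT

theorem runsIn_skip (s : K → List Sym) : RunsIn skip s 1 s := ⟨1, le_rfl, .skip s⟩

theorem runsIn_push (k : K) (x : Sym) (s : K → List Sym) :
    RunsIn (push k x) s 1 (Function.update s k (x :: s k)) := ⟨1, le_rfl, .push k x s⟩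

theorem runsIn_pop (k : K) (s : K → List Sym) :
    RunsIn (pop k) s 1 (Function.update s k (s k).tail) := ⟨1, le_rfl, .pop k s⟩

theorem RunsIn.seq {a b : Cmd K} {s s' s'' : K → List Sym} {T T' : ℕ} (h : RunsIn a s T s')
    (h' : RunsIn b s' T' s'') : RunsIn (seq a b) s (T + T') s'' := by
  obtain ⟨t, ht, h⟩ := h
  obtain ⟨t', ht', h'⟩ := h'
  exact ⟨t + t', by omega, .seq h h'⟩

theorem RunsIn.case {k : K} {f : Option Sym → Cmd K} {s s' : K → List Sym} {T : ℕ}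
    {o : Option Sym} (ho : (s k).head? = o) (h : RunsIn (f o) s T s') :
    RunsIn (case k f) s (T + 1) s' := by
  subst ho
  obtain ⟨t, ht, h⟩ := h
  exact ⟨t + 1, by omega, .case h⟩

/-- Loop rule: `inv i` is the state after `i` rounds. Each round costs its body and one test, and
the failing test adds one more step. -/
theorem runsIn_loop {k : K} {P : Option Sym → Bool} {c : Cmd K} {s : K → List Sym}
    (inv : ℕ → K → List Sym) (n T : ℕ) (h0 : inv 0 = s)
    (hgo : ∀ i < n, P (inv i k).head? = true ∧ RunsIn c (inv i) T (inv (i + 1)))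
    (hend : P (inv n k).head? = false) :
    RunsIn (loop k P c) s (n * (T + 1) + 1) (inv n) := by
  subst h0
  suffices h : ∀ j ≤ n, RunsIn (loop k P c) (inv (n - j)) (j * (T + 1) + 1) (inv n) by
    simpa using h n le_rfl
  intro j
  induction j with
  | zero => intro _; exact ⟨1, by omega, .loop_end hend⟩
  | succ j ih =>
    intro hj
    obtain ⟨hP, t, ht, h⟩ := hgo (n - (j + 1)) (by omega)
    obtain ⟨t', ht', h'⟩ := ih (by omega)
    rw [show n - (j + 1) + 1 = n - j by omega] at h
    refine ⟨_, ?_, .loop_go hP h h'⟩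
    rw [Nat.succ_mul]
    omega

theorem reverse_take_succ {α : Type*} (l : List α) {i : ℕ} (hi : i < l.length) :
    (l.take (i + 1)).reverse = l[i] :: (l.take i).reverse := by
  rw [List.take_add_one, List.getElem?_eq_getElem hi]
  simp

/-- Move one stack onto another, reversing it. -/
def mv (a b : K) : Cmd K :=
  loop a Option.isSome (case a fun
    | some x => seq (pop a) (push b x)
    | none => skip)

theorem runsIn_mv {a b : K} (hab : a ≠ b) (s : K → List Sym) :
    RunsIn (mv a b) s (4 * (s a).length + 1)
      (Function.update (Function.update s a []) b ((s a).reverse ++ s b)) := by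
  have h := runsIn_loop (s := s) (k := a) (P := Option.isSome) (c := case a fun
    | some x => seq (pop a) (push b x)
    | none => skip)
    (fun i => Function.update (Function.update s a ((s a).drop i)) b
      (((s a).take i).reverse ++ s b)) (s a).length 3 (by simp) (by
      intro i hi
      refine ⟨by simp [Function.update_of_ne hab, hi], ?_⟩
      refine (RunsIn.case (o := some (s a)[i]) (by simp [Function.update_of_ne hab, hi])
        ((runsIn_pop _ _).seq (runsIn_push _ _ _))).congr ?_ le_rfl
      funext k
      by_cases h1 : k = b
      · subst h1
        simp [Function.update_of_ne hab.symm, reverse_take_succ _ hi]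
      · by_cases h2 : k = a
        · subst h2
          simp [h1]
        · simp [h1, h2]) (by simp [Function.update_of_ne hab])
  refine (h.congr ?_ ?_)
  all_goals simp [mul_comm]

/-- Move one stack onto another, reversing it, and put a copy in its place. -/
def unmv (t a b : K) : Cmd K :=
  loop t Option.isSome (case t fun
    | some x => seq (pop t) (seq (push a x) (push b x))
    | none => skip)

theorem runsIn_unmv {t a b : K} (hta : t ≠ a) (htb : t ≠ b) (hab : a ≠ b) (s : K → List Sym) :
    RunsIn (unmv t a b) s (5 * (s t).length + 1)
      (Function.update (Function.update (Function.update s t []) a ((s t).reverse ++ s a)) b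
        ((s t).reverse ++ s b)) := by
  have h := runsIn_loop (s := s) (k := t) (P := Option.isSome) (c := case t fun
    | some x => seq (pop t) (seq (push a x) (push b x))
    | none => skip)
    (fun i => Function.update (Function.update (Function.update s t ((s t).drop i)) a
      (((s t).take i).reverse ++ s a)) b (((s t).take i).reverse ++ s b)) (s t).length 4 (by simp) (by
      intro i hi
      refine ⟨by simp [Function.update_of_ne htb, Function.update_of_ne hta, hi], ?_⟩
      refine (RunsIn.case (o := some (s t)[i])
        (by simp [Function.update_of_ne htb, Function.update_of_ne hta, hi])
        ((runsIn_pop _ _).seq ((runsIn_push _ _ _).seq (runsIn_push _ _ _)))).congr ?_ le_rfl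
      funext k
      by_cases h1 : k = b
      · subst h1
        simp [Function.update_of_ne htb.symm, Function.update_of_ne hab.symm, reverse_take_succ _ hi]
      · by_cases h2 : k = a
        · subst h2
          simp [h1, Function.update_of_ne hta.symm, reverse_take_succ _ hi]
        · by_cases h3 : k = t
          · subst h3
            simp [h1, h2]
          · simp [h1, h2, h3]) (by simp [Function.update_of_ne htb, Function.update_of_ne hta])
  refine (h.congr ?_ ?_)
  all_goals simp [mul_comm]

/-- Copy the stack `a` onto `b`, by means of the empty stack `t`. -/
def cp (a b t : K) : Cmd K := seq (mv a t) (unmv t a b)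

theorem runsIn_cp {a b t : K} (hab : a ≠ b) (hta : t ≠ a) (htb : t ≠ b) (s : K → List Sym)
    (ht : s t = []) :
    RunsIn (cp a b t) s (9 * (s a).length + 2) (Function.update s b (s a ++ s b)) := by
  refine ((runsIn_mv hta.symm s).seq (runsIn_unmv hta htb hab _)).congr ?_ ?_
  · funext k
    by_cases h1 : k = b
    · subst h1
      simp [Function.update_of_ne htb.symm, Function.update_of_ne hab.symm, ht]
    · by_cases h2 : k = a
      · subst h2
        simp [h1, Function.update_of_ne hta.symm, ht]
      · by_cases h3 : k = t
        · subst h3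
          simp [h1, h2, ht]
        · simp [h1, h2, h3]
  · simp [ht]
    omega

/-- Empty a stack. -/
def clear (a : K) : Cmd K := loop a Option.isSome (pop a)

theorem runsIn_clear (a : K) (s : K → List Sym) :
    RunsIn (clear a) s (2 * (s a).length + 1) (Function.update s a []) := by
  have h := runsIn_loop (s := s) (k := a) (P := Option.isSome) (c := pop a)
    (fun i => Function.update s a ((s a).drop i)) (s a).length 1 (by simp) (by
      intro i hi
      refine ⟨by simp [hi], (runsIn_pop _ _).congr ?_ le_rfl⟩
      simp) (by simp)
  refine (h.congr ?_ ?_)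
  all_goals simp [mul_comm]

/-- Push `n` copies of a symbol. -/
def pushN (k : K) (x : Sym) : ℕ → Cmd K
  | 0 => skip
  | n + 1 => seq (push k x) (pushN k x n)

theorem runsIn_pushN (k : K) (x : Sym) (n : ℕ) (s : K → List Sym) :
    RunsIn (pushN k x n) s (n + 1) (Function.update s k (List.replicate n x ++ s k)) := by
  induction n generalizing s with
  | zero => exact (runsIn_skip s).congr (by simp) le_rfl
  | succ n ih =>
    refine ((runsIn_push k x s).seq (ih _)).congr ?_ (by omega)
    simp [List.replicate_succ']

/-- Double the height of a stack of separators, by means of the empty stack `t`. -/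
def dbl (a t : K) : Cmd K :=
  seq (loop a Option.isSome (seq (pop a) (seq (push t .sep) (push t .sep)))) (mv t a)

/-- A number in unary. -/
def unary (n : ℕ) : List Sym := List.replicate n Sym.sep

@[simp] theorem length_unary (n : ℕ) : (unary n).length = n := List.length_replicate

@[simp] theorem unary_zero : unary 0 = [] := rfl

theorem unary_succ (n : ℕ) : unary (n + 1) = Sym.sep :: unary n := rfl

@[simp] theorem unary_append (m n : ℕ) : unary m ++ unary n = unary (m + n) := by
  simp [unary]

@[simp] theorem unary_reverse (n : ℕ) : (unary n).reverse = unary n := by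
  simp [unary]

@[simp] theorem unary_tail (n : ℕ) : (unary n).tail = unary (n - 1) := by
  simp [unary]

theorem head?_unary (n : ℕ) : (unary n).head? = if n = 0 then none else some Sym.sep := by
  simp [unary, List.head?_replicate]

theorem runsIn_dbl {a t : K} (hat : a ≠ t) (s : K → List Sym) (n : ℕ) (ha : s a = unary n)
    (ht : s t = []) :
    RunsIn (dbl a t) s (12 * n + 2) (Function.update s a (unary (2 * n))) := by
  have h := runsIn_loop (s := s) (k := a) (P := Option.isSome)
    (c := seq (pop a) (seq (push t .sep) (push t .sep)))
    (fun i => Function.update (Function.update s a (unary (n - i))) t (unary (2 * i))) n 3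
    (by rw [Nat.sub_zero, ← ha, Function.update_eq_self, Nat.mul_zero, unary_zero, ← ht,
      Function.update_eq_self]) (by
      intro i hi
      refine ⟨by simp [hat, head?_unary]; omega, ?_⟩
      refine ((runsIn_pop _ _).seq ((runsIn_push _ _ _).seq (runsIn_push _ _ _))).congr ?_ le_rfl
      funext k
      by_cases h1 : k = t
      · subst h1
        simp [hat.symm, ← unary_succ, show 2 * (i + 1) = 2 * i + 1 + 1 by ring]
      · by_cases h2 : k = a
        · subst h2
          simp [h1]
          congr 1
        · simp [h1, h2]) (by simp [hat])
  refine (h.seq (runsIn_mv hat.symm _)).congr ?_ ?_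
  · funext k
    by_cases h1 : k = t
    · subst h1
      simp [hat.symm, ht]
    · by_cases h2 : k = a
      · subst h2
        simp [h1]
      · simp [h1, h2]
  · simp
    omega

/-- Repeat a program a fixed number of times. -/
def rep (c : Cmd K) : ℕ → Cmd K
  | 0 => skip
  | n + 1 => seq c (rep c n)

/-- The value of a list of bits, least significant first. -/
def bval : List Bool → ℕ
  | [] => 0
  | b :: l => b.toNat + 2 * bval l

/-- The carry and the sum bit of the addition of three bits. -/
def maj (a b c : Bool) : Bool := (a && b) || (c && (a || b))

/-- Binary addition, as long as the second number. -/
def addBits (c : Bool) : List Bool → List Bool → List Bool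
  | _, [] => [c]
  | A, b :: B => (A.headD false ^^ b ^^ c) :: addBits (maj (A.headD false) b c) A.tail B

theorem length_addBits (c : Bool) (A B : List Bool) : (addBits c A B).length = B.length + 1 := by
  induction B generalizing A c with
  | nil => rfl
  | cons b B ih => simp [addBits, ih]

/-- The recursion follows the second number only, so the first must not be longer; its missing bits
count as zero. -/
theorem bval_addBits (c : Bool) (A B : List Bool) (h : A.length ≤ B.length) :
    bval (addBits c A B) = c.toNat + bval A + bval B := by
  induction B generalizing A c with
  | nil =>
    have : A = [] := List.length_eq_zero_iff.1 (by simpa using h)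
    subst this
    simp [addBits, bval]
  | cons b B ih =>
    have h2 := ih (maj (A.headD false) b c) A.tail (by simp at h ⊢; omega)
    rw [addBits, bval, h2]
    rcases A with _ | ⟨a, A⟩
    · cases b <;> cases c <;> simp [bval, maj] <;> ring
    · cases a <;> cases b <;> cases c <;> simp [bval, maj] <;> ring

/-- A bit read from a stack; `false` stands for anything else. -/
def toBit (o : Option Sym) : Bool := o = some (Sym.bit true)

/-- A list of bits as a word. -/
def word (l : List Bool) : List Sym := l.map Sym.bit

@[simp] theorem word_nil : word [] = [] := rfl
@[simp] theorem word_cons (b : Bool) (l : List Bool) : word (b :: l) = Sym.bit b :: word l := rfl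
@[simp] theorem length_word (l : List Bool) : (word l).length = l.length := List.length_map _
@[simp] theorem word_append (l l' : List Bool) : word (l ++ l') = word l ++ word l' :=
  List.map_append
@[simp] theorem word_reverse (l : List Bool) : word l.reverse = (word l).reverse :=
  List.map_reverse
@[simp] theorem word_drop (l : List Bool) (n : ℕ) : word (l.drop n) = (word l).drop n :=
  List.map_drop
@[simp] theorem word_take (l : List Bool) (n : ℕ) : word (l.take n) = (word l).take n :=
  List.map_take
@[simp] theorem word_tail (l : List Bool) : (word l).tail = word l.tail :=
  List.map_tail.symm
@[simp] theorem toBit_head?_word (l : List Bool) : toBit (word l).head? = l.headD false := by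
  rcases l with _ | ⟨_ | _, l⟩ <;> simp [toBit]

/-- Add the binary numbers on `A` and `B` and push the sum onto `R`, most significant bit on top;
`Cy` holds the carry. -/
def add (A B R Cy : K) : Cmd K :=
  seq (push Cy (.bit false))
    (seq (loop B Option.isSome (case A fun a => case B fun b => case Cy fun c =>
      seq (pop A) (seq (pop B) (seq (pop Cy) (seq
        (push R (.bit (toBit a ^^ toBit b ^^ toBit c)))
        (push Cy (.bit (maj (toBit a) (toBit b) (toBit c)))))))))
    (seq (case Cy fun
      | some c => push R c
      | none => skip) (pop Cy)))

/-- The last bit `cy'` of the sum is split off because it is still on `Cy` when the loop stops;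
`add` pushes it onto `R` afterwards. -/
theorem runsIn_add_loop {A B R Cy : K} (h1 : A ≠ B) (h2 : A ≠ R) (h3 : A ≠ Cy) (h4 : B ≠ R)
    (h5 : B ≠ Cy) (h6 : R ≠ Cy) (la lb : List Bool) (cy : Bool) (s : K → List Sym)
    (hA : s A = word la) (hB : s B = word lb) (hC : s Cy = [.bit cy]) :
    ∃ cy' l, addBits cy la lb = l ++ [cy'] ∧
    RunsIn (loop B Option.isSome (case A fun a => case B fun b => case Cy fun c =>
      seq (pop A) (seq (pop B) (seq (pop Cy) (seq
        (push R (.bit (toBit a ^^ toBit b ^^ toBit c)))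
        (push Cy (.bit (maj (toBit a) (toBit b) (toBit c)))))))))
      s (9 * lb.length + 1)
      (Function.update (Function.update (Function.update (Function.update s A
        (word (la.drop lb.length))) B []) R ((word l).reverse ++ s R)) Cy [.bit cy']) := by
  induction lb generalizing la cy s with
  | nil =>
    refine ⟨cy, [], rfl, 1, le_rfl, ?_⟩
    refine (congrArg (Runs _ s 1) ?_).mp (Runs.loop_end (s := s) (by rw [hB]; rfl))
    funext k
    by_cases e1 : k = Cy
    · subst e1; simp [hC]
    by_cases e2 : k = R
    · subst e2; simp [e1]
    by_cases e3 : k = B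
    · subst e3; simp [e1, e2, hB]
    by_cases e4 : k = A
    · subst e4; simp [e1, e2, e3, hA]
    simp [e1, e2, e3, e4]
  | cons b lb ih =>
    have hbody := RunsIn.case (k := A) (s := s) (f := fun a => case B fun b => case Cy fun c =>
      seq (pop A) (seq (pop B) (seq (pop Cy) (seq
        (push R (.bit (toBit a ^^ toBit b ^^ toBit c)))
        (push Cy (.bit (maj (toBit a) (toBit b) (toBit c)))))))) rfl
      (RunsIn.case rfl (RunsIn.case rfl ((runsIn_pop _ _).seq ((runsIn_pop _ _).seq
      ((runsIn_pop _ _).seq ((runsIn_push _ _ _).seq (runsIn_push _ _ _)))))))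
    set s1 : K → List Sym := Function.update (Function.update (Function.update (Function.update s A
        (word la.tail)) B (word lb)) R (.bit (la.headD false ^^ b ^^ cy) :: s R)) Cy
        [.bit (maj (la.headD false) b cy)] with hs1
    have hbody' := hbody.congr (s'' := s1) (by
      have t1 : toBit (s A).head? = la.headD false := by rw [hA, toBit_head?_word]
      have t2 : toBit (s B).head? = b := by rw [hB, toBit_head?_word]; rfl
      have t3 : toBit (s Cy).head? = cy := by rw [hC]; cases cy <;> simp [toBit]
      rw [t1, t2, t3, hs1]
      funext k
      by_cases e1 : k = Cy
      · subst e1; simp [hC, h6.symm, h5.symm, h3.symm]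
      by_cases e2 : k = R
      · subst e2; simp [e1, h4.symm, h2.symm]
      by_cases e3 : k = B
      · subst e3; simp [e1, e2, hB, h1.symm]
      by_cases e4 : k = A
      · subst e4; simp [e1, e2, e3, hA]
      simp [e1, e2, e3, e4]) le_rfl
    obtain ⟨cy', l, hl, t', ht', hr⟩ := ih la.tail (maj (la.headD false) b cy) s1
      (by simp [hs1, h1, h2, h3]) (by simp [hs1, h4, h5]) (by simp [hs1])
    obtain ⟨t, ht, hb⟩ := hbody'
    refine ⟨cy', (la.headD false ^^ b ^^ cy) :: l, by rw [addBits, hl, List.cons_append], t + t' + 1, ?_,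
      Runs.loop_go (by simp [hB]) hb ?_⟩
    · simp
      omega
    · convert hr using 1
      funext k
      by_cases e1 : k = Cy
      · subst e1; simp
      by_cases e2 : k = R
      · subst e2; simp [e1, hs1]
      by_cases e3 : k = B
      · subst e3; simp [e1, e2]
      by_cases e4 : k = A
      · subst e4; simp [e1, e2, e3]
      simp [e1, e2, e3, e4, hs1]

theorem runsIn_add {A B R Cy : K} (h1 : A ≠ B) (h2 : A ≠ R) (h3 : A ≠ Cy) (h4 : B ≠ R)
    (h5 : B ≠ Cy) (h6 : R ≠ Cy) (la lb : List Bool) (hle : la.length ≤ lb.length)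
    (s : K → List Sym) (hA : s A = word la) (hB : s B = word lb) (hC : s Cy = []) :
    RunsIn (add A B R Cy) s (9 * lb.length + 5)
      (Function.update (Function.update (Function.update s A []) B []) R
        ((word (addBits false la lb)).reverse ++ s R)) := by
  obtain ⟨cy', l, hl, h⟩ := runsIn_add_loop h1 h2 h3 h4 h5 h6 la lb false
    (Function.update s Cy [.bit false]) (by simp [h3, hA]) (by simp [h5, hB]) (by simp)
  have hp := (runsIn_push Cy (.bit false) s)
  rw [hC] at hp
  refine (hp.seq (h.seq ((RunsIn.case (o := some (.bit cy')) (by simp)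
    (runsIn_push _ _ _)).seq (runsIn_pop _ _)))).congr ?_ (by omega)
  rw [hl]
  funext k
  by_cases e1 : k = Cy
  · subst e1; simp [h3.symm, h5.symm, h6.symm, hC]
  by_cases e2 : k = R
  · subst e2; simp [e1]
  by_cases e3 : k = B
  · subst e3; simp [e1, e2]
  by_cases e4 : k = A
  · subst e4; simp [e1, e2, e3, hle]
  simp [e1, e2, e3, e4]

end Cmd
end GaussianNet

namespace GaussianNet

/-! ### Enumeration of a down-set by an odometer -/

/-- `Orbit next o L o'`: iterating `next` from `o` one runs through `L` and arrives at `o'`. -/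
def Orbit {α : Type*} (next : α → Option α) : Option α → List α → Option α → Prop
  | o, [], o' => o = o'
  | o, a :: L, o' => o = some a ∧ Orbit next (next a) L o'

theorem Orbit.append {α : Type*} {next : α → Option α} {o o' o'' : Option α} {L L' : List α}
    (h : Orbit next o L o') (h' : Orbit next o' L' o'') : Orbit next o (L ++ L') o'' := by
  induction L generalizing o with
  | nil => cases h; exact h'
  | cons a L ih => exact ⟨h.1, ih h.2⟩

theorem Orbit.unique {α : Type*} {next : α → Option α} {o : Option α} {L L' : List α}
    (h : Orbit next o L none) (h' : Orbit next o L' none) : L = L' := by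
  induction L generalizing o L' with
  | nil =>
    cases h
    cases L' with
    | nil => rfl
    | cons a L' => exact absurd h'.1 (by simp)
  | cons a L ih =>
    obtain ⟨rfl, h⟩ := h
    cases L' with
    | nil => exact absurd h' (by simp [Orbit])
    | cons b L' =>
      obtain ⟨h1, h'⟩ := h'
      cases h1
      rw [ih h h']

theorem Orbit.suffix {α : Type*} {next : α → Option α} {o : Option α} {L L' : List α} {a : α}
    (h : Orbit next o (L ++ a :: L') none) : Orbit next (next a) L' none := by
  induction L generalizing o with
  | nil => exact h.2
  | cons b L ih => exact ih h.2

/-- The rest of the list after an entry `a` is the orbit of `next a` down to `none`, hence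
determined by `a`. A second occurrence of `a` would give two such rests of different lengths. -/
theorem Orbit.nodup {α : Type*} {next : α → Option α} {o : Option α} {L : List α}
    (h : Orbit next o L none) : L.Nodup := by
  induction L generalizing o with
  | nil => exact List.nodup_nil
  | cons a L ih =>
    refine List.nodup_cons.2 ⟨fun ha => ?_, ih h.2⟩
    obtain ⟨s, t, rfl⟩ := List.append_of_mem ha
    have h1 := h.2.suffix.unique h.2
    have h2 := congrArg List.length h1
    simp at h2
    omega

theorem Orbit.getElem?_zero {α : Type*} {next : α → Option α} {o : Option α} {L : List α}
    (h : Orbit next o L none) : L[0]? = o := by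
  cases L with
  | nil => cases h; rfl
  | cons a L => rw [h.1]; rfl

theorem Orbit.getElem?_succ {α : Type*} {next : α → Option α} {o : Option α} {L : List α}
    (h : Orbit next o L none) {i : ℕ} {a : α} (hi : L[i]? = some a) : L[i + 1]? = next a := by
  induction L generalizing o i with
  | nil => simp at hi
  | cons b L ih =>
    cases i with
    | zero =>
      simp only [List.getElem?_cons_zero, Option.some.injEq] at hi
      subst hi
      simpa using h.2.getElem?_zero
    | succ i => simpa using ih h.2 (by simpa using hi)

/-- The length of the code of the coordinate with index `u`. -/
def cost (l u : ℕ) : ℕ := Nat.size (u / 2) + l + 5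

/-- The total length of the codes of the coordinates of a point. -/
def costs (l : ℕ) (v : List ℕ) : ℕ := (v.map (cost l)).sum

@[simp] theorem costs_nil (l : ℕ) : costs l [] = 0 := rfl
@[simp] theorem costs_cons (l u : ℕ) (v : List ℕ) : costs l (u :: v) = cost l u + costs l v := by
  simp [costs]

theorem cost_mono (l : ℕ) {u u' : ℕ} (h : u ≤ u') : cost l u ≤ cost l u' := by
  unfold cost
  have := Nat.size_le_size (Nat.div_le_div_right (c := 2) h)
  omega

theorem cost_zero (l : ℕ) : cost l 0 = l + 5 := by simp [cost]

/-- `u` is an admissible first coordinate before the coordinates `r`. -/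
def Fits (l cap Q u : ℕ) (r : List ℕ) : Prop :=
  Nat.size (u / 2) ≤ cap ∧ cost l u + costs l r ≤ Q

instance (l cap Q u : ℕ) (r : List ℕ) : Decidable (Fits l cap Q u r) :=
  inferInstanceAs (Decidable (_ ∧ _))

theorem Fits.of_le {l cap Q u u' : ℕ} {r : List ℕ} (h : Fits l cap Q u r) (hu : u' ≤ u) :
    Fits l cap Q u' r :=
  ⟨(Nat.size_le_size (Nat.div_le_div_right hu)).trans h.1,
    (Nat.add_le_add_right (cost_mono l hu) _).trans h.2⟩

/-- The successor of a point: the first coordinate that can be increased is increased, and those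
before it are reset. -/
def next (l cap : ℕ) : ℕ → List ℕ → Option (List ℕ)
  | _, [] => none
  | Q, u :: r =>
    if Fits l cap Q (u + 1) r then some ((u + 1) :: r)
    else (next l cap (Q - cost l 0) r).map (0 :: ·)

/-- The admissible points with `k` coordinates. -/
def Adm (l cap Q k : ℕ) (v : List ℕ) : Prop :=
  v.length = k ∧ (∀ u ∈ v, Nat.size (u / 2) ≤ cap) ∧ costs l v ≤ Q

/-- `Fits` is inherited by smaller `u` and the cap makes it fail eventually, so the admissible first
coordinates form an initial segment of `ℕ`. -/
theorem exists_fits_iff (l cap Q : ℕ) (r : List ℕ) :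
    ∃ m, ∀ u, Fits l cap Q u r ↔ u < m := by
  have hb : ∃ m, ¬ Fits l cap Q m r := by
    refine ⟨2 * 2 ^ cap, fun h => ?_⟩
    have := Nat.size_le.1 h.1
    omega
  classical
  refine ⟨Nat.find hb, fun u => ⟨fun h => ?_, fun h => ?_⟩⟩
  · by_contra hu
    exact Nat.find_spec hb (h.of_le (not_lt.1 hu))
  · by_contra hu
    exact Nat.find_min hb h hu

theorem orbit_range {l cap Q : ℕ} {r : List ℕ} {m : ℕ} (hm : ∀ u, Fits l cap Q u r ↔ u < m)
    (j : ℕ) (hj : 0 < j) (hjm : j ≤ m) :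
    Orbit (next l cap Q) (some ((m - j) :: r)) ((List.range' (m - j) j).map (· :: r))
      ((next l cap (Q - cost l 0) r).map (0 :: ·)) := by
  induction j with
  | zero => omega
  | succ j ih =>
    rw [List.range'_succ, List.map_cons]
    refine ⟨rfl, ?_⟩
    rcases Nat.eq_zero_or_pos j with rfl | hj0
    · have : ¬ Fits l cap Q (m - (0 + 1) + 1) r := by rw [hm]; omega
      rw [next, if_neg this]
      rfl
    · have : Fits l cap Q (m - (j + 1) + 1) r := by rw [hm]; omega
      rw [next, if_pos this, show m - (j + 1) + 1 = m - j by omega]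
      exact ih hj0 (by omega)

/-- Induction on the number of coordinates: above each tail `r`, in the order of the tails, the
first coordinate runs through its initial segment, after which the odometer resets it and advances
`r`. -/
theorem exists_orbit (l cap : ℕ) (k Q : ℕ) (hQ : k * cost l 0 ≤ Q) :
    ∃ L : List (List ℕ), Orbit (next l cap Q) (some (List.replicate k 0)) L none ∧
      ∀ v, v ∈ L ↔ Adm l cap Q k v := by
  induction k generalizing Q with
  | zero =>
    refine ⟨[[]], ⟨rfl, rfl⟩, fun v => ?_⟩
    simp only [List.mem_singleton, Adm, List.length_eq_zero_iff]
    constructor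
    · rintro rfl
      simp
    · exact fun h => h.1
  | succ k ih =>
    rw [Nat.succ_mul] at hQ
    obtain ⟨L, hL, hmem⟩ := ih (Q - cost l 0) (by omega)
    choose m hm using exists_fits_iff l cap Q
    have key : ∀ (L : List (List ℕ)) (o : Option (List ℕ)),
        (∀ r ∈ L, costs l r ≤ Q - cost l 0) → Orbit (next l cap (Q - cost l 0)) o L none →
        Orbit (next l cap Q) (o.map (0 :: ·))
          (L.flatMap fun r => (List.range' 0 (m r)).map (· :: r)) none := by
      intro L
      induction L with
      | nil =>
        intro o _ h
        cases h
        rfl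
      | cons r L ih =>
        intro o hr h
        obtain ⟨rfl, h⟩ := h
        rw [List.flatMap_cons]
        -- The tails are enumerated with the budget `Q - cost l 0`, which leaves just enough for a
        -- first coordinate `0`. So no block is empty, and the reset in `next` lands on an
        -- admissible point.
        have h0 : Fits l cap Q 0 r := ⟨by simp, by
          have := hr r (by simp)
          omega⟩
        have hpos := (hm r 0).1 h0
        refine Orbit.append ?_ (ih _ (fun r' hr' => hr r' (List.mem_cons_of_mem _ hr')) h)
        simpa using orbit_range (hm r) (m r) hpos le_rfl
    refine ⟨_, key L _ (fun r hr => ((hmem r).1 hr).2.2) hL, fun v => ?_⟩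
    simp only [List.mem_flatMap, List.mem_map, List.mem_range'_1, Nat.zero_le, true_and, zero_add,
      ← hm, hmem]
    constructor
    · rintro ⟨r, hr, u, hu, rfl⟩
      refine ⟨by simp [hr.1], ?_, by simpa using hu.2⟩
      simp only [List.mem_cons, forall_eq_or_imp]
      exact ⟨hu.1, hr.2.1⟩
    · rintro ⟨h1, h2, h3⟩
      rcases v with _ | ⟨u, r⟩
      · simp at h1
      · simp only [List.mem_cons, forall_eq_or_imp, costs_cons] at h2 h3
        have := cost_mono l (Nat.zero_le u)
        exact ⟨r, ⟨by simpa using h1, h2.2, by omega⟩, u, ⟨h2.1, h3⟩, rfl⟩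

/-! ### Binary expansions -/

theorem bits_two_mul {a : ℕ} (h : a ≠ 0) : Nat.bits (2 * a) = false :: Nat.bits a := by
  simpa using Nat.bit0_bits a h

theorem bits_two_mul_add_one (a : ℕ) : Nat.bits (2 * a + 1) = true :: Nat.bits a := by
  simp

/-- Binary increment. -/
theorem bits_succ (a : ℕ) : ∃ j,
    (Nat.bits a = List.replicate j true ∧
      Nat.bits (a + 1) = List.replicate j false ++ [true]) ∨
    ∃ r, Nat.bits a = List.replicate j true ++ false :: r ∧
      Nat.bits (a + 1) = List.replicate j false ++ true :: r := by
  induction a using Nat.strong_induction_on with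
  | _ a ih =>
    obtain ⟨b, rfl | rfl⟩ : ∃ b, a = 2 * b ∨ a = 2 * b + 1 := ⟨a / 2, by omega⟩
    · refine ⟨0, ?_⟩
      rcases eq_or_ne b 0 with rfl | hb
      · left; simp
      · right
        exact ⟨b.bits, by simp [bits_two_mul hb], by simp⟩
    · obtain ⟨j, hj⟩ := ih b (by omega)
      refine ⟨j + 1, ?_⟩
      rw [bits_two_mul_add_one, show 2 * b + 1 + 1 = 2 * (b + 1) by ring,
        bits_two_mul b.succ_ne_zero]
      rcases hj with ⟨h1, h2⟩ | ⟨r, h1, h2⟩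
      · left; simp [h1, h2, List.replicate_succ]
      · right; exact ⟨r, by simp [h1, List.replicate_succ], by simp [h2, List.replicate_succ]⟩

theorem bval_bits (a : ℕ) : Cmd.bval (Nat.bits a) = a := by
  induction a using Nat.strong_induction_on with
  | _ a ih =>
    obtain ⟨b, rfl | rfl⟩ : ∃ b, a = 2 * b ∨ a = 2 * b + 1 := ⟨a / 2, by omega⟩
    · rcases eq_or_ne b 0 with rfl | hb
      · rfl
      · rw [bits_two_mul hb, Cmd.bval, ih b (by omega)]
        simp
    · rw [bits_two_mul_add_one, Cmd.bval, ih b (by omega)]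
      simp
      ring

theorem length_bits (a : ℕ) : (Nat.bits a).length = Nat.size a := (Nat.size_eq_bits_len a)

/-- The code of the coordinate with index `u`, that is `(-1)^u (2 ⌊u/2⌋ + 1) / 2^l`. -/
def encCoord (l u : ℕ) : List Sym :=
  Sym.bit (decide (u % 2 = 1)) :: Sym.bit true :: (Cmd.word (Nat.bits (u / 2)) ++
    Sym.sep :: (List.replicate l (Sym.bit false) ++ [Sym.bit true, Sym.sep]))

/-- The code of a point given by the indices of its coordinates. -/
def encCoords (l : ℕ) (v : List ℕ) : List Sym := v.flatMap (encCoord l)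

@[simp] theorem encCoords_nil (l : ℕ) : encCoords l [] = [] := rfl
@[simp] theorem encCoords_cons (l u : ℕ) (v : List ℕ) :
    encCoords l (u :: v) = encCoord l u ++ encCoords l v := by
  simp [encCoords]

theorem encCoords_append (l : ℕ) (v v' : List ℕ) :
    encCoords l (v ++ v') = encCoords l v ++ encCoords l v' := by
  simp [encCoords]

theorem length_encCoord (l u : ℕ) : (encCoord l u).length = cost l u := by
  simp [encCoord, cost, length_bits]
  omega

theorem length_encCoords (l : ℕ) (v : List ℕ) : (encCoords l v).length = costs l v := by
  induction v with
  | nil => rfl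
  | cons u v ih => simp [ih, length_encCoord]

/-- The coordinate with index `u`. -/
def coord (l u : ℕ) : ℚ := (if u % 2 = 1 then -1 else 1) * ((2 * (u / 2 : ℕ) + 1 : ℕ) : ℚ) / 2 ^ l

theorem bits_two_pow (l : ℕ) : Nat.bits (2 ^ l) = List.replicate l false ++ [true] := by
  induction l with
  | zero => simp
  | succ l ih =>
    rw [pow_succ', bits_two_mul (by positivity), ih, List.replicate_succ]
    rfl

/-- This is why cell centres are convenient points: an odd numerator over a power of two is already
in lowest terms, so the code of a coordinate can be edited symbol by symbol without any reduction,
and its denominator part is the same for all coordinates. -/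
theorem num_den_odd_div_two_pow (z : ℤ) (hz : Odd z) (l : ℕ) :
    ((z : ℚ) / 2 ^ l).num = z ∧ ((z : ℚ) / 2 ^ l).den = 2 ^ l := by
  have hc : Nat.Coprime z.natAbs (2 ^ l : ℤ).natAbs := by
    rw [Int.natAbs_pow]
    exact Nat.Coprime.pow_right _ (Nat.coprime_two_right.2 (Int.natAbs_odd.2 hz))
  have h1 := Rat.num_div_eq_of_coprime (a := z) (b := 2 ^ l) (by positivity) hc
  have h2 := Rat.den_div_eq_of_coprime (a := z) (b := 2 ^ l) (by positivity) hc
  push_cast at h1 h2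
  exact ⟨h1, by exact_mod_cast h2⟩

theorem coord_eq (l u : ℕ) :
    coord l u = (((if u % 2 = 1 then -1 else 1) * ((2 * (u / 2 : ℕ) + 1 : ℕ) : ℤ) : ℤ) : ℚ) /
      2 ^ l := by
  unfold coord
  split_ifs <;> simp only [Int.cast_mul, Int.cast_natCast, Int.cast_neg, Int.cast_one]

theorem encRat_coord (l u : ℕ) : encRat (coord l u) = encCoord l u := by
  have hodd : Odd ((if u % 2 = 1 then -1 else 1) * ((2 * (u / 2 : ℕ) + 1 : ℕ) : ℤ) : ℤ) := by
    split_ifs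
    · exact Int.odd_mul.2 ⟨by decide, (Int.odd_coe_nat _).2 ⟨_, rfl⟩⟩
    · exact Int.odd_mul.2 ⟨by decide, (Int.odd_coe_nat _).2 ⟨_, rfl⟩⟩
  obtain ⟨h1, h2⟩ := num_den_odd_div_two_pow _ hodd l
  unfold encRat encCoord encNat
  rw [coord_eq, h1, h2, bits_two_pow, Int.natAbs_mul, Int.natAbs_natCast]
  have h3 : (if u % 2 = 1 then (-1 : ℤ) else 1).natAbs = 1 := by split_ifs <;> rfl
  have h4 : ((if u % 2 = 1 then (-1 : ℤ) else 1) * ((2 * (u / 2) + 1 : ℕ) : ℤ) < 0) ↔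
      u % 2 = 1 := by
    split_ifs with h
    · simp only [h, iff_true]; push_cast; omega
    · simp only [h, iff_false]; push_cast; omega
  simp only [h3, one_mul, h4, bits_two_mul_add_one]
  simp [Cmd.word]

theorem coord_injective (l : ℕ) : Function.Injective (coord l) := by
  intro u u' h
  have h1 := congrArg Rat.num h
  have hodd : ∀ u, Odd ((if u % 2 = 1 then -1 else 1) * ((2 * (u / 2 : ℕ) + 1 : ℕ) : ℤ) : ℤ) := by
    intro u
    split_ifs
    · exact Int.odd_mul.2 ⟨by decide, (Int.odd_coe_nat _).2 ⟨_, rfl⟩⟩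
    · exact Int.odd_mul.2 ⟨by decide, (Int.odd_coe_nat _).2 ⟨_, rfl⟩⟩
  rw [coord_eq, coord_eq, (num_den_odd_div_two_pow _ (hodd u) l).1,
    (num_den_odd_div_two_pow _ (hodd u') l).1] at h1
  split_ifs at h1 <;> push_cast at h1 <;> omega

end GaussianNet

namespace GaussianNet

/-! ### The enumerating machine -/

/-- The stacks of the enumerating machine. -/
inductive EStk
  | inp | out | T | U | P | Q | qs | lz | cap | cap2 | A | Z | done
  deriving DecidableEq

instance : Fintype EStk where
  elems := {.inp, .out, .T, .U, .P, .Q, .qs, .lz, .cap, .cap2, .A, .Z, .done}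
  complete x := by cases x <;> decide

/-- The contents of the stacks of the enumerating machine. -/
structure ESt where
  inp : List Sym := []
  out : List Sym := []
  T : List Sym := []
  U : List Sym := []
  P : List Sym := []
  Q : List Sym := []
  qs : List Sym := []
  lz : List Sym := []
  cap : List Sym := []
  cap2 : List Sym := []
  A : List Sym := []
  Z : List Sym := []
  done : List Sym := []

namespace ESt

/-- The contents as a function. -/
def f (s : ESt) : EStk → List Sym
  | .inp => s.inp | .out => s.out | .T => s.T | .U => s.U | .P => s.P | .Q => s.Q | .qs => s.qs
  | .lz => s.lz | .cap => s.cap | .cap2 => s.cap2 | .A => s.A | .Z => s.Z | .done => s.done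

variable (s : ESt) (w : List Sym)

@[simp] theorem f_inp : s.f .inp = s.inp := rfl
@[simp] theorem f_out : s.f .out = s.out := rfl
@[simp] theorem f_T : s.f .T = s.T := rfl
@[simp] theorem f_U : s.f .U = s.U := rfl
@[simp] theorem f_P : s.f .P = s.P := rfl
@[simp] theorem f_Q : s.f .Q = s.Q := rfl
@[simp] theorem f_qs : s.f .qs = s.qs := rfl
@[simp] theorem f_lz : s.f .lz = s.lz := rfl
@[simp] theorem f_cap : s.f .cap = s.cap := rfl
@[simp] theorem f_cap2 : s.f .cap2 = s.cap2 := rfl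
@[simp] theorem f_A : s.f .A = s.A := rfl
@[simp] theorem f_Z : s.f .Z = s.Z := rfl
@[simp] theorem f_done : s.f .done = s.done := rfl
@[simp] theorem update_inp : Function.update s.f .inp w = f { s with inp := w } := by
  funext k; cases k <;> rfl
@[simp] theorem update_out : Function.update s.f .out w = f { s with out := w } := by
  funext k; cases k <;> rfl
@[simp] theorem update_T : Function.update s.f .T w = f { s with T := w } := by
  funext k; cases k <;> rfl
@[simp] theorem update_U : Function.update s.f .U w = f { s with U := w } := by
  funext k; cases k <;> rfl
@[simp] theorem update_P : Function.update s.f .P w = f { s with P := w } := by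
  funext k; cases k <;> rfl
@[simp] theorem update_Q : Function.update s.f .Q w = f { s with Q := w } := by
  funext k; cases k <;> rfl
@[simp] theorem update_qs : Function.update s.f .qs w = f { s with qs := w } := by
  funext k; cases k <;> rfl
@[simp] theorem update_lz : Function.update s.f .lz w = f { s with lz := w } := by
  funext k; cases k <;> rfl
@[simp] theorem update_cap : Function.update s.f .cap w = f { s with cap := w } := by
  funext k; cases k <;> rfl
@[simp] theorem update_cap2 : Function.update s.f .cap2 w = f { s with cap2 := w } := by
  funext k; cases k <;> rfl
@[simp] theorem update_A : Function.update s.f .A w = f { s with A := w } := by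
  funext k; cases k <;> rfl
@[simp] theorem update_Z : Function.update s.f .Z w = f { s with Z := w } := by
  funext k; cases k <;> rfl
@[simp] theorem update_done : Function.update s.f .done w = f { s with done := w } := by
  funext k; cases k <;> rfl

end ESt

namespace Enum

open Cmd

/-- Is the symbol a bit? -/
def isBit : Option Sym → Bool
  | some (.bit _) => true
  | _ => false

/-- Emit the code of the first coordinate. -/
def emit : Cmd EStk :=
  seq (push .out .sep) (seq (push .out (.bit true)) (seq (cp .lz .out .T) (seq (push .out .sep)
    (seq (push .out (.bit true)) (push .out (.bit false))))))

theorem runsIn_emit (s : ESt) (l : ℕ) (hl : s.lz = List.replicate l (.bit false))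
    (hT : s.T = []) :
    RunsIn emit s.f (9 * l + 7) (ESt.f { s with out := encCoord l 0 ++ s.out }) := by
  refine ((runsIn_push _ _ _).seq ((runsIn_push _ _ _).seq ((runsIn_cp (by decide) (by decide)
    (by decide) _ (by simp [hT])).seq ((runsIn_push _ _ _).seq ((runsIn_push _ _ _).seq
    (runsIn_push _ _ _)))))).congr ?_ ?_
  · simp [hl, encCoord]
  · simp [hl]
    omega

/-- Read the dimension. -/
def readK : Cmd EStk :=
  seq (push .P .sep) (seq (loop .inp isBit (seq
    (case .inp fun o => if toBit o then cp .P .U .T else skip)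
    (seq (pop .inp) (seq (dbl .P .T) (pushN .cap .sep 2))))) (seq (pop .inp) (clear .P)))

/-- Binary to unary conversion: `P` holds the current power of two and is added to `U` at each bit
`1`. The cost of the doublings is a geometric sum, so the total is linear in the final height of
`P`. Two cap entries per bit of `k` are pushed on the way. -/
theorem runsIn_readK_loop (bs : List Bool) (s : ESt) (r : List Sym) (p u c : ℕ)
    (hi : s.inp = word bs ++ .sep :: r) (hP : s.P = unary p) (hU : s.U = unary u)
    (hc : s.cap = unary c) (hT : s.T = []) :
    RunsIn (loop .inp isBit (seq
      (case .inp fun o => if toBit o then cp .P .U .T else skip)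
      (seq (pop .inp) (seq (dbl .P .T) (pushN .cap .sep 2))))) s.f
      (21 * (p * 2 ^ bs.length - p) + 10 * bs.length + 1)
      (ESt.f { s with inp := .sep :: r, P := unary (p * 2 ^ bs.length),
                      U := unary (u + p * bval bs), cap := unary (c + 2 * bs.length) }) := by
  induction bs generalizing s p u c with
  | nil =>
    refine ⟨1, by omega, ?_⟩
    refine (congrArg (Runs _ s.f 1) ?_).mp (Runs.loop_end (by simp [hi, isBit]))
    cases s
    simp_all [bval]
  | cons b bs ih =>
    have h1 : RunsIn (case .inp fun o => if toBit o then cp .P .U .T else skip) s.f (9 * p + 3)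
        (ESt.f { s with U := unary (u + p * b.toNat) }) := by
      refine (RunsIn.case (o := some (.bit b)) (by simp [hi]) (T := 9 * p + 2) ?_)
      cases b
      · refine (runsIn_skip _).congr (by simp [← hU]) (by omega)
      · refine (runsIn_cp (by decide) (by decide) (by decide) _ (by simp [hT])).congr ?_ ?_
        · simp [hP, hU, add_comm]
        · simp [hP]
    have h2 := h1.seq ((runsIn_pop .inp _).seq ((runsIn_dbl (a := .P) (t := .T) (by decide) _ p
      (by simp [hP]) (by simp [hT])).seq (runsIn_pushN .cap .sep 2 _)))
    obtain ⟨t, ht, h2⟩ := h2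
    obtain ⟨t', ht', h3⟩ := ih
      { s with
        inp := word bs ++ .sep :: r
        U := unary (u + p * b.toNat)
        P := unary (2 * p)
        cap := unary (c + 2) } (2 * p) (u + p * b.toNat) (c + 2) rfl rfl rfl rfl hT
    refine ⟨t + t' + 1, ?_, Runs.loop_go (by simp [hi, isBit]) h2 ?_⟩
    · have : p * 2 ^ (b :: bs).length = 2 * p * 2 ^ bs.length := by
        rw [List.length_cons, pow_succ]; ring
      have h4 : p * 1 ≤ p * 2 ^ bs.length := Nat.mul_le_mul_left _ Nat.one_le_two_pow
      have : 2 * p * 2 ^ bs.length = p * 2 ^ bs.length + p * 2 ^ bs.length := by ring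
      simp only [List.length_cons] at *
      omega
    · convert h3 using 2
      · simp [hi, hc, unary, List.replicate]
      · have : c + 2 * (bs.length + 1) = c + 2 + 2 * bs.length := by ring
        have h5 : p * 2 ^ (bs.length + 1) = 2 * p * 2 ^ bs.length := by ring
        have h6 : u + p * (b.toNat + 2 * bval bs) = u + p * b.toNat + 2 * p * bval bs := by ring
        simp [bval, this, h5, h6]

theorem runsIn_readK (s : ESt) (r : List Sym) (k c : ℕ) (hk : 1 ≤ k)
    (hi : s.inp = encNat k ++ r) (hP : s.P = []) (hU : s.U = [])
    (hc : s.cap = unary c) (hT : s.T = []) :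
    RunsIn readK s.f (60 * k)
      (ESt.f { s with inp := r, U := unary k, cap := unary (c + 2 * Nat.size k) }) := by
  have h1 := runsIn_readK_loop (Nat.bits k) { s with P := unary 1 } r 1 0 c (by simp [hi, encNat, word])
    rfl hU hc hT
  have h0 := runsIn_push .P .sep s.f
  simp only [ESt.update_P, ESt.f_P, hP] at h0
  have hs : 2 ^ (Nat.size k) ≤ 2 * k := by
    have h2 : ¬ Nat.size k ≤ Nat.size k - 1 := by
      have := Nat.size_pos.2 hk
      omega
    rw [Nat.size_le, not_lt] at h2
    have := Nat.size_pos.2 hk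
    calc 2 ^ Nat.size k = 2 * 2 ^ (Nat.size k - 1) := by
          rw [← pow_succ', Nat.sub_add_cancel this]
      _ ≤ 2 * k := Nat.mul_le_mul_left _ h2
  have hlt : Nat.size k ≤ k := Nat.size_le.2 Nat.lt_two_pow_self
  refine (h0.seq (h1.seq ((runsIn_pop _ _).seq (runsIn_clear _ _)))).congr ?_ ?_
  · simp [bval_bits, length_bits, hP]
  · simp [length_bits]
    omega

/-- Read the precision. -/
def readN : Cmd EStk :=
  seq (loop .inp isBit (seq (pop .inp) (seq (pushN .lz (.bit false) 6)
    (seq (pushN .cap .sep 8) (pushN .qs .sep 32))))) (pop .inp)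

/-- Per bit of `N`, the 6 zeros build the denominator of the grid, the 8 entries the remaining part
of `capBits`, and the 32 entries the share of one coordinate in `codeBound`. -/
theorem runsIn_readN (s : ESt) (r : List Sym) (N c : ℕ)
    (hi : s.inp = encNat N ++ r) (hl : s.lz = []) (hq : s.qs = []) (hc : s.cap = unary c) :
    RunsIn readN s.f (51 * Nat.size N + 2)
      (ESt.f { s with
        inp := r
        lz := List.replicate (6 * Nat.size N) (.bit false)
        cap := unary (c + 8 * Nat.size N)
        qs := unary (32 * Nat.size N) }) := by
  have h := runsIn_loop (s := s.f) (k := .inp) (P := isBit) (c := seq (pop .inp)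
    (seq (pushN .lz (.bit false) 6) (seq (pushN .cap .sep 8) (pushN .qs .sep 32))))
    (fun i => ESt.f { s with
      inp := word ((Nat.bits N).drop i) ++ .sep :: r
      lz := List.replicate (6 * i) (.bit false)
      cap := unary (c + 8 * i)
      qs := unary (32 * i) }) (Nat.size N) 50 (by
        cases s
        simp_all [encNat, word]) (by
      intro i hi
      rw [← length_bits] at hi
      refine ⟨by simp [hi, isBit, List.head?_append, word], ?_⟩
      refine ((runsIn_pop _ _).seq ((runsIn_pushN _ _ _ _).seq ((runsIn_pushN _ _ _ _).seq
        (runsIn_pushN _ _ _ _)))).congr ?_ (by omega)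
      have hd : (Nat.bits N).drop i = (Nat.bits N)[i] :: (Nat.bits N).drop (i + 1) :=
        List.drop_eq_getElem_cons hi
      simp only [ESt.f_inp, ESt.update_inp, ESt.f_lz, ESt.update_lz, ESt.f_cap, ESt.update_cap,
        ESt.f_qs, ESt.update_qs, hd, unary, List.replicate_append_replicate]
      simp only [word_cons, List.cons_append, List.tail_cons,
        show 6 + 6 * i = 6 * (i + 1) by ring, show 8 + (c + 8 * i) = c + 8 * (i + 1) by ring,
        show 32 + 32 * i = 32 * (i + 1) by ring]) (by simp [← length_bits, isBit])
  refine (h.seq (runsIn_pop _ _)).congr ?_ (by omega)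
  simp [← length_bits]

/-- Emit as many copies of the first coordinate as there are entries on `Z`. -/
def emitAll : Cmd EStk := loop .Z Option.isSome (seq (pop .Z) emit)

theorem encCoords_replicate_succ (l n : ℕ) : encCoords l (List.replicate (n + 1) 0) =
    encCoord l 0 ++ encCoords l (List.replicate n 0) := by
  rw [List.replicate_succ, encCoords_cons]

theorem runsIn_emitAll (s : ESt) (l n : ℕ) (hl : s.lz = List.replicate l (.bit false))
    (hT : s.T = []) (hU : s.Z = unary n) :
    RunsIn emitAll s.f (n * (9 * l + 9) + 1) (ESt.f { s with
      out := encCoords l (List.replicate n 0) ++ s.out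
      Z := [] }) := by
  have h := runsIn_loop (s := s.f) (k := .Z) (P := Option.isSome) (c := seq (pop .Z) emit)
    (fun i => ESt.f { s with
      out := encCoords l (List.replicate i 0) ++ s.out
      Z := unary (n - i) }) n (9 * l + 8) (by
        cases s
        simp_all) (by
      intro i hi
      refine ⟨by simp [head?_unary]; omega, ?_⟩
      have hp := runsIn_pop .Z (ESt.f { s with
        out := encCoords l (List.replicate i 0) ++ s.out
        Z := unary (n - i) })
      simp only [ESt.update_Z] at hp
      refine (hp.seq (runsIn_emit _ l hl hT)).congr ?_ (by omega)
      simp [encCoords_replicate_succ, Nat.sub_sub]) (by simp)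
  exact h.congr (by simp) le_rfl

end Enum
end GaussianNet

namespace GaussianNet

namespace Cmd

theorem RunsIn.loop_go_seq {K : Type} [DecidableEq K] {k : K} {P : Option Sym → Bool}
    {c d : Cmd K} {s s' s'' : K → List Sym} {T T' : ℕ} (hP : P (s k).head? = true)
    (h : RunsIn c s T s') (h' : RunsIn (Cmd.seq (loop k P c) d) s' T' s'') :
    RunsIn (Cmd.seq (loop k P c) d) s (T + T' + 1) s'' := by
  obtain ⟨t, ht, h⟩ := h
  obtain ⟨t', ht', h'⟩ := h'
  cases h' with
  | seq h1 h2 => exact ⟨_, by omega, .seq (.loop_go hP h h1) h2⟩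

theorem runsIn_loop_end {K : Type} [DecidableEq K] {k : K} {P : Option Sym → Bool}
    {c : Cmd K} {s : K → List Sym} (hP : P (s k).head? = false) : RunsIn (loop k P c) s 1 s :=
  ⟨1, le_rfl, .loop_end hP⟩

end Cmd

namespace Enum

open Cmd

/-- Move the leading ones of the input to `A`, counting them also against the cap. -/
def ones : Cmd EStk :=
  loop .inp toBit (seq (pop .inp) (seq (push .A .sep) (seq (pop .cap) (push .cap2 .sep))))

theorem runsIn_ones (s : ESt) (j c : ℕ) (r : List Sym)
    (hi : s.inp = List.replicate j (.bit true) ++ r) (hr : toBit r.head? = false)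
    (hA : s.A = []) (hc : s.cap = unary (c + j)) (hc2 : s.cap2 = []) :
    RunsIn ones s.f (5 * j + 1) (ESt.f { s with
      inp := r
      A := unary j
      cap := unary c
      cap2 := unary j }) := by
  have h := runsIn_loop (s := s.f) (k := .inp) (P := toBit)
    (c := seq (pop .inp) (seq (push .A .sep) (seq (pop .cap) (push .cap2 .sep))))
    (fun i => ESt.f { s with
      inp := List.replicate (j - i) (.bit true) ++ r
      A := unary i
      cap := unary (c + j - i)
      cap2 := unary i }) j 4 (by
        cases s
        simp_all) (by
      intro i hi
      have e : j - i = j - (i + 1) + 1 := by omega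
      refine ⟨by simp [e, List.replicate_succ, toBit], ?_⟩
      refine ((runsIn_pop _ _).seq ((runsIn_push _ _ _).seq ((runsIn_pop _ _).seq
        (runsIn_push _ _ _)))).congr ?_ le_rfl
      simp [e, List.replicate_succ, ← unary_succ, Nat.sub_sub]) (by simpa using hr)
  exact h.congr (by simp) (by omega)

/-- Put back an increased coordinate. -/
def succeed : Cmd EStk :=
  seq (push .inp (.bit true)) (seq (loop .A Option.isSome (seq (pop .A) (push .inp (.bit false))))
    (seq (push .inp (.bit true)) (seq (push .inp (.bit false)) (push .done .sep))))

theorem runsIn_succeed (s : ESt) (j : ℕ) (hA : s.A = unary j) (hd : s.done = []) :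
    RunsIn succeed s.f (3 * j + 5) (ESt.f { s with
      inp := .bit false :: .bit true :: (List.replicate j (.bit false) ++ .bit true :: s.inp)
      A := []
      done := [.sep] }) := by
  have h := runsIn_loop (s := ESt.f { s with inp := .bit true :: s.inp }) (k := .A)
    (P := Option.isSome) (c := seq (pop .A) (push .inp (.bit false)))
    (fun i => ESt.f { s with
      inp := List.replicate i (.bit false) ++ .bit true :: s.inp
      A := unary (j - i) }) j 2 (by
        cases s
        simp_all) (by
      intro i hi
      refine ⟨by simp [head?_unary]; omega, ?_⟩
      refine ((runsIn_pop _ _).seq (runsIn_push _ _ _)).congr ?_ le_rfl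
      simp [List.replicate_succ, Nat.sub_sub]) (by simp)
  have h0 := runsIn_push .inp (.bit true) s.f
  simp only [ESt.update_inp, ESt.f_inp] at h0
  refine (h0.seq (h.seq ((runsIn_push _ _ _).seq ((runsIn_push _ _ _).seq
    (runsIn_push _ _ _))))).congr ?_ (by omega)
  simp [hd]

/-- Skip bits of the input. -/
def skipBits : Cmd EStk := loop .inp isBit (pop .inp)

theorem runsIn_skipBits (s : ESt) (bs : List Bool) (r : List Sym) (hi : s.inp = word bs ++ r)
    (hr : isBit r.head? = false) :
    RunsIn skipBits s.f (2 * bs.length + 1) (ESt.f { s with inp := r }) := by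
  have h := runsIn_loop (s := s.f) (k := .inp) (P := isBit) (c := pop .inp)
    (fun i => ESt.f { s with inp := word (bs.drop i) ++ r }) bs.length 1 (by
        cases s
        simp_all) (by
      intro i hi
      have hd : bs.drop i = bs[i] :: bs.drop (i + 1) := List.drop_eq_getElem_cons hi
      refine ⟨by simp only [ESt.f_inp, hd, word_cons, List.cons_append, List.head?_cons, isBit],
        (runsIn_pop _ _).congr ?_ le_rfl⟩
      simp only [ESt.f_inp, hd, ESt.update_inp, word_cons, List.cons_append, List.tail_cons]) (by simpa using hr)
  exact h.congr (by simp) (by omega)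

/-- Remove a coordinate that cannot be increased. -/
def fail : Cmd EStk :=
  seq (pop .inp) (seq skipBits (seq (pop .inp) (seq (mv .A .Q) (push .Z .sep))))

theorem runsIn_fail (s : ESt) (j l q z : ℕ) (r : List Sym)
    (hi : s.inp = .sep :: (List.replicate l (.bit false) ++ .bit true :: .sep :: r))
    (hA : s.A = unary j) (hQ : s.Q = unary q) (hZ : s.Z = unary z) :
    RunsIn fail s.f (2 * l + 4 * j + 7) (ESt.f { s with
      inp := r
      A := []
      Q := unary (q + j)
      Z := unary (z + 1) }) := by
  have h0 := runsIn_pop .inp s.f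
  simp only [ESt.update_inp, ESt.f_inp, hi, List.tail_cons] at h0
  have h1 := runsIn_skipBits { s with inp := List.replicate l (.bit false) ++ .bit true :: .sep :: r }
    (List.replicate l false ++ [true]) (.sep :: r) (by simp [word]) (by simp [isBit])
  refine (h0.seq (h1.seq ((runsIn_pop _ _).seq ((runsIn_mv (by decide) _).seq
    (runsIn_push _ _ _))))).congr ?_ ?_
  · simp [hA, hQ, hZ, ← unary_succ, add_comm]
  · simp [hA]
    omega

/-- Try to increase a coordinate with negative sign. -/
def advance : Cmd EStk :=
  seq (pop .inp) (seq (pop .inp) (seq ones (seq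
    (case .inp fun o => if o = some (.bit false) then seq (pop .inp) succeed else
      case .Q fun o => if o = none then fail else case .cap fun o => if o = none then fail
        else succeed)
    (mv .cap2 .cap))))

/-- With `u` odd, the next index has positive sign and `u / 2` increased by one. The binary
increment turns leading ones into zeros and the following zero into a one. The code gets longer only
if there is no zero, and then it needs one free token and one free cap entry. If either is missing,
the coordinate is removed, its tokens are returned to `Q`, and `Z` records that a zero coordinate
has to be printed. -/
theorem runsIn_advance (s : ESt) (l c u q z : ℕ) (r : List Sym) (hu : u % 2 = 1)
    (huc : Nat.size (u / 2) ≤ c)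
    (hi : s.inp = encCoord l u ++ r) (hQ : s.Q = unary q) (hZ : s.Z = unary z)
    (hA : s.A = []) (hc : s.cap = unary c) (hc2 : s.cap2 = []) (hd : s.done = []) :
    RunsIn advance s.f (19 * cost l u) (ESt.f (
      if Nat.size ((u + 1) / 2) ≤ c ∧ Nat.size ((u + 1) / 2) ≤ q + Nat.size (u / 2) then
        { s with
          inp := encCoord l (u + 1) ++ r
          done := [.sep] }
      else
        { s with
          inp := r
          Q := unary (q + Nat.size (u / 2))
          Z := unary (z + 1) })) := by
  obtain ⟨a, rfl⟩ : ∃ a, u = 2 * a + 1 := ⟨u / 2, by omega⟩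
  have e1 : (2 * a + 1) / 2 = a := by omega
  have e2 : (2 * a + 1 + 1) / 2 = a + 1 := by omega
  have e3 : (2 * a + 1 + 1) % 2 = 0 := by omega
  have h0 := runsIn_pop .inp s.f
  have h0' := runsIn_pop .inp (Function.update s.f .inp (s.f .inp).tail)
  simp only [ESt.update_inp, ESt.f_inp, hi, encCoord, List.tail_cons, List.cons_append, e1]
    at h0 h0'
  rw [e1] at huc
  obtain ⟨c', hc'⟩ : ∃ c', c = c' + Nat.size a := ⟨c - Nat.size a, by omega⟩
  obtain ⟨j, ⟨h1, h2⟩ | ⟨bs, h1, h2⟩⟩ := bits_succ a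
  -- All bits of `a` are one: the increment lengthens the code, and the outcome depends on whether
  -- the token stack and the rest of the cap are nonempty.
  · have hj : Nat.size a = j := by rw [← length_bits, h1]; simp
    have hj' : Nat.size (a + 1) = j + 1 := by rw [← length_bits, h2]; simp
    rw [hj] at hc'
    have hq' : (if Nat.size ((2 * a + 1 + 1) / 2) ≤ c ∧
        Nat.size ((2 * a + 1 + 1) / 2) ≤ q + Nat.size ((2 * a + 1) / 2) then
        { s with
          inp := encCoord l (2 * a + 1 + 1) ++ r
          done := [.sep] }
      else
        { s with
          inp := r
          Q := unary (q + Nat.size ((2 * a + 1) / 2))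
          Z := unary (z + 1) }) = if c' ≠ 0 ∧ q ≠ 0 then
        { s with
          inp := .bit false :: .bit true :: (List.replicate j (.bit false) ++ .bit true :: .sep ::
            (List.replicate l (.bit false) ++ .bit true :: .sep :: r))
          done := [.sep] }
      else
        { s with
          inp := r
          Q := unary (q + j)
          Z := unary (z + 1) } := by
      rw [e1, e2, hj, hj']
      refine if_congr (by omega) ?_ rfl
      simp [encCoord, e2, e3, h2, word]
    rw [hq']
    have h3 := runsIn_ones
      { s with inp := word (Nat.bits a) ++ .sep :: (List.replicate l (.bit false) ++
          [.bit true, .sep]) ++ r } j c' (.sep :: (List.replicate l (.bit false) ++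
      .bit true :: .sep :: r)) (by simp [h1, word]) rfl hA (by rw [← hc', hc]) hc2
    have hcost : cost l (2 * a + 1) = j + l + 5 := by rw [cost, e1, hj]
    rcases eq_or_ne q 0 with rfl | hq
    · rw [if_neg (by simp)]
      refine RunsIn.congr (h0.seq (h0'.seq (h3.seq ((RunsIn.case (o := some .sep) rfl (RunsIn.case (o := none)
        (by simp [hQ]) (runsIn_fail _ j l 0 z r rfl rfl (by exact hQ) (by exact hZ)))).seq
        (runsIn_mv (by decide) _))))) ?_ ?_
      · simp [hA, hc2, hc, hc', add_comm]
      · simp [hcost]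
        omega
    rcases eq_or_ne c' 0 with rfl | hcn
    · rw [if_neg (by simp)]
      refine RunsIn.congr (h0.seq (h0'.seq (h3.seq ((RunsIn.case (o := some .sep) rfl (RunsIn.case (o := some .sep)
        (by simp [hQ, head?_unary, hq]) (RunsIn.case (o := none) rfl
        (runsIn_fail _ j l q z r rfl rfl (by exact hQ) (by exact hZ))))).seq
        (runsIn_mv (by decide) _))))) ?_ ?_
      · simp [hA, hc2, hc, hc', add_comm]
      · simp [hcost]
        omega
    · rw [if_pos ⟨hcn, hq⟩]
      refine RunsIn.congr (h0.seq (h0'.seq (h3.seq ((RunsIn.case (o := some .sep) rfl (RunsIn.case (o := some .sep)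
        (by simp [hQ, head?_unary, hq]) (RunsIn.case (o := some .sep)
        (by simp [head?_unary, hcn])
        (runsIn_succeed _ j rfl (by exact hd))))).seq
        (runsIn_mv (by decide) _))))) ?_ ?_
      · simp [hA, hc2, hc, hc', add_comm]
      · simp [hcost]
        omega
  -- Some bit of `a` is zero: the length does not change, and the increment always succeeds.
  · have hj : Nat.size a = j + 1 + bs.length := by rw [← length_bits, h1]; simp; omega
    have hj' : Nat.size (a + 1) = Nat.size a := by
      rw [hj, ← length_bits, h2]; simp; omega
    rw [e1, e2, hj', if_pos (by omega)]
    have h3 := runsIn_ones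
      { s with inp := word (Nat.bits a) ++ .sep :: (List.replicate l (.bit false) ++
          [.bit true, .sep]) ++ r } j (c - j) (.bit false :: (word bs ++ .sep ::
          (List.replicate l (.bit false) ++ .bit true :: .sep :: r)))
      (by simp [h1, word]) rfl hA (by rw [Nat.sub_add_cancel (by omega), hc]) hc2
    have hcost : cost l (2 * a + 1) = j + 1 + bs.length + l + 5 := by rw [cost, e1, hj]
    have h5 := runsIn_pop .inp (ESt.f
      { s with
        inp := .bit false :: (word bs ++ .sep ::
          (List.replicate l (.bit false) ++ .bit true :: .sep :: r))
        A := unary j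
        cap := unary (c - j)
        cap2 := unary j })
    simp only [ESt.update_inp, ESt.f_inp, List.tail_cons] at h5
    refine RunsIn.congr (h0.seq (h0'.seq (h3.seq ((RunsIn.case (o := some (.bit false)) rfl (h5.seq
      (runsIn_succeed _ j rfl (by exact hd)))).seq (runsIn_mv (by decide) _))))) ?_ ?_
    · have : j + (c - j) = c := by omega
      simp [hA, hc2, hc, encCoord, e2, e3, h2, word, this]
    · simp [hcost]
      omega

/-- Find the first coordinate that can be increased, and increase it. -/
def search : Cmd EStk :=
  seq (loop .inp toBit advance) (case .done fun o => if o = none then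
    case .inp fun o => if o = none then seq (clear .Z) (push .out .noPoint)
      else seq (pop .inp) (push .inp (.bit true))
    else pop .done)

/-- The stack `Q` holds the unused budget `q`, so that `q + costs l v` plays the role of the bound
in `next`. A coordinate with positive sign is always increased, by changing its sign bit, because
the opposite point has a code of the same length. The machine therefore loops over negative signs
only. The first alternative of the conclusion is the end of the enumeration; in the second, `i`
coordinates were reset. -/
theorem runsIn_search (l c : ℕ) (v : List ℕ) (s : ESt) (q z : ℕ)
    (hv : ∀ u ∈ v, Nat.size (u / 2) ≤ c) (hi : s.inp = encCoords l v) (hQ : s.Q = unary q)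
    (hZ : s.Z = unary z) (hA : s.A = []) (hc : s.cap = unary c) (hc2 : s.cap2 = [])
    (hd : s.done = []) :
    ∃ q' z' w o, RunsIn search s.f (23 * costs l v + 2 * z + 6) (ESt.f { s with
        inp := encCoords l w
        Q := unary q'
        Z := unary z'
        out := o ++ s.out }) ∧ q' ≤ q + costs l v ∧
      ((next l c (q + costs l v) v = none ∧ w = [] ∧ z' = 0 ∧ o = [.noPoint]) ∨
        ∃ i, next l c (q + costs l v) v = some (List.replicate i 0 ++ w) ∧ z' = z + i ∧ o = []) := by
  induction v generalizing s q z with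
  | nil =>
    refine ⟨q, 0, [], [.noPoint], ?_, Nat.le_add_right _ _, Or.inl ⟨rfl, rfl, rfl, rfl⟩⟩
    refine RunsIn.congr ((runsIn_loop_end (by simp [hi, toBit])).seq (RunsIn.case (o := none) (by simp [hd])
      (RunsIn.case (o := none) (by simp [hi]) ((runsIn_clear _ _).seq
      (runsIn_push _ _ _))))) ?_ ?_
    · simp [hi, hQ]
    · simp [hZ]
      omega
  | cons u r ih =>
    rcases Nat.mod_two_eq_zero_or_one u with hu | hu
    · have e1 : (u + 1) / 2 = u / 2 := by omega
      have e2 : (u + 1) % 2 = 1 := by omega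
      refine ⟨q, z, (u + 1) :: r, [], ?_, Nat.le_add_right _ _, Or.inr ⟨0, ?_, rfl, rfl⟩⟩
      · have hh : (encCoord l u ++ encCoords l r).head? = some (.bit false) := by
          simp [encCoord, hu]
        refine RunsIn.congr ((runsIn_loop_end (by simp [hi, hh, toBit])).seq (RunsIn.case (o := none)
          (by simp [hd]) (RunsIn.case (o := some (.bit false)) (by simp [hi, hh])
          ((runsIn_pop _ _).seq (runsIn_push _ _ _))))) ?_ ?_
        · simp [hi, hQ, hZ, encCoord, e1, e2]
        · omega
      · have hf : Fits l c (q + costs l (u :: r)) (u + 1) r := by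
          refine ⟨e1 ▸ hv u (by simp), ?_⟩
          rw [costs_cons, cost, e1, ← cost]
          omega
        rw [next, if_pos hf]
        rfl
    · have hf : Fits l c (q + costs l (u :: r)) (u + 1) r ↔ Nat.size ((u + 1) / 2) ≤ c ∧
          Nat.size ((u + 1) / 2) ≤ q + Nat.size (u / 2) := by
        rw [Fits, costs_cons, cost, cost]
        constructor
        · rintro ⟨h1, h2⟩; exact ⟨h1, by omega⟩
        · rintro ⟨h1, h2⟩; exact ⟨h1, by omega⟩
      have h := runsIn_advance s l c u q z (encCoords l r) hu (hv u (by simp))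
        (by rw [hi, encCoords_cons]) hQ hZ hA hc hc2 hd
      have hh : (encCoord l u ++ encCoords l r).head? = some (.bit true) := by
        simp [encCoord, hu]
      have e2 : (u + 1) % 2 = 0 := by omega
      rw [if_congr hf.symm rfl rfl] at h
      by_cases hF : Fits l c (q + costs l (u :: r)) (u + 1) r
      · rw [if_pos hF] at h
        refine ⟨q, z, (u + 1) :: r, [], ?_, Nat.le_add_right _ _, Or.inr ⟨0, by rw [next, if_pos hF]; rfl, rfl, rfl⟩⟩
        refine RunsIn.congr (RunsIn.loop_go_seq (by simp [hi, hh, toBit]) h ((runsIn_loop_end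
          (by simp [encCoord, e2, toBit])).seq (RunsIn.case (o := some .sep) (by simp)
          (runsIn_pop _ _)))) ?_ ?_
        · simp [hQ, hZ, hd]
        · rw [costs_cons, cost]
          omega
      · rw [if_neg hF] at h
        obtain ⟨q', z', w, o, hr, hq', hres⟩ := ih
          { s with
            inp := encCoords l r
            Q := unary (q + Nat.size (u / 2))
            Z := unary (z + 1) } (q + Nat.size (u / 2)) (z + 1)
          (fun u' hu' => hv u' (by simp [hu'])) rfl rfl rfl hA hc hc2 hd
        -- The tokens returned by the removed coordinate are exactly those that a zero coordinate
        -- does not need, so the invariant matches the budget of the recursive call of `next`.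
        have e3 : q + Nat.size (u / 2) + costs l r = q + costs l (u :: r) - cost l 0 := by
          rw [costs_cons, cost_zero, cost]
          omega
        rw [e3] at hres
        refine ⟨q', z', w, o, (RunsIn.loop_go_seq (by simp [hi, hh, toBit]) h hr).mono ?_, ?_, ?_⟩
        · rw [costs_cons, cost]
          omega
        · rw [costs_cons, cost]
          omega
        · rw [next, if_neg hF]
          rcases hres with ⟨h1, h2⟩ | ⟨i, h1, h2, h3⟩
          · left
            rw [h1]
            exact ⟨rfl, h2⟩
          · right
            refine ⟨i + 1, ?_, by omega, h3⟩
            rw [h1]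
            rfl

end Enum
end GaussianNet

/-! ### The complete enumerating program. -/

namespace GaussianNet

theorem next_length_costs {l c : ℕ} {v v' : List ℕ} {Q : ℕ} (hQ : costs l v ≤ Q)
    (h : next l c Q v = some v') : v'.length = v.length ∧ costs l v' ≤ Q := by
  induction v generalizing Q v' with
  | nil => simp [next] at h
  | cons u r ih =>
    rw [next] at h
    split_ifs at h with hF
    · cases h
      exact ⟨rfl, by simpa using hF.2⟩
    · obtain ⟨w, hw, rfl⟩ := Option.map_eq_some_iff.1 h
      rw [costs_cons] at hQ
      have h0 := cost_mono l (Nat.zero_le u)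
      obtain ⟨h1, h2⟩ := ih (by omega) hw
      exact ⟨by simp [h1], by rw [costs_cons]; omega⟩

namespace Enum

open Cmd

/-- Fill the stack of tokens. -/
def fillQ : Cmd EStk := loop .U Option.isSome (seq (pop .U) (cp .qs .Q .T))

theorem runsIn_fillQ (s : ESt) (k q : ℕ) (hU : s.U = unary k) (hq : s.qs = unary q)
    (hQ : s.Q = []) (hT : s.T = []) :
    RunsIn fillQ s.f (k * (9 * q + 4) + 1) (ESt.f { s with
      U := []
      Q := unary (k * q) }) := by
  have h := runsIn_loop (s := s.f) (k := .U) (P := Option.isSome)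
    (c := seq (pop .U) (cp .qs .Q .T))
    (fun i => ESt.f { s with
      U := unary (k - i)
      Q := unary (i * q) }) k (9 * q + 3) (by
        cases s
        simp_all) (by
      intro i hi
      refine ⟨by simp [head?_unary]; omega, ?_⟩
      have hp := runsIn_pop .U (ESt.f { s with
        U := unary (k - i)
        Q := unary (i * q) })
      simp only [ESt.update_U] at hp
      refine RunsIn.congr (hp.seq (runsIn_cp (by decide) (by decide) (by decide) _
        (by simp [hT]))) ?_ ?_
      · simp [hq, Nat.sub_sub, Nat.succ_mul, add_comm]
      · simp [hq]
        omega) (by simp)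
  exact h.congr (by simp) le_rfl

/-- Move the input to `T`, at the price of one token for each symbol. -/
def consume : Cmd EStk :=
  loop .inp Option.isSome (case .inp fun
    | some x => seq (pop .inp) (seq (push .T x) (pop .Q))
    | none => skip)

theorem runsIn_consume (s : ESt) (q : ℕ) (hQ : s.Q = unary q) (hT : s.T = []) :
    RunsIn consume s.f (5 * s.inp.length + 1) (ESt.f { s with
      inp := []
      T := s.inp.reverse
      Q := unary (q - s.inp.length) }) := by
  have h := runsIn_loop (s := s.f) (k := .inp) (P := Option.isSome) (c := case .inp fun
    | some x => seq (pop .inp) (seq (push .T x) (pop .Q))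
    | none => skip)
    (fun i => ESt.f { s with
      inp := s.inp.drop i
      T := (s.inp.take i).reverse
      Q := unary (q - i) }) s.inp.length 4 (by
        cases s
        simp_all) (by
      intro i hi
      refine ⟨by simp [hi], ?_⟩
      refine RunsIn.congr (RunsIn.case (o := some s.inp[i]) (by simp [hi]) ((runsIn_pop _ _).seq
        ((runsIn_push _ _ _).seq (runsIn_pop _ _)))) ?_ le_rfl
      simp [reverse_take_succ _ hi, Nat.sub_sub]) (by simp)
  exact h.congr (by simp) (by omega)

/-- Print the remaining coordinates and the reset ones, and clean up. -/
def finish : Cmd EStk :=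
  seq (mv .inp .T) (seq (mv .T .out) (seq emitAll (seq (clear .Q) (seq (clear .lz)
    (seq (clear .cap) (clear .qs))))))

theorem runsIn_finish (w o : List Sym) (q qs l c n : ℕ) :
    RunsIn finish (ESt.f {
        inp := w
        out := o
        Q := unary q
        qs := unary qs
        lz := List.replicate l (.bit false)
        cap := unary c
        Z := unary n }) (8 * w.length + n * (9 * l + 9) + 2 * q + 2 * qs + 2 * l + 2 * c + 7)
      (ESt.f { out := encCoords l (List.replicate n 0) ++ w ++ o }) := by
  have h1 := (runsIn_mv (a := EStk.inp) (b := .T) (by decide) (ESt.f {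
        inp := w
        out := o
        Q := unary q
        qs := unary qs
        lz := List.replicate l (.bit false)
        cap := unary c
        Z := unary n }))
  have h2 := (runsIn_mv (a := EStk.T) (b := .out) (by decide) (ESt.f {
        out := o
        T := w.reverse
        Q := unary q
        qs := unary qs
        lz := List.replicate l (.bit false)
        cap := unary c
        Z := unary n }))
  simp only [ESt.f_inp, ESt.f_T, ESt.update_inp, ESt.update_T, ESt.f_out, ESt.update_out,
    List.append_nil, List.reverse_reverse, List.length_reverse] at h1 h2
  have h3 := runsIn_emitAll {
        out := w ++ o
        Q := unary q
        qs := unary qs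
        lz := List.replicate l (.bit false)
        cap := unary c
        Z := unary n } l n rfl rfl rfl
  refine RunsIn.congr (h1.seq (h2.seq (h3.seq ((runsIn_clear _ _).seq ((runsIn_clear _ _).seq
    ((runsIn_clear _ _).seq (runsIn_clear _ _))))))) ?_ ?_
  · simp
  · simp
    omega

/-- The enumerating program. -/
def prog : Cmd EStk :=
  seq readK (seq readN (seq
    (case .inp fun o => if o = some .noPoint then seq (pop .inp) (mv .U .Z) else
      seq fillQ (seq consume (seq (mv .T .inp) search)))
    finish))

theorem single_inp (w : List Sym) : single EStk.inp w = ESt.f { inp := w } := by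
  funext k; cases k <;> rfl

theorem single_out (w : List Sym) : single EStk.out w = ESt.f { out := w } := by
  funext k; cases k <;> rfl

theorem runsIn_read (k N : ℕ) (hk : 1 ≤ k) (r : List Sym) :
    RunsIn readK (single .inp (encNat k ++ encNat N ++ r)) (60 * k) (ESt.f {
      inp := encNat N ++ r
      U := unary k
      cap := unary (2 * Nat.size k) }) ∧
    RunsIn readN (ESt.f {
      inp := encNat N ++ r
      U := unary k
      cap := unary (2 * Nat.size k) }) (51 * Nat.size N + 2) (ESt.f {
      inp := r
      U := unary k
      qs := unary (32 * Nat.size N)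
      lz := List.replicate (6 * Nat.size N) (.bit false)
      cap := unary (2 * Nat.size k + 8 * Nat.size N) }) := by
  rw [single_inp, List.append_assoc]
  have h1 := runsIn_readK { inp := encNat k ++ (encNat N ++ r) } _ k 0 hk rfl rfl rfl rfl rfl
  rw [Nat.zero_add] at h1
  exact ⟨h1, runsIn_readN _ r N _ rfl rfl rfl rfl⟩

theorem size_le_self (k : ℕ) : Nat.size k ≤ k := Nat.size_le.2 Nat.lt_two_pow_self

theorem runsIn_prog_noPoint (k N : ℕ) (hk : 1 ≤ k) (hN : 1 ≤ N) :
    RunsIn prog (single .inp (encNat k ++ encNat N ++ [.noPoint])) (3000 * (k * Nat.size N))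
      (single .out (encCoords (6 * Nat.size N) (List.replicate k 0))) := by
  obtain ⟨h1, h2⟩ := runsIn_read k N hk [.noPoint]
  have h3 := runsIn_finish [] [] 0 (32 * Nat.size N) (6 * Nat.size N)
    (2 * Nat.size k + 8 * Nat.size N) k
  have h4 := (runsIn_pop EStk.inp (ESt.f {
      inp := [.noPoint]
      U := unary k
      qs := unary (32 * Nat.size N)
      lz := List.replicate (6 * Nat.size N) (.bit false)
      cap := unary (2 * Nat.size k + 8 * Nat.size N) })).seq
    (runsIn_mv (a := .U) (b := .Z) (by decide) _)
  simp only [ESt.f_inp, ESt.update_inp, List.tail_cons, ESt.f_U, ESt.f_Z, ESt.update_U,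
    ESt.update_Z, List.append_nil, unary_reverse, length_unary] at h4
  rw [single_out]
  refine RunsIn.congr (h1.seq (h2.seq ((RunsIn.case (o := some .noPoint) rfl h4).seq h3))) ?_ ?_
  · simp
  · have h5 : 1 ≤ Nat.size N := Nat.size_pos.2 hN
    have h6 : k * 1 ≤ k * Nat.size N := Nat.mul_le_mul_left _ h5
    have h7 : 1 * Nat.size N ≤ k * Nat.size N := Nat.mul_le_mul_right _ hk
    have h8 := size_le_self k
    have h9 : k * (9 * (6 * Nat.size N) + 9) = 54 * (k * Nat.size N) + 9 * k := by ring
    rw [h9]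
    simp only [List.length_nil]
    omega

/-- `fillQ` provides `k * (32 * Nat.size N)` tokens and `consume` pays one for each symbol of the
point, which leaves the slack that `search` expects. Time is linear in `k * Nat.size N` because all
stacks have at most that height up to constants. -/
theorem runsIn_prog_point (k N : ℕ) (hk : 1 ≤ k) (hN : 1 ≤ N) (v : List ℕ)
    (hv : Adm (6 * Nat.size N) (2 * Nat.size k + 8 * Nat.size N) (k * (32 * Nat.size N)) k v) :
    RunsIn prog (single .inp (encNat k ++ encNat N ++ encCoords (6 * Nat.size N) v))
      (3000 * (k * Nat.size N))
      (single .out (match next (6 * Nat.size N) (2 * Nat.size k + 8 * Nat.size N)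
          (k * (32 * Nat.size N)) v with
        | none => [.noPoint]
        | some v' => encCoords (6 * Nat.size N) v')) := by
  obtain ⟨h1, h2⟩ := runsIn_read k N hk (encCoords (6 * Nat.size N) v)
  obtain ⟨hv1, hv2, hv3⟩ := hv
  set l := 6 * Nat.size N with hl
  set c := 2 * Nat.size k + 8 * Nat.size N with hc
  have h5 : 1 ≤ Nat.size N := Nat.size_pos.2 hN
  have h6 : k * 1 ≤ k * Nat.size N := Nat.mul_le_mul_left _ h5
  have h7 : 1 * Nat.size N ≤ k * Nat.size N := Nat.mul_le_mul_right _ hk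
  have h8 := size_le_self k
  have hQ : k * (32 * Nat.size N) = 32 * (k * Nat.size N) := by ring
  have h3 := runsIn_fillQ {
      inp := encCoords l v
      U := unary k
      qs := unary (32 * Nat.size N)
      lz := List.replicate l (.bit false)
      cap := unary c } k (32 * Nat.size N) rfl rfl rfl rfl
  have h4 := runsIn_consume {
      inp := encCoords l v
      Q := unary (k * (32 * Nat.size N))
      qs := unary (32 * Nat.size N)
      lz := List.replicate l (.bit false)
      cap := unary c } (k * (32 * Nat.size N)) rfl rfl
  simp only [length_encCoords] at h4
  have h4' := runsIn_mv (a := EStk.T) (b := .inp) (by decide) (ESt.f {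
      T := (encCoords l v).reverse
      Q := unary (k * (32 * Nat.size N) - costs l v)
      qs := unary (32 * Nat.size N)
      lz := List.replicate l (.bit false)
      cap := unary c })
  simp only [ESt.f_inp, ESt.update_inp, ESt.f_T, ESt.update_T, List.append_nil,
    List.reverse_reverse, List.length_reverse, length_encCoords] at h4'
  obtain ⟨q', z', w, o, hs, hq', hres⟩ := runsIn_search l c v {
      inp := encCoords l v
      Q := unary (k * (32 * Nat.size N) - costs l v)
      qs := unary (32 * Nat.size N)
      lz := List.replicate l (.bit false)
      cap := unary c } (k * (32 * Nat.size N) - costs l v) 0 hv2 rfl rfl rfl rfl rfl rfl rfl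
  rw [Nat.sub_add_cancel hv3] at hres hq'
  have hf := runsIn_finish (encCoords l w) o q' (32 * Nat.size N) l c z'
  have hhead : (encCoords l v).head? ≠ some .noPoint := by
    rcases v with _ | ⟨u, r⟩
    · simp
    · simp [encCoord]
  rw [List.append_nil] at hs
  have hmain := h1.seq (h2.seq ((RunsIn.case (k := .inp) (f := fun o =>
    if o = some .noPoint then seq (pop .inp) (mv .U .Z) else
      seq fillQ (seq consume (seq (mv .T .inp) search))) (o := (encCoords l v).head?) rfl
      (by
        rw [if_neg hhead]
        exact h3.seq (h4.seq (h4'.seq hs)))).seq hf))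
  have key : z' ≤ k ∧ costs l w ≤ 32 * (k * Nat.size N) ∧
      encCoords l (List.replicate z' 0) ++ encCoords l w ++ o =
        match next l c (k * (32 * Nat.size N)) v with
        | none => [.noPoint]
        | some v' => encCoords l v' := by
    rcases hres with ⟨e1, rfl, rfl, rfl⟩ | ⟨i, e1, rfl, rfl⟩
    · rw [e1]
      simp
    · obtain ⟨e2, e3⟩ := next_length_costs hv3 e1
      rw [e1]
      simp only [List.length_append, List.length_replicate] at e2
      have e4 : costs l w ≤ costs l (List.replicate i 0 ++ w) := by
        simp [costs]
      rw [zero_add]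
      exact ⟨by omega, by omega, by simp [encCoords_append]⟩
  obtain ⟨k1, k2, k3⟩ := key
  rw [single_out, ← k3]
  refine hmain.mono ?_
  have h9 : k * (9 * (32 * Nat.size N) + 4) = 288 * (k * Nat.size N) + 4 * k := by ring
  have h10 : z' * (9 * l + 9) ≤ 54 * (k * Nat.size N) + 9 * k := by
    calc z' * (9 * l + 9) ≤ k * (9 * l + 9) := Nat.mul_le_mul_right _ k1
      _ = _ := by rw [hl]; ring
  rw [h9, length_encCoords]
  omega

end Enum
end GaussianNet

namespace GaussianNet

/-! ### The weighing machine -/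

/-- The stacks of the weighing machine. -/
inductive WStk
  | inp | out | T | M | L | D | V | A | B | R | Cy | O | P | C1 | C2
  deriving DecidableEq

instance : Fintype WStk where
  elems := {.inp, .out, .T, .M, .L, .D, .V, .A, .B, .R, .Cy, .O, .P, .C1, .C2}
  complete x := by cases x <;> decide

/-- The contents of the stacks of the weighing machine. -/
structure WSt where
  inp : List Sym := []
  out : List Sym := []
  T : List Sym := []
  M : List Sym := []
  L : List Sym := []
  D : List Sym := []
  V : List Sym := []
  A : List Sym := []
  B : List Sym := []
  R : List Sym := []
  Cy : List Sym := []
  O : List Sym := []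
  P : List Sym := []
  C1 : List Sym := []
  C2 : List Sym := []

namespace WSt

/-- The contents as a function. -/
def f (s : WSt) : WStk → List Sym
  | .inp => s.inp
  | .out => s.out
  | .T => s.T
  | .M => s.M
  | .L => s.L
  | .D => s.D
  | .V => s.V
  | .A => s.A
  | .B => s.B
  | .R => s.R
  | .Cy => s.Cy
  | .O => s.O
  | .P => s.P
  | .C1 => s.C1
  | .C2 => s.C2

variable (s : WSt) (w : List Sym)

@[simp] theorem f_inp : s.f .inp = s.inp := rfl
@[simp] theorem f_out : s.f .out = s.out := rfl
@[simp] theorem f_T : s.f .T = s.T := rfl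
@[simp] theorem f_M : s.f .M = s.M := rfl
@[simp] theorem f_L : s.f .L = s.L := rfl
@[simp] theorem f_D : s.f .D = s.D := rfl
@[simp] theorem f_V : s.f .V = s.V := rfl
@[simp] theorem f_A : s.f .A = s.A := rfl
@[simp] theorem f_B : s.f .B = s.B := rfl
@[simp] theorem f_R : s.f .R = s.R := rfl
@[simp] theorem f_Cy : s.f .Cy = s.Cy := rfl
@[simp] theorem f_O : s.f .O = s.O := rfl
@[simp] theorem f_P : s.f .P = s.P := rfl
@[simp] theorem f_C1 : s.f .C1 = s.C1 := rfl
@[simp] theorem f_C2 : s.f .C2 = s.C2 := rfl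
@[simp] theorem update_inp : Function.update s.f .inp w = f { s with inp := w } := by
  funext k; cases k <;> rfl
@[simp] theorem update_out : Function.update s.f .out w = f { s with out := w } := by
  funext k; cases k <;> rfl
@[simp] theorem update_T : Function.update s.f .T w = f { s with T := w } := by
  funext k; cases k <;> rfl
@[simp] theorem update_M : Function.update s.f .M w = f { s with M := w } := by
  funext k; cases k <;> rfl
@[simp] theorem update_L : Function.update s.f .L w = f { s with L := w } := by
  funext k; cases k <;> rfl
@[simp] theorem update_D : Function.update s.f .D w = f { s with D := w } := by
  funext k; cases k <;> rfl
@[simp] theorem update_V : Function.update s.f .V w = f { s with V := w } := by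
  funext k; cases k <;> rfl
@[simp] theorem update_A : Function.update s.f .A w = f { s with A := w } := by
  funext k; cases k <;> rfl
@[simp] theorem update_B : Function.update s.f .B w = f { s with B := w } := by
  funext k; cases k <;> rfl
@[simp] theorem update_R : Function.update s.f .R w = f { s with R := w } := by
  funext k; cases k <;> rfl
@[simp] theorem update_Cy : Function.update s.f .Cy w = f { s with Cy := w } := by
  funext k; cases k <;> rfl
@[simp] theorem update_O : Function.update s.f .O w = f { s with O := w } := by
  funext k; cases k <;> rfl
@[simp] theorem update_P : Function.update s.f .P w = f { s with P := w } := by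
  funext k; cases k <;> rfl
@[simp] theorem update_C1 : Function.update s.f .C1 w = f { s with C1 := w } := by
  funext k; cases k <;> rfl
@[simp] theorem update_C2 : Function.update s.f .C2 w = f { s with C2 := w } := by
  funext k; cases k <;> rfl

end WSt

namespace Cmd

/-- Run a program once for each entry of the stack `D`, which is restored by means of the empty
stack `C`. -/
def forU {K : Type} (D C : K) (c : Cmd K) : Cmd K :=
  seq (mv D C) (loop C Option.isSome (seq (pop C) (seq (push D .sep) c)))

/-- While the body runs, the counter is split between `D` and `C`. The body is therefore required to
work for all heights `d` and `e` of these two stacks and to leave them alone. -/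
theorem runsIn_forU {K : Type} [DecidableEq K] {D C : K} (hDC : D ≠ C) {c : Cmd K}
    {s : K → List Sym} (inv : ℕ → K → List Sym) (n T : ℕ) (h0 : inv 0 = s)
    (hs : s D = unary n) (hC : s C = []) (hn : inv n D = unary n) (hn' : inv n C = [])
    (hgo : ∀ i < n, ∀ d e,
      RunsIn c (Function.update (Function.update (inv i) D (unary d)) C (unary e)) T
        (Function.update (Function.update (inv (i + 1)) D (unary d)) C (unary e))) :
    RunsIn (forU D C c) s (n * (T + 7) + 2) (inv n) := by
  have h1 := runsIn_mv hDC s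
  rw [hs, hC, List.append_nil, unary_reverse, length_unary] at h1
  have h2 := runsIn_loop (k := C) (P := Option.isSome) (c := seq (pop C) (seq (push D .sep) c))
    (s := Function.update (Function.update s D []) C (unary n))
    (fun i => Function.update (Function.update (inv i) D (unary i)) C (unary (n - i))) n (T + 2)
    (by simp [h0]) (by
      intro i hi
      refine ⟨by simp [head?_unary]; omega, ?_⟩
      refine RunsIn.congr ((runsIn_pop _ _).seq ((runsIn_push _ _ _).seq ?_)) rfl
        (show 1 + (1 + T) ≤ _ by omega)
      have h := hgo i hi (i + 1) (n - (i + 1))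
      convert h using 1
      funext k
      by_cases e1 : k = D
      · subst e1
        simp [hDC, unary_succ]
      · by_cases e2 : k = C
        · subst e2
          simp [hDC.symm, Nat.sub_sub]
        · simp [e1, e2]) (by simp)
  refine (h1.seq h2).congr ?_ ?_
  · funext k
    by_cases e1 : k = C
    · subst e1
      simp [hn']
    · by_cases e2 : k = D
      · subst e2
        simp [e1, hn]
      · simp [e1, e2]
  · have : n * (T + 7) = n * (T + 2 + 1) + 4 * n := by ring
    omega

end Cmd

namespace Weigh

open Cmd

/-- One step of Pascal's triangle: replace the number `v` on `V` by `v + v * 2 ^ D`. -/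
def step : Cmd WStk :=
  seq (cp .V .A .T) (seq (mv .V .T) (seq (mv .T .B) (seq (forU .D .C1 (push .B (.bit false)))
    (seq (add .A .B .R .Cy) (mv .R .V)))))

/-- The effect of `step`. -/
def stepBits (d : ℕ) (v : List Bool) : List Bool := addBits false v (List.replicate d false ++ v)

theorem runsIn_zeros (s : WSt) (d : ℕ) (hD : s.D = unary d) (hC1 : s.C1 = []) :
    RunsIn (forU .D .C1 (push .B (.bit false))) s.f (d * 8 + 2)
      (WSt.f { s with B := word (List.replicate d false) ++ s.B }) := by
  refine runsIn_forU (by decide)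
    (fun i => WSt.f { s with B := word (List.replicate i false) ++ s.B }) d 1 (by simp) hD hC1
    hD hC1 ?_
  intro i _ d' e
  refine RunsIn.congr (runsIn_push _ _ _) ?_ le_rfl
  simp [List.replicate_succ]

theorem runsIn_step (s : WSt) (v : List Bool) (d : ℕ) (hV : s.V = word v) (hD : s.D = unary d)
    (hT : s.T = []) (hA : s.A = []) (hB : s.B = []) (hR : s.R = []) (hCy : s.Cy = [])
    (hC1 : s.C1 = []) :
    RunsIn step s.f (30 * v.length + 21 * d + 20) (WSt.f { s with V := word (stepBits d v) }) := by
  have h1 := runsIn_cp (a := WStk.V) (b := .A) (t := .T) (by decide) (by decide) (by decide) s.f hT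
  have h2 := runsIn_mv (a := WStk.V) (b := .T) (by decide) (WSt.f { s with A := word v })
  have h3 := runsIn_mv (a := WStk.T) (b := .B) (by decide) (WSt.f
    { s with
      A := word v
      V := []
      T := (word v).reverse })
  simp only [WSt.f_V, WSt.f_A, WSt.f_T, WSt.f_B, WSt.update_A, WSt.update_V, WSt.update_T,
    WSt.update_B, hV, hA, hT, hB, List.append_nil, List.reverse_reverse, List.length_reverse,
    length_word] at h1 h2 h3
  have h4 := runsIn_zeros
    { s with
      A := word v
      V := []
      T := []
      B := word v } d hD hC1
  simp only [← word_append] at h4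
  have h5 := runsIn_add (A := WStk.A) (B := .B) (R := .R) (Cy := .Cy) (by decide) (by decide)
    (by decide) (by decide) (by decide) (by decide) v (List.replicate d false ++ v) (by simp) (WSt.f
    { s with
      A := word v
      V := []
      T := []
      B := word (List.replicate d false ++ v) }) rfl rfl hCy
  refine RunsIn.congr (h1.seq (h2.seq (h3.seq (h4.seq (h5.seq (runsIn_mv (by decide) _)))))) ?_ ?_
  · simp [hA, hB, hT, hR, stepBits]
  · simp [hR, length_addBits]
    omega

theorem length_stepBits (d : ℕ) (v : List Bool) : (stepBits d v).length = v.length + d + 1 := by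
  simp [stepBits, length_addBits]
  omega

theorem bval_append (v w : List Bool) : bval (v ++ w) = bval v + 2 ^ v.length * bval w := by
  induction v with
  | nil => simp [bval]
  | cons b v ih => simp [bval, ih, pow_succ]; ring

theorem bval_replicate_false (d : ℕ) : bval (List.replicate d false) = 0 := by
  induction d with
  | zero => rfl
  | succ d ih => simp [List.replicate_succ, bval, ih]

theorem bval_stepBits (d : ℕ) (v : List Bool) : bval (stepBits d v) = bval v * (1 + 2 ^ d) := by
  rw [stepBits, bval_addBits _ _ _ (by simp), bval_append, bval_replicate_false]
  simp
  ring

/-- Several steps of Pascal's triangle. -/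
def pascal : Cmd WStk := forU .M .C2 (seq step step)

theorem length_iterate_stepBits (d n : ℕ) (v : List Bool) :
    ((stepBits d)^[n] v).length = v.length + n * (d + 1) := by
  induction n with
  | zero => simp
  | succ n ih =>
    rw [Function.iterate_succ_apply', length_stepBits, ih]
    ring

/-- By the binomial theorem the value is a sum of terms `bval v * choose n j * (2^d)^j`: row `n` of
Pascal's triangle, laid out in base `2^d`. -/
theorem bval_iterate_stepBits (d n : ℕ) (v : List Bool) :
    bval ((stepBits d)^[n] v) = bval v * (1 + 2 ^ d) ^ n := by
  induction n with
  | zero => simp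
  | succ n ih =>
    rw [Function.iterate_succ_apply', bval_stepBits, ih]
    ring

theorem runsIn_pascal (s : WSt) (v : List Bool) (d m : ℕ) (hV : s.V = word v)
    (hD : s.D = unary d) (hM : s.M = unary m) (hC2 : s.C2 = [])
    (hT : s.T = []) (hA : s.A = []) (hB : s.B = []) (hR : s.R = []) (hCy : s.Cy = [])
    (hC1 : s.C1 = []) :
    RunsIn pascal s.f (m * (60 * (v.length + 2 * m * (d + 1)) + 42 * d + 47) + 2)
      (WSt.f { s with V := word ((stepBits d)^[2 * m] v) }) := by
  refine runsIn_forU (by decide)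
    (fun i => WSt.f { s with V := word ((stepBits d)^[2 * i] v) }) m _ (by simp [← hV]) hM hC2
    hM hC2 ?_
  intro i hi d' e
  have h1 := runsIn_step { s with
      V := word ((stepBits d)^[2 * i] v)
      M := unary d'
      C2 := unary e } ((stepBits d)^[2 * i] v) d rfl hD hT hA hB hR hCy hC1
  have h2 := runsIn_step { s with
      V := word (stepBits d ((stepBits d)^[2 * i] v))
      M := unary d'
      C2 := unary e } (stepBits d ((stepBits d)^[2 * i] v)) d rfl hD hT hA hB hR hCy hC1
  simp only [WSt.update_M, WSt.update_C2]
  refine (h1.seq h2).congr ?_ ?_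
  · rw [show 2 * (i + 1) = 2 * i + 1 + 1 by ring, Function.iterate_succ_apply',
      Function.iterate_succ_apply']
  · rw [length_stepBits, length_iterate_stepBits]
    have : 2 * m * (d + 1) = 2 * i * (d + 1) + 2 * (m - i) * (d + 1) := by
      rw [← add_mul]
      congr 1
      omega
    have h3 : 1 * (d + 1) ≤ 2 * (m - i) * (d + 1) := Nat.mul_le_mul_right _ (by omega)
    rw [this]
    omega

end Weigh
end GaussianNet

/-! ### Reading a coordinate and adding up a block of digits. -/

namespace GaussianNet
namespace Weigh

open Cmd

/-- Is the symbol the bit zero? -/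
def isZero (o : Option Sym) : Bool := o = some (Sym.bit false)

/-- Discard as many digits of `V` as there are entries on `O`. -/
def dropDigits : Cmd WStk :=
  loop .O Option.isSome (seq (pop .O) (forU .D .C1 (pop .V)))

theorem runsIn_dropDigits (s : WSt) (v : List Bool) (d o : ℕ) (hV : s.V = word v)
    (hD : s.D = unary d) (hO : s.O = unary o) (hC1 : s.C1 = []) :
    RunsIn dropDigits s.f (o * (8 * d + 4) + 1) (WSt.f { s with
      V := word (v.drop (d * o))
      O := [] }) := by
  have h := runsIn_loop (s := s.f) (k := .O) (P := Option.isSome)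
    (c := seq (pop .O) (forU .D .C1 (pop .V)))
    (fun i => WSt.f { s with
      V := word (v.drop (d * i))
      O := unary (o - i) }) o (8 * d + 3) (by
        cases s
        simp_all) (by
      intro i hi
      refine ⟨by simp [head?_unary]; omega, ?_⟩
      have h1 := runsIn_pop .O (WSt.f { s with
        V := word (v.drop (d * i))
        O := unary (o - i) })
      simp only [WSt.update_O, WSt.f_O, unary_tail, Nat.sub_sub] at h1
      refine RunsIn.congr (h1.seq (runsIn_forU (D := WStk.D) (C := .C1) (by decide)
        (fun e => WSt.f { s with
          V := word (v.drop (d * i + e))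
          O := unary (o - (i + 1)) }) d 1 (by simp) hD hC1 hD hC1 ?_)) ?_ ?_
      · intro e _ d' e'
        refine RunsIn.congr (runsIn_pop _ _) ?_ le_rfl
        simp [add_assoc]
      · simp [mul_add]
      · omega) (by simp)
  exact h.congr (by simp) (by simp [add_assoc])

/-- Add the next digit of `V` to the number on `B`. -/
def addDigit : Cmd WStk :=
  seq (forU .D .C1 (case .V fun
      | some x => seq (pop .V) (push .T x)
      | none => skip))
    (seq (mv .T .A) (seq (add .A .B .R .Cy) (mv .R .B)))

theorem runsIn_addDigit (s : WSt) (v b : List Bool) (d : ℕ) (hV : s.V = word v)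
    (hB : s.B = word b) (hb : d ≤ b.length) (hD : s.D = unary d) (hT : s.T = []) (hA : s.A = [])
    (hR : s.R = []) (hCy : s.Cy = []) (hC1 : s.C1 = []) :
    RunsIn addDigit s.f (14 * d + 13 * b.length + 13) (WSt.f { s with
      V := word (v.drop d)
      B := word (addBits false (v.take d) b) }) := by
  have h1 := runsIn_forU (D := WStk.D) (C := .C1) (s := s.f) (by decide) (c := case .V fun
      | some x => seq (pop .V) (push .T x)
      | none => skip)
    (fun i => WSt.f { s with
      V := word (v.drop i)
      T := (word (v.take i)).reverse }) d 3 (by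
        cases s
        simp_all) hD hC1 hD hC1 (by
      intro i _ d' e
      rcases lt_or_ge i v.length with hi | hi
      · have hd : v.drop i = v[i] :: v.drop (i + 1) := List.drop_eq_getElem_cons hi
        refine RunsIn.congr (RunsIn.case (o := some (.bit v[i]))
          (by simp only [WSt.update_D, WSt.update_C1, WSt.f_V, hd]; rfl)
          ((runsIn_pop _ _).seq (runsIn_push _ _ _))) ?_ le_rfl
        simp only [WSt.update_D, WSt.update_C1, WSt.f_V, hd, WSt.update_V, WSt.f_T, WSt.update_T,
          ← word_reverse, reverse_take_succ _ hi, word_cons, List.tail_cons]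
      · refine RunsIn.congr (RunsIn.case (o := none) (by simp [hi]) (runsIn_skip _)) ?_ (by omega)
        simp [List.drop_eq_nil_of_le, List.take_of_length_le, hi, hi.trans (Nat.le_succ i)])
  simp only [hA] at h1
  have h2 := runsIn_mv (a := WStk.T) (b := .A) (by decide) (WSt.f { s with
      V := word (v.drop d)
      T := (word (v.take d)).reverse })
  simp only [WSt.f_T, WSt.f_A, WSt.update_T, WSt.update_A, hA, List.append_nil,
    List.reverse_reverse, List.length_reverse, length_word, List.length_take] at h2
  have h5 := runsIn_add (A := WStk.A) (B := .B) (R := .R) (Cy := .Cy) (by decide) (by decide)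
    (by decide) (by decide) (by decide) (by decide) (v.take d) b (by simp; omega) (WSt.f
    { s with
      A := word (v.take d)
      V := word (v.drop d)
      T := [] }) rfl hB hCy
  refine RunsIn.congr (h1.seq (h2.seq (h5.seq (runsIn_mv (a := WStk.R) (b := .B) (by decide) _)))) ?_ ?_
  · simp [hA, hR, hT]
  · simp [hR, length_addBits]
    omega

/-- The sum of the first `j` digits. -/
def sumBits (d : ℕ) (v : List Bool) : ℕ → List Bool
  | 0 => List.replicate d false
  | j + 1 => addBits false ((v.drop (d * j)).take d) (sumBits d v j)

theorem length_sumBits (d : ℕ) (v : List Bool) (j : ℕ) : (sumBits d v j).length = d + j := by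
  induction j with
  | zero => simp [sumBits]
  | succ j ih => rw [sumBits, length_addBits, ih]; ring

/-- Sum twice as many digits as there are entries on `L`. -/
def sumDigits : Cmd WStk := forU .L .C2 (seq addDigit addDigit)

theorem runsIn_sumDigits (s : WSt) (v : List Bool) (d m : ℕ) (hV : s.V = word v)
    (hB : s.B = word (List.replicate d false)) (hD : s.D = unary d) (hL : s.L = unary m)
    (hT : s.T = []) (hA : s.A = []) (hR : s.R = []) (hCy : s.Cy = []) (hC1 : s.C1 = [])
    (hC2 : s.C2 = []) :
    RunsIn sumDigits s.f (m * (54 * d + 52 * m + 33) + 2) (WSt.f { s with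
      V := word (v.drop (d * (2 * m)))
      B := word (sumBits d v (2 * m)) }) := by
  refine runsIn_forU (by decide)
    (fun i => WSt.f { s with
      V := word (v.drop (d * (2 * i)))
      B := word (sumBits d v (2 * i)) }) m _ (by simp [← hV, ← hB, sumBits]) hL hC2 hL hC2 ?_
  intro i hi d' e
  have h1 := runsIn_addDigit { s with
      V := word (v.drop (d * (2 * i)))
      B := word (sumBits d v (2 * i))
      L := unary d'
      C2 := unary e } (v.drop (d * (2 * i))) (sumBits d v (2 * i)) d rfl rfl
      (by rw [length_sumBits]; omega) hD hT hA hR hCy hC1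
  have h2 := runsIn_addDigit { s with
      V := word (v.drop (d * (2 * i + 1)))
      B := word (sumBits d v (2 * i + 1))
      L := unary d'
      C2 := unary e } (v.drop (d * (2 * i + 1))) (sumBits d v (2 * i + 1)) d rfl rfl
      (by rw [length_sumBits]; omega) hD hT hA hR hCy hC1
  rw [List.drop_drop, ← Nat.mul_succ] at h1 h2
  simp only [WSt.update_L, WSt.update_C2]
  refine (h1.seq h2).congr rfl ?_
  rw [length_sumBits, length_sumBits]
  omega

/-- Multiply the number on `V` by the weight selected by the number on `O`. -/
def extract : Cmd WStk :=
  seq dropDigits (seq (forU .D .C1 (push .B (.bit false))) (seq sumDigits (seq (clear .V)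
    (seq (mv .B .T) (mv .T .V)))))

theorem runsIn_extract (s : WSt) (v : List Bool) (d m o : ℕ) (hV : s.V = word v)
    (hB : s.B = []) (hD : s.D = unary d) (hL : s.L = unary m) (hO : s.O = unary o)
    (hT : s.T = []) (hA : s.A = []) (hR : s.R = []) (hCy : s.Cy = []) (hC1 : s.C1 = [])
    (hC2 : s.C2 = []) :
    RunsIn extract s.f (o * (8 * d + 4) + m * (54 * d + 52 * m + 33) + 2 * v.length + 16 * d +
        16 * m + 8) (WSt.f { s with
      V := word (sumBits d (v.drop (d * o)) (2 * m))
      O := [] }) := by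
  have h1 := runsIn_dropDigits s v d o hV hD hO hC1
  have h2 := runsIn_zeros { s with
      V := word (v.drop (d * o))
      O := [] } d hD hC1
  simp only [hB, List.append_nil] at h1 h2
  have h3 := runsIn_sumDigits { s with
      V := word (v.drop (d * o))
      O := []
      B := word (List.replicate d false) } (v.drop (d * o)) d m rfl rfl hD hL hT hA hR hCy hC1 hC2
  refine RunsIn.congr (h1.seq (h2.seq (h3.seq ((runsIn_clear _ _).seq ((runsIn_mv (a := WStk.B) (b := .T) (by decide) _).seq
    (runsIn_mv (a := WStk.T) (b := .V) (by decide) _)))))) ?_ ?_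
  · simp [hB, hT]
  · simp [hT, length_sumBits]
    omega

/-- Read a number, and add its multiple by the height of `P` to `O`. -/
def readNum : Cmd WStk :=
  loop .inp Enum.isBit (seq (case .inp fun o => if toBit o then cp .P .O .T else skip)
    (seq (pop .inp) (dbl .P .T)))

theorem runsIn_readNum (bs : List Bool) (s : WSt) (r : List Sym) (p u : ℕ)
    (hi : s.inp = word bs ++ .sep :: r) (hP : s.P = unary p) (hO : s.O = unary u)
    (hT : s.T = []) :
    RunsIn readNum s.f (21 * (p * 2 ^ bs.length - p) + 7 * bs.length + 1)
      (WSt.f { s with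
        inp := .sep :: r
        P := unary (p * 2 ^ bs.length)
        O := unary (u + p * bval bs) }) := by
  induction bs generalizing s p u with
  | nil =>
    refine (runsIn_loop_end (by simp [hi, Enum.isBit])).congr ?_ (by omega)
    cases s
    simp_all [bval]
  | cons b bs ih =>
    have h1 : RunsIn (case .inp fun o => if toBit o then cp .P .O .T else skip) s.f (9 * p + 3)
        (WSt.f { s with O := unary (u + p * b.toNat) }) := by
      refine (RunsIn.case (o := some (.bit b)) (by simp [hi]) (T := 9 * p + 2) ?_)
      cases b
      · refine (runsIn_skip _).congr (by simp [← hO]) (by omega)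
      · refine (runsIn_cp (by decide) (by decide) (by decide) _ (by simp [hT])).congr ?_ ?_
        · simp [hP, hO, add_comm]
        · simp [hP]
    have h2 := h1.seq ((runsIn_pop .inp _).seq (runsIn_dbl (a := .P) (t := .T) (by decide) _ p
      (by simp [hP]) (by simp [hT])))
    obtain ⟨t, ht, h2⟩ := h2
    obtain ⟨t', ht', h3⟩ := ih
      { s with
        inp := word bs ++ .sep :: r
        O := unary (u + p * b.toNat)
        P := unary (2 * p) } (2 * p) (u + p * b.toNat) rfl rfl rfl hT
    refine ⟨t + t' + 1, ?_, Runs.loop_go (by simp [hi, Enum.isBit]) h2 ?_⟩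
    · have : p * 2 ^ (b :: bs).length = 2 * p * 2 ^ bs.length := by
        rw [List.length_cons, pow_succ]; ring
      have h4 : p * 1 ≤ p * 2 ^ bs.length := Nat.mul_le_mul_left _ Nat.one_le_two_pow
      have : 2 * p * 2 ^ bs.length = p * 2 ^ bs.length + p * 2 ^ bs.length := by ring
      simp only [List.length_cons] at *
      omega
    · have h5 : p * 2 ^ (bs.length + 1) = 2 * p * 2 ^ bs.length := by ring
      have h6 : u + p * (b.toNat + 2 * bval bs) = u + p * b.toNat + 2 * p * bval bs := by ring
      simpa [bval, h5, h6, hi, readNum] using h3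

/-- Skip bits of the input. -/
def skipBits : Cmd WStk := loop .inp Enum.isBit (pop .inp)

theorem runsIn_skipBits (s : WSt) (bs : List Bool) (r : List Sym) (hi : s.inp = word bs ++ r)
    (hr : Enum.isBit r.head? = false) :
    RunsIn skipBits s.f (2 * bs.length + 1) (WSt.f { s with inp := r }) := by
  have h := runsIn_loop (s := s.f) (k := .inp) (P := Enum.isBit) (c := pop .inp)
    (fun i => WSt.f { s with inp := word (bs.drop i) ++ r }) bs.length 1 (by
        cases s
        simp_all) (by
      intro i hi
      have hd : bs.drop i = bs[i] :: bs.drop (i + 1) := List.drop_eq_getElem_cons hi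
      refine ⟨by simp only [WSt.f_inp, hd, word_cons, List.cons_append, List.head?_cons, Enum.isBit],
        (runsIn_pop _ _).congr ?_ le_rfl⟩
      simp only [WSt.f_inp, hd, WSt.update_inp, word_cons, List.cons_append, List.tail_cons])
      (by simpa using hr)
  exact h.congr (by simp) (by omega)

/-- Read a coordinate and put the index of the first digit of its weight on `O`. -/
def readCoord : Cmd WStk :=
  seq (pop .inp) (seq (cp .L .P .T) (seq readNum (seq (clear .P) (seq (pop .inp) (seq skipBits
    (seq (pop .inp) (seq (cp .M .O .T) (forU .L .C1 (pop .O)))))))))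

/-- With `a = u / 2`, the numerator `2 a + 1` times `p` is the middle of the block of a cell,
counted from the centre `m` of the row. Adding `m` and removing `p` gives the first position `m + 2
a p`. The sign bit is discarded, since the weight is even. -/
theorem runsIn_readCoord (s : WSt) (l u p m : ℕ) (r : List Sym) (hi : s.inp = encCoord l u ++ r)
    (hP : s.P = []) (hL : s.L = unary p) (hM : s.M = unary m) (hO : s.O = []) (hT : s.T = [])
    (hC1 : s.C1 = []) :
    RunsIn readCoord s.f (25 * (p * 2 ^ (Nat.size (u / 2) + 1)) + 7 * Nat.size (u / 2) + 2 * l +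
        9 * m + 17 * p + 25) (WSt.f { s with
      inp := r
      O := unary (m + 2 * (u / 2) * p) }) := by
  set a := u / 2 with ha
  have h1 := runsIn_pop .inp s.f
  have h2 := runsIn_cp (a := WStk.L) (b := .P) (t := .T) (by decide) (by decide) (by decide)
    (WSt.f { s with inp := Sym.bit true :: (word (Nat.bits a) ++
      Sym.sep :: (List.replicate l (Sym.bit false) ++ [Sym.bit true, Sym.sep])) ++ r }) hT
  have h3 := runsIn_readNum (true :: Nat.bits a) { s with
      inp := Sym.bit true :: (word (Nat.bits a) ++
        Sym.sep :: (List.replicate l (Sym.bit false) ++ [Sym.bit true, Sym.sep])) ++ r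
      P := unary p } (List.replicate l (Sym.bit false) ++ [Sym.bit true, Sym.sep] ++ r) p 0
      (by simp) rfl hO hT
  have h4 := runsIn_clear .P (WSt.f { s with
      inp := Sym.sep :: (List.replicate l (Sym.bit false) ++ [Sym.bit true, Sym.sep] ++ r)
      P := unary (p * 2 ^ (true :: Nat.bits a).length)
      O := unary (0 + p * bval (true :: Nat.bits a)) })
  have h5 := runsIn_pop .inp (WSt.f { s with
      inp := Sym.sep :: (List.replicate l (Sym.bit false) ++ [Sym.bit true, Sym.sep] ++ r)
      P := []
      O := unary (0 + p * bval (true :: Nat.bits a)) })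
  have h6 := runsIn_skipBits { s with
      inp := List.replicate l (Sym.bit false) ++ [Sym.bit true, Sym.sep] ++ r
      P := []
      O := unary (0 + p * bval (true :: Nat.bits a)) } (List.replicate l false ++ [true])
      (.sep :: r) (by simp [word]) rfl
  have h7 := runsIn_pop .inp (WSt.f { s with
      inp := .sep :: r
      P := []
      O := unary (0 + p * bval (true :: Nat.bits a)) })
  have h8 := runsIn_cp (a := WStk.M) (b := .O) (t := .T) (by decide) (by decide) (by decide)
    (WSt.f { s with
      inp := r
      P := []
      O := unary (0 + p * bval (true :: Nat.bits a)) }) hT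
  have hval : m + (0 + p * bval (true :: Nat.bits a)) = m + 2 * a * p + p := by
    rw [bval, bval_bits]
    simp
    ring
  simp only [WSt.f_inp, WSt.update_inp, WSt.f_P, WSt.update_P, WSt.f_L, WSt.f_M, WSt.f_O,
    WSt.update_O, hi, encCoord, hP, hL, hM, hO, List.append_nil, List.tail_cons,
    List.cons_append, length_unary, unary_append, ← ha, hval] at h1 h2 h3 h4 h5 h6 h7 h8
  have h9 := runsIn_forU (D := WStk.L) (C := .C1) (c := pop .O) (by decide) (s := WSt.f { s with
      inp := r
      P := []
      O := unary (m + 2 * a * p + p) })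
    (fun i => WSt.f { s with
      inp := r
      P := []
      O := unary (m + 2 * a * p + p - i) }) p 1 (by simp) hL hC1 hL hC1 (by
        intro i _ d' e
        refine RunsIn.congr (runsIn_pop _ _) ?_ le_rfl
        simp [Nat.sub_sub])
  simp only [hL, hM] at h9
  refine RunsIn.congr (h1.seq (h2.seq (h3.seq (h4.seq (h5.seq (h6.seq (h7.seq (h8.seq h9)))))))) ?_ ?_
  · simp [hP, hL, hM]
  · simp [length_bits]
    omega

/-- Multiply the number on `V` by the weight of the next coordinate. -/
def weighCoord : Cmd WStk :=
  seq readCoord (seq (cp .M .D .T) (seq (cp .M .D .T) (seq pascal extract)))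

/-- The effect of `weighCoord` on the number on `V`. -/
def coordBits (m p d : ℕ) (v : List Bool) (u : ℕ) : List Bool :=
  sumBits d (((stepBits d)^[2 * m] v).drop (d * (m + 2 * (u / 2) * p))) (2 * p)

/-- `D` grows by `2 m` before Pascal's triangle is run, which makes the digits wide enough: the
product so far is at most `2^d` and a binomial coefficient is below `2^(2m)`. Since a cell sum is at
most `2^(2m)`, the value again fits under the new `D`, which serves as the exponent of the common
denominator as well. -/
theorem runsIn_weighCoord (s : WSt) (l u p m d : ℕ) (v : List Bool) (r : List Sym)
    (hi : s.inp = encCoord l u ++ r) (hV : s.V = word v) (hD : s.D = unary d)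
    (hP : s.P = []) (hL : s.L = unary p) (hM : s.M = unary m) (hO : s.O = []) (hT : s.T = [])
    (hA : s.A = []) (hB : s.B = []) (hR : s.R = []) (hCy : s.Cy = [])
    (hC1 : s.C1 = []) (hC2 : s.C2 = []) :
    RunsIn weighCoord s.f ((25 * (p * 2 ^ (Nat.size (u / 2) + 1)) + 7 * Nat.size (u / 2) + 2 * l +
        27 * m + 17 * p + 29) +
        ((m * (60 * (v.length + 2 * m * (d + 2 * m + 1)) + 42 * (d + 2 * m) + 47) + 2) +
        ((m + 2 * (u / 2) * p) * (8 * (d + 2 * m) + 4) + p * (54 * (d + 2 * m) + 52 * p + 33) +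
          2 * (v.length + 2 * m * (d + 2 * m + 1)) + 16 * (d + 2 * m) + 16 * p + 8)))
      (WSt.f { s with
        inp := r
        D := unary (d + 2 * m)
        V := word (coordBits m p (d + 2 * m) v u) }) := by
  have h1 := runsIn_readCoord s l u p m r hi hP hL hM hO hT hC1
  have h2 := runsIn_cp (a := WStk.M) (b := .D) (t := .T) (by decide) (by decide) (by decide)
    (WSt.f { s with
      inp := r
      O := unary (m + 2 * (u / 2) * p) }) hT
  have h3 := runsIn_cp (a := WStk.M) (b := .D) (t := .T) (by decide) (by decide) (by decide)
    (WSt.f { s with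
      inp := r
      O := unary (m + 2 * (u / 2) * p)
      D := unary (m + d) }) hT
  simp only [WSt.f_M, WSt.f_D, WSt.update_D, hM, hD, unary_append, length_unary,
    show m + (m + d) = d + 2 * m by ring] at h1 h2 h3
  have h4 := runsIn_pascal { s with
      inp := r
      O := unary (m + 2 * (u / 2) * p)
      D := unary (d + 2 * m) } v (d + 2 * m) m hV rfl hM hC2 hT hA hB hR hCy hC1
  have h5 := runsIn_extract { s with
      inp := r
      O := unary (m + 2 * (u / 2) * p)
      D := unary (d + 2 * m)
      V := word ((stepBits (d + 2 * m))^[2 * m] v) } _ (d + 2 * m) p _ rfl hB rfl hL rfl hT hA hR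
      hCy hC1 hC2
  simp only [hM] at h4 h5
  refine RunsIn.congr (h1.seq (h2.seq (h3.seq (h4.seq h5)))) ?_ ?_
  · simp [hO, hM, coordBits]
  · rw [length_iterate_stepBits]
    omega

end Weigh
end GaussianNet

/-! ### Output in lowest terms, and the complete weighing program. -/

namespace GaussianNet

namespace Cmd

theorem runsIn_rep_dbl {K : Type} [DecidableEq K] {a t : K} (hat : a ≠ t) (j : ℕ)
    (s : K → List Sym) (n : ℕ) (ha : s a = unary n) (ht : s t = []) :
    RunsIn (rep (dbl a t) j) s (12 * (n * 2 ^ j - n) + 2 * j + 1)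
      (Function.update s a (unary (n * 2 ^ j))) := by
  induction j generalizing s n with
  | zero =>
    refine (runsIn_skip s).congr ?_ (by omega)
    rw [pow_zero, mul_one, ← ha, Function.update_eq_self]
  | succ j ih =>
    refine RunsIn.congr ((runsIn_dbl hat s n ha ht).seq (ih _ (2 * n) (by simp)
      (by simp [hat.symm, ht]))) ?_ ?_
    · rw [Function.update_idem, show n * 2 ^ (j + 1) = 2 * n * 2 ^ j by ring]
    · have h1 : n * 2 ^ (j + 1) = 2 * n * 2 ^ j := by ring
      have h2 : 2 * n * 1 ≤ 2 * n * 2 ^ j := Nat.mul_le_mul_left _ Nat.one_le_two_pow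
      omega

/-- A list of bits is the binary expansion of its value, padded with zeros. -/
theorem eq_bits_append (v : List Bool) :
    ∃ z, v = Nat.bits (bval v) ++ List.replicate z false := by
  induction v with
  | nil => exact ⟨0, rfl⟩
  | cons b v ih =>
    obtain ⟨z, hz⟩ := ih
    rcases b with _ | _
    · rcases Nat.eq_zero_or_pos (bval v) with h | h
      · rw [h] at hz
        refine ⟨z + 1, ?_⟩
        rw [bval, h, hz]
        rfl
      · refine ⟨z, ?_⟩
        rw [bval, Bool.toNat_false, zero_add, bits_two_mul h.ne', List.cons_append, ← hz]
    · refine ⟨z, ?_⟩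
      rw [bval, Bool.toNat_true, add_comm, bits_two_mul_add_one, List.cons_append, ← hz]

theorem exists_bits_eq_append_true {n : ℕ} (hn : n ≠ 0) : ∃ l, Nat.bits n = l ++ [true] := by
  induction n using Nat.strong_induction_on with
  | _ n ih =>
    obtain ⟨b, rfl | rfl⟩ : ∃ b, n = 2 * b ∨ n = 2 * b + 1 := ⟨n / 2, by omega⟩
    · obtain ⟨l, hl⟩ := ih b (by omega) (by omega)
      exact ⟨false :: l, by rw [bits_two_mul (by omega), hl]; rfl⟩
    · rcases eq_or_ne b 0 with rfl | hb
      · exact ⟨[], by simp⟩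
      · obtain ⟨l, hl⟩ := ih b (by omega) hb
        exact ⟨true :: l, by rw [bits_two_mul_add_one, hl]; rfl⟩

theorem exists_eq_replicate_append_true (v : List Bool) (hv : bval v ≠ 0) :
    ∃ j w, v = List.replicate j false ++ true :: w := by
  induction v with
  | nil => exact absurd rfl hv
  | cons b v ih =>
    rcases b with _ | _
    · obtain ⟨j, w, h⟩ := ih (by rw [bval] at hv; simpa using hv)
      exact ⟨j + 1, w, by rw [h]; rfl⟩
    · exact ⟨0, v, rfl⟩

end Cmd

namespace Weigh

open Cmd

/-- Read a number and scale the heights of `M` and `L` accordingly. -/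
def scale (a b : ℕ) : Cmd WStk :=
  seq (loop .inp Enum.isBit (seq (pop .inp) (seq (rep (dbl .M .T) a) (rep (dbl .L .T) b))))
    (pop .inp)

theorem runsIn_scale (a b : ℕ) (s : WSt) (n m p : ℕ) (r : List Sym)
    (hi : s.inp = encNat n ++ r) (hM : s.M = unary m) (hL : s.L = unary p) (hT : s.T = []) :
    RunsIn (scale a b) s.f
      (Nat.size n * (12 * (m * 2 ^ (a * Nat.size n)) + 12 * (p * 2 ^ (b * Nat.size n)) +
        2 * a + 2 * b + 4) + 2) (WSt.f { s with
          inp := r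
          M := unary (m * 2 ^ (a * Nat.size n))
          L := unary (p * 2 ^ (b * Nat.size n)) }) := by
  rw [← length_bits]
  have hi' : s.inp = word (Nat.bits n) ++ .sep :: r := by rw [hi, encNat, word]; simp
  generalize Nat.bits n = bs at hi' ⊢
  have h := runsIn_loop (s := s.f) (k := .inp) (P := Enum.isBit)
    (c := seq (pop .inp) (seq (rep (dbl .M .T) a) (rep (dbl .L .T) b)))
    (fun i => WSt.f { s with
      inp := word (bs.drop i) ++ .sep :: r
      M := unary (m * 2 ^ (a * i))
      L := unary (p * 2 ^ (b * i)) }) bs.length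
    (12 * (m * 2 ^ (a * bs.length)) + 12 * (p * 2 ^ (b * bs.length)) + 2 * a + 2 * b + 3) (by
        cases s
        simp_all) (by
      intro i hi
      have hd : bs.drop i = bs[i] :: bs.drop (i + 1) := List.drop_eq_getElem_cons hi
      refine ⟨by simp only [WSt.f_inp, hd, word_cons, List.cons_append, List.head?_cons,
        Enum.isBit], ?_⟩
      have h1 := runsIn_pop .inp (WSt.f { s with
        inp := word (bs.drop i) ++ .sep :: r
        M := unary (m * 2 ^ (a * i))
        L := unary (p * 2 ^ (b * i)) })
      simp only [WSt.f_inp, hd, WSt.update_inp, word_cons, List.cons_append, List.tail_cons] at h1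
      have h2 := runsIn_rep_dbl (a := WStk.M) (t := .T) (by decide) a (WSt.f { s with
        inp := word (bs.drop (i + 1)) ++ .sep :: r
        M := unary (m * 2 ^ (a * i))
        L := unary (p * 2 ^ (b * i)) }) _ rfl hT
      have h3 := runsIn_rep_dbl (a := WStk.L) (t := .T) (by decide) b (WSt.f { s with
        inp := word (bs.drop (i + 1)) ++ .sep :: r
        M := unary (m * 2 ^ (a * (i + 1)))
        L := unary (p * 2 ^ (b * i)) }) _ rfl hT
      have e (m a : ℕ) : m * 2 ^ (a * i) * 2 ^ a = m * 2 ^ (a * (i + 1)) := by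
        rw [mul_assoc, ← pow_add, Nat.mul_succ]
      have e' (m a : ℕ) : m * 2 ^ (a * (i + 1)) ≤ m * 2 ^ (a * bs.length) :=
        Nat.mul_le_mul_left _ (Nat.pow_le_pow_right (by omega) (Nat.mul_le_mul_left _ hi))
      simp only [e, WSt.update_M, WSt.update_L] at h2 h3
      simp only [hd, word_cons, List.cons_append]
      refine RunsIn.congr (h1.seq (h2.seq h3)) rfl ?_
      have := e' m a
      have := e' p b
      omega) (by simp [Enum.isBit])
  refine RunsIn.congr (h.seq (runsIn_pop _ _)) ?_ ?_
  · simp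
  · exact le_of_eq (by ring)

/-- The effect of `weighCoord` for all coordinates of a point. -/
def weighBits (m p : ℕ) : ℕ → List Bool → List ℕ → List Bool
  | _, v, [] => v
  | d, v, u :: us => weighBits m p (d + 2 * m) (coordBits m p (d + 2 * m) v u) us

/-- The cost per coordinate is uniform because extraction brings the number on `V` back to length `d
+ 2 p`, however long the multiplication had made it; so lengths never accumulate beyond `D + 2 * p`.
-/
theorem runsIn_weighCoords (l p m c D : ℕ) (us : List ℕ) (s : WSt) (d : ℕ) (v : List Bool)
    (hus : ∀ u ∈ us, Nat.size (u / 2) ≤ c) (hd : d + 2 * m * us.length ≤ D)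
    (hv : v.length ≤ D + 2 * p)
    (hi : s.inp = encCoords l us) (hV : s.V = word v) (hD : s.D = unary d)
    (hP : s.P = []) (hL : s.L = unary p) (hM : s.M = unary m) (hO : s.O = []) (hT : s.T = [])
    (hA : s.A = []) (hB : s.B = []) (hR : s.R = []) (hCy : s.Cy = [])
    (hC1 : s.C1 = []) (hC2 : s.C2 = []) :
    RunsIn (loop .inp Option.isSome weighCoord) s.f
      (us.length * (((25 * (p * 2 ^ (c + 1)) + 7 * c + 2 * l + 27 * m + 17 * p + 29) +
        ((m * (60 * (D + 2 * p + 2 * m * (D + 1)) + 42 * D + 47) + 2) +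
        ((m + 2 * 2 ^ c * p) * (8 * D + 4) + p * (54 * D + 52 * p + 33) +
          2 * (D + 2 * p + 2 * m * (D + 1)) + 16 * D + 16 * p + 8))) + 1) + 1)
      (WSt.f { s with
        inp := []
        D := unary (d + 2 * m * us.length)
        V := word (weighBits m p d v us) }) := by
  induction us generalizing s d v with
  | nil =>
    refine (runsIn_loop_end (by simp [hi])).congr ?_ (by omega)
    cases s
    simp_all [weighBits]
  | cons u us ih =>
    rw [encCoords_cons] at hi
    rw [List.length_cons] at hd ⊢
    obtain ⟨t, ht, h1⟩ := runsIn_weighCoord s l u p m d v _ hi hV hD hP hL hM hO hT hA hB hR hCy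
      hC1 hC2
    have hd' : d + 2 * m + 2 * m * us.length ≤ D := by
      rw [Nat.mul_succ] at hd
      omega
    obtain ⟨t', ht', h2⟩ := ih { s with
        inp := encCoords l us
        D := unary (d + 2 * m)
        V := word (coordBits m p (d + 2 * m) v u) } (d + 2 * m) (coordBits m p (d + 2 * m) v u)
      (fun u' h => hus u' (List.mem_cons_of_mem _ h)) hd'
      (by rw [coordBits, length_sumBits]; omega) rfl rfl rfl hP hL hM hO hT hA hB hR hCy hC1 hC2
    have hu := hus u List.mem_cons_self
    have hu' : u / 2 ≤ 2 ^ c := (Nat.size_le.1 hu).le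
    have hD' : d + 2 * m ≤ D := by omega
    refine ⟨t + t' + 1, ?_, Runs.loop_go (by simp [hi, encCoord]) h1 ?_⟩
    · have ht2 := ht.trans (b := _) (c := (25 * (p * 2 ^ (c + 1)) + 7 * c + 2 * l + 27 * m +
        17 * p + 29) +
        ((m * (60 * (D + 2 * p + 2 * m * (D + 1)) + 42 * D + 47) + 2) +
        ((m + 2 * 2 ^ c * p) * (8 * D + 4) + p * (54 * D + 52 * p + 33) +
          2 * (D + 2 * p + 2 * m * (D + 1)) + 16 * D + 16 * p + 8))) (by
          gcongr
          · norm_num)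
      rw [Nat.succ_mul]
      omega
    · simpa [weighBits, add_assoc, mul_add, add_comm (2 * m)] using h2

/-- Write the quotient of the number on `V` by `2 ^ D`, in lowest terms. -/
def finish : Cmd WStk :=
  seq (loop .V isZero (seq (pop .V) (pop .D))) (seq (push .out .sep) (seq (push .out (.bit true))
    (seq (loop .D Option.isSome (seq (pop .D) (push .out (.bit false)))) (seq (push .out .sep)
    (seq (mv .V .T) (seq (loop .T isZero (pop .T)) (seq (mv .T .out) (seq (push .out (.bit false))
    (seq (clear .M) (clear .L))))))))))

theorem encRat_div_two_pow (j w d : ℕ) (hj : j ≤ d) :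
    encRat (((2 ^ j * (2 * w + 1) : ℕ) : ℚ) / 2 ^ d) = Sym.bit false ::
      (encNat (2 * w + 1) ++ (List.replicate (d - j) (Sym.bit false) ++ [Sym.bit true, Sym.sep])) := by
  obtain ⟨h1, h2⟩ := num_den_odd_div_two_pow (2 * w + 1) ⟨w, rfl⟩ (d - j)
  have h3 : ((2 ^ j * (2 * w + 1) : ℕ) : ℚ) / 2 ^ d = ((2 * w + 1 : ℤ) : ℚ) / 2 ^ (d - j) := by
    rw [div_eq_div_iff (by positivity) (by positivity), ← Nat.sub_add_cancel hj, pow_add]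
    push_cast
    rw [Nat.add_sub_cancel]
    ring
  rw [h3, encRat, h1, h2, show ((2 * w + 1 : ℤ)).natAbs = 2 * w + 1 by omega]
  rw [encNat, encNat, bits_two_pow]
  simp
  omega

/-- Cancelling powers of two means removing low zeros of the numerator together with entries of `D`.
The high zeros, which come from the fixed-width additions, are removed after reversal onto `T`,
because a canonical binary expansion ends with a one. Both loops stop since the number is not zero.
-/
theorem runsIn_finish (v : List Bool) (d m p : ℕ) (hv0 : bval v ≠ 0) (hv : bval v ≤ 2 ^ d) :
    RunsIn finish (WSt.f {
        V := word v
        D := unary d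
        M := unary m
        L := unary p }) (13 * v.length + 4 * d + 2 * m + 2 * p + 12) (WSt.f {
        out := encRat ((bval v : ℚ) / 2 ^ d) }) := by
  obtain ⟨j, w, rfl⟩ := exists_eq_replicate_append_true v hv0
  rw [bval_append, bval_replicate_false, List.length_replicate, zero_add, bval] at hv ⊢
  rw [Bool.toNat_true, add_comm 1] at hv ⊢
  -- `2^j` divides a nonzero number that is at most `2^d`, so `D` is not exhausted by the
  -- cancellation.
  have hjd : j ≤ d := by
    refine (Nat.pow_le_pow_iff_right (a := 2) (by omega)).1 (le_trans ?_ hv)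
    exact Nat.le_mul_of_pos_right _ (by omega)
  rw [encRat_div_two_pow _ _ _ hjd]
  have h1 := runsIn_loop (k := WStk.V) (P := isZero) (c := seq (pop .V) (pop .D)) (s := WSt.f {
        V := word (List.replicate j false ++ true :: w)
        D := unary d
        M := unary m
        L := unary p })
    (fun i => WSt.f {
        V := word (List.replicate (j - i) false ++ true :: w)
        D := unary (d - i)
        M := unary m
        L := unary p }) j 2 rfl (by
      intro i hi
      have e : j - i = j - (i + 1) + 1 := by omega
      refine ⟨by simp [e, List.replicate_succ, isZero], ?_⟩
      refine RunsIn.congr ((runsIn_pop _ _).seq (runsIn_pop _ _)) ?_ le_rfl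
      simp [e, List.replicate_succ, Nat.sub_sub]) (by simp [isZero])
  simp only [Nat.sub_self, List.replicate_zero, List.nil_append] at h1
  have h2 := runsIn_push .out .sep (WSt.f {
        V := word (true :: w)
        D := unary (d - j)
        M := unary m
        L := unary p })
  have h3 := runsIn_push .out (.bit true) (WSt.f {
        V := word (true :: w)
        D := unary (d - j)
        M := unary m
        L := unary p
        out := [.sep] })
  have h4 := runsIn_loop (k := WStk.D) (P := Option.isSome)
    (c := seq (pop .D) (push .out (.bit false))) (s := WSt.f {
        V := word (true :: w)
        D := unary (d - j)
        M := unary m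
        L := unary p
        out := [.bit true, .sep] })
    (fun i => WSt.f {
        V := word (true :: w)
        D := unary (d - j - i)
        M := unary m
        L := unary p
        out := List.replicate i (.bit false) ++ [.bit true, .sep] }) (d - j) 2 rfl (by
      intro i hi
      refine ⟨by simp [head?_unary]; omega, ?_⟩
      refine RunsIn.congr ((runsIn_pop _ _).seq (runsIn_push _ _ _)) ?_ le_rfl
      simp [List.replicate_succ, Nat.sub_sub, add_assoc]) (by simp)
  set o := List.replicate (d - j) (Sym.bit false) ++ [Sym.bit true, Sym.sep] with ho
  simp only [Nat.sub_self, unary_zero] at h4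
  have h5 := runsIn_push .out .sep (WSt.f {
        V := word (true :: w)
        M := unary m
        L := unary p
        out := o })
  obtain ⟨z, hz⟩ := eq_bits_append (true :: w)
  have hval : bval (true :: w) = 2 * bval w + 1 := by
    rw [bval, Bool.toNat_true, add_comm]
  rw [hval] at hz
  set n := 2 * bval w + 1 with hn
  obtain ⟨b, hb⟩ := exists_bits_eq_append_true (n := n) (by omega)
  have hrev : (word (true :: w)).reverse = List.replicate z (.bit false) ++
      (word (Nat.bits n)).reverse := by
    rw [hz]
    simp [word]
  have h6 := runsIn_mv (a := WStk.V) (b := .T) (by decide) (WSt.f {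
        V := word (true :: w)
        M := unary m
        L := unary p
        out := .sep :: o })
  have hlen : (word (Nat.bits n)).length + z = w.length + 1 := by
    have := congrArg List.length hz
    simp at this
    simpa using this.symm
  have h7 := runsIn_loop (k := WStk.T) (P := isZero) (c := pop .T) (s := WSt.f {
        T := List.replicate z (.bit false) ++ (word (Nat.bits n)).reverse
        M := unary m
        L := unary p
        out := .sep :: o })
    (fun i => WSt.f {
        T := List.replicate (z - i) (.bit false) ++ (word (Nat.bits n)).reverse
        M := unary m
        L := unary p
        out := .sep :: o }) z 1 rfl (by
      intro i hi
      have e : z - i = z - (i + 1) + 1 := by omega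
      refine ⟨by simp [e, List.replicate_succ, isZero], ?_⟩
      refine RunsIn.congr (runsIn_pop _ _) ?_ le_rfl
      simp [e, List.replicate_succ]) (by simp [isZero, hb])
  have h8 := runsIn_mv (a := WStk.T) (b := .out) (by decide) (WSt.f {
        T := (word (Nat.bits n)).reverse
        M := unary m
        L := unary p
        out := .sep :: o })
  have h9 := runsIn_push .out (.bit false) (WSt.f {
        M := unary m
        L := unary p
        out := encNat n ++ o })
  have h10 := runsIn_clear .M (WSt.f {
        M := unary m
        L := unary p
        out := .bit false :: (encNat n ++ o) })
  have h11 := runsIn_clear .L (WSt.f {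
        L := unary p
        out := .bit false :: (encNat n ++ o) })
  have henc : word (Nat.bits n) ++ .sep :: o = encNat n ++ o := by simp [encNat, word]
  simp only [Nat.sub_self, List.replicate_zero, List.nil_append] at h7
  simp only [WSt.f_out, WSt.f_V, WSt.f_T, WSt.f_M, WSt.f_L, WSt.update_out, WSt.update_V,
    WSt.update_T, WSt.update_M, WSt.update_L, List.append_nil, hrev, List.reverse_reverse,
    henc] at h2 h3 h5 h6 h8 h9 h10 h11
  refine RunsIn.congr (h1.seq (h2.seq (h3.seq (h4.seq (h5.seq (h6.seq (h7.seq (h8.seq (h9.seq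
    (h10.seq h11)))))))))) rfl ?_
  simp only [length_unary, length_word, List.length_append, List.length_replicate,
    List.length_cons, List.length_reverse] at *
  omega

/-- The weighing program. -/
def prog : Cmd WStk :=
  seq (push .M .sep) (seq (push .M .sep) (seq (push .L .sep) (seq (push .V (.bit true))
    (seq (scale 20 10) (seq (scale 20 4) (seq (loop .inp Option.isSome weighCoord) finish))))))

theorem single_inp (w : List Sym) : single WStk.inp w = WSt.f { inp := w } := by
  funext k; cases k <;> rfl

theorem single_out (w : List Sym) : single WStk.out w = WSt.f { out := w } := by
  funext k; cases k <;> rfl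

theorem length_weighBits_le (m p d D : ℕ) (v : List Bool) (us : List ℕ)
    (hd : d + 2 * m * us.length ≤ D) (hv : v.length ≤ D + 2 * p) :
    (weighBits m p d v us).length ≤ D + 2 * p := by
  induction us generalizing d v with
  | nil => exact hv
  | cons u us ih =>
    rw [List.length_cons, Nat.mul_succ] at hd
    refine ih _ _ (by omega) ?_
    rw [coordBits, length_sumBits]
    omega

/-- The multipliers 20, 10 in `scale` for `k` and 20, 4 for `N`, and the two initial entries of `M`,
yield the stated `m` and `p`. The weighing starts from the empty product `[true]` with `D` empty. -/
theorem runsIn_prog (k N l c D m p : ℕ) (us : List ℕ)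
    (hm : m = 2 * 2 ^ (20 * Nat.size k) * 2 ^ (20 * Nat.size N))
    (hp : p = 2 ^ (10 * Nat.size k) * 2 ^ (4 * Nat.size N))
    (hD : D = 2 * m * us.length)
    (hus : ∀ u ∈ us, Nat.size (u / 2) ≤ c)
    (h0 : bval (weighBits m p 0 [true] us) ≠ 0)
    (h1 : bval (weighBits m p 0 [true] us) ≤ 2 ^ D) :
    RunsIn prog (single .inp (encNat k ++ encNat N ++ encCoords l us))
      ((Nat.size k + Nat.size N) * (12 * m + 12 * p + 64) +
        us.length * (((25 * (p * 2 ^ (c + 1)) + 7 * c + 2 * l + 27 * m + 17 * p + 29) +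
        ((m * (60 * (D + 2 * p + 2 * m * (D + 1)) + 42 * D + 47) + 2) +
        ((m + 2 * 2 ^ c * p) * (8 * D + 4) + p * (54 * D + 52 * p + 33) +
          2 * (D + 2 * p + 2 * m * (D + 1)) + 16 * D + 16 * p + 8))) + 1) +
        (17 * D + 28 * p + 2 * m + 21))
      (single .out (encRat ((bval (weighBits m p 0 [true] us) : ℚ) / 2 ^ D))) := by
  rw [single_inp, single_out]
  have hp1 : 1 ≤ p := by rw [hp]; exact Nat.mul_pos (by positivity) (by positivity)
  have k1 := runsIn_push .M .sep (WSt.f { inp := encNat k ++ encNat N ++ encCoords l us })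
  have k2 := runsIn_push .M .sep (WSt.f {
    inp := encNat k ++ encNat N ++ encCoords l us
    M := [.sep] })
  have k3 := runsIn_push .L .sep (WSt.f {
    inp := encNat k ++ encNat N ++ encCoords l us
    M := [.sep, .sep] })
  have k4 := runsIn_push .V (.bit true) (WSt.f {
    inp := encNat k ++ encNat N ++ encCoords l us
    M := [.sep, .sep]
    L := [.sep] })
  have k5 := runsIn_scale 20 10 {
    inp := encNat k ++ encNat N ++ encCoords l us
    M := [.sep, .sep]
    L := [.sep]
    V := [.bit true] } k 2 1 (encNat N ++ encCoords l us) (by simp) rfl rfl rfl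
  have k6 := runsIn_scale 20 4 {
    inp := encNat N ++ encCoords l us
    M := unary (2 * 2 ^ (20 * Nat.size k))
    L := unary (1 * 2 ^ (10 * Nat.size k))
    V := [.bit true] } N _ _ (encCoords l us) rfl rfl rfl rfl
  rw [one_mul] at k5 k6
  rw [← hm, ← hp] at k6
  have k7 := runsIn_weighCoords l p m c D us {
    inp := encCoords l us
    M := unary m
    L := unary p
    V := [.bit true] } 0 [true] hus (by omega) (by simp; omega) rfl rfl rfl rfl rfl rfl rfl rfl rfl
      rfl rfl rfl rfl rfl
  rw [zero_add, ← hD] at k7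
  have k8 := runsIn_finish (weighBits m p 0 [true] us) D m p h0 h1
  simp only [WSt.f_M, WSt.f_L, WSt.f_V, WSt.update_M, WSt.update_L, WSt.update_V] at k1 k2 k3 k4
  refine RunsIn.congr (k1.seq (k2.seq (k3.seq (k4.seq (k5.seq (k6.seq (k7.seq k8))))))) rfl ?_
  have h2 := length_weighBits_le m p 0 D [true] us (by omega) (by simp; omega)
  have h3 : 2 * 2 ^ (20 * Nat.size k) ≤ m := by
    rw [hm]; exact Nat.le_mul_of_pos_right _ (by positivity)
  have h4 : 2 ^ (10 * Nat.size k) ≤ p := by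
    rw [hp]; exact Nat.le_mul_of_pos_right _ (by positivity)
  have h5 : Nat.size k * (12 * (2 * 2 ^ (20 * Nat.size k)) + 12 * (2 ^ (10 * Nat.size k)) +
      2 * 20 + 2 * 10 + 4) ≤ Nat.size k * (12 * m + 12 * p + 64) :=
    Nat.mul_le_mul_left _ (by omega)
  have h6 : Nat.size N * (12 * m + 12 * p + 2 * 20 + 2 * 4 + 4) ≤
      Nat.size N * (12 * m + 12 * p + 64) := Nat.mul_le_mul_left _ (by omega)
  rw [add_mul (Nat.size k)]
  omega

end Weigh
end GaussianNet

/-! ### Arithmetic correctness of the weights. -/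

namespace GaussianNet

namespace Weigh

open Cmd

theorem bval_lt (v : List Bool) : bval v < 2 ^ v.length := by
  induction v with
  | nil => simp [bval]
  | cons b v ih =>
    have : b.toNat ≤ 1 := Bool.toNat_le b
    rw [bval, List.length_cons, pow_succ]
    omega

theorem bval_drop_take (v : List Bool) (n : ℕ) :
    bval (v.drop n) = bval v / 2 ^ n ∧ bval (v.take n) = bval v % 2 ^ n := by
  rcases le_total v.length n with h | h
  · have : bval v < 2 ^ n := (bval_lt v).trans_le (Nat.pow_le_pow_right (by omega) h)
    rw [List.drop_eq_nil_of_le h, List.take_of_length_le h, Nat.div_eq_of_lt this,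
      Nat.mod_eq_of_lt this]
    exact ⟨rfl, rfl⟩
  · have h1 := bval_append (v.take n) (v.drop n)
    have h2 := bval_lt (v.take n)
    rw [List.take_append_drop, List.length_take, min_eq_left h] at h1
    rw [List.length_take, min_eq_left h] at h2
    rw [h1, add_comm, Nat.mul_add_div (by positivity), Nat.div_eq_of_lt h2, Nat.mul_add_mod,
      Nat.mod_eq_of_lt h2]
    exact ⟨rfl, rfl⟩

theorem bval_sumBits (d : ℕ) (v : List Bool) (j : ℕ) :
    bval (sumBits d v j) = ∑ i ∈ Finset.range j, bval v / 2 ^ (d * i) % 2 ^ d := by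
  induction j with
  | zero => simp [sumBits, bval_replicate_false]
  | succ j ih =>
    rw [sumBits, bval_addBits _ _ _ (by rw [length_sumBits]; simp), ih,
      (bval_drop_take _ _).2, (bval_drop_take _ _).1, Finset.sum_range_succ]
    simp
    ring

/-- Uniqueness of digits in base `b`. Positions beyond the last digit give zero, which agrees with
the vanishing of binomial coefficients outside the row. -/
theorem digit_sum (b : ℕ) (c : ℕ → ℕ) (hc : ∀ j, c j < b) (n i : ℕ) :
    (∑ j ∈ Finset.range n, c j * b ^ j) / b ^ i % b = if i < n then c i else 0 := by
  have hb : 0 < b := (Nat.zero_le _).trans_lt (hc 0)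
  induction i generalizing c n with
  | zero =>
    rcases n with _ | n
    · simp
    · rw [Finset.sum_range_succ', pow_zero, Nat.div_one, mul_one]
      have : ∑ j ∈ Finset.range n, c (j + 1) * b ^ (j + 1) =
          b * ∑ j ∈ Finset.range n, c (j + 1) * b ^ j := by
        rw [Finset.mul_sum]
        exact Finset.sum_congr rfl fun j _ => by ring
      rw [this, Nat.mul_add_mod, Nat.mod_eq_of_lt (hc 0)]
      simp
  | succ i ih =>
    rcases n with _ | n
    · simp
    · rw [Finset.sum_range_succ', pow_zero, mul_one]
      have : ∑ j ∈ Finset.range n, c (j + 1) * b ^ (j + 1) =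
          b * ∑ j ∈ Finset.range n, c (j + 1) * b ^ j := by
        rw [Finset.mul_sum]
        exact Finset.sum_congr rfl fun j _ => by ring
      rw [this, pow_succ', ← Nat.div_div_eq_div_mul, Nat.mul_add_div hb, Nat.div_eq_of_lt (hc 0),
        add_zero, ih (fun j => c (j + 1)) (fun j => hc _)]
      simp

/-- The numerator of the weight of a cell. -/
def cellSum (m p a : ℕ) : ℕ := ∑ i ∈ Finset.range (2 * p), (2 * m).choose (m + 2 * a * p + i)

theorem cellSum_le (m p a : ℕ) : cellSum m p a ≤ 2 ^ (2 * m) := by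
  rw [← Nat.sum_range_choose, cellSum]
  have h1 : ∑ i ∈ Finset.range (2 * p), (2 * m).choose (m + 2 * a * p + i) =
      ∑ i ∈ Finset.Ico (m + 2 * a * p) (m + 2 * a * p + 2 * p), (2 * m).choose i := by
    rw [Finset.sum_Ico_eq_sum_range, Nat.add_sub_cancel_left]
  rw [h1, ← Finset.sum_filter_add_sum_filter_not _ (· < 2 * m + 1)]
  have h2 : ∑ i ∈ (Finset.Ico (m + 2 * a * p) (m + 2 * a * p + 2 * p)).filter (¬ · < 2 * m + 1),
      (2 * m).choose i = 0 :=
    Finset.sum_eq_zero fun i hi => Nat.choose_eq_zero_of_lt (by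
      have := (Finset.mem_filter.1 hi).2
      omega)
  rw [h2, add_zero]
  exact Finset.sum_le_sum_of_subset fun i hi => Finset.mem_range.2 (Finset.mem_filter.1 hi).2

theorem cellSum_pos {m p a : ℕ} (hp : 0 < p) (h : 2 * a * p ≤ m) : 0 < cellSum m p a := by
  refine Finset.sum_pos' (fun _ _ => Nat.zero_le _) ⟨0, Finset.mem_range.2 (by omega), ?_⟩
  exact Nat.choose_pos (by omega)

/-- The hypothesis on `v` excludes carries: `bval v * choose (2m) j < 2^d`, as a binomial
coefficient is strictly below `2^(2m)` when `m ≥ 1`. So the digits of the product with `(1 +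
2^d)^(2m)` are exactly these numbers. -/
theorem bval_coordBits (m p d u : ℕ) (v : List Bool) (hm : 1 ≤ m)
    (hv : bval v * 2 ^ (2 * m) ≤ 2 ^ d) :
    bval (coordBits m p d v u) = bval v * cellSum m p (u / 2) := by
  have hc (j : ℕ) : bval v * (2 * m).choose j < 2 ^ d := by
    rcases Nat.eq_zero_or_pos (bval v) with h | h
    · rw [h, zero_mul]; positivity
    · exact lt_of_lt_of_le (Nat.mul_lt_mul_of_pos_left (Nat.choose_lt_two_pow _ _ (by omega)) h) hv
  have hX : bval v * (1 + 2 ^ d) ^ (2 * m) =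
      ∑ j ∈ Finset.range (2 * m + 1), bval v * (2 * m).choose j * (2 ^ d) ^ j := by
    rw [add_comm, add_pow, Finset.mul_sum]
    refine Finset.sum_congr rfl fun j _ => ?_
    simp
    ring
  rw [coordBits, bval_sumBits, cellSum, Finset.mul_sum]
  refine Finset.sum_congr rfl fun i _ => ?_
  rw [(bval_drop_take _ _).1, bval_iterate_stepBits, hX, Nat.div_div_eq_div_mul, ← pow_add,
    ← mul_add, pow_mul, digit_sum _ _ hc]
  split_ifs with h
  · rfl
  · rw [Nat.choose_eq_zero_of_lt (by omega), mul_zero]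

/-- Both claims go through one induction, because the bound by the current power of two is what
justifies the digit argument for the next coordinate. -/
theorem bval_weighBits (m p d : ℕ) (v : List Bool) (us : List ℕ) (hm : 1 ≤ m)
    (hv : bval v ≤ 2 ^ d) :
    bval (weighBits m p d v us) = bval v * (us.map fun u => cellSum m p (u / 2)).prod ∧
      bval (weighBits m p d v us) ≤ 2 ^ (d + 2 * m * us.length) := by
  induction us generalizing d v with
  | nil => simpa [weighBits] using hv
  | cons u us ih =>
    have h1 := bval_coordBits m p (d + 2 * m) u v hm
      (by rw [pow_add]; exact Nat.mul_le_mul_right _ hv)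
    obtain ⟨h2, h3⟩ := ih (d + 2 * m) (coordBits m p (d + 2 * m) v u) (by
      rw [h1, pow_add]
      exact Nat.mul_le_mul hv (cellSum_le _ _ _))
    rw [weighBits]
    refine ⟨?_, h3.trans (le_of_eq ?_)⟩
    · rw [h2, h1, List.map_cons, List.prod_cons, mul_assoc]
    · rw [List.length_cons]
      ring

/-- The weight of the cell to which a coordinate belongs. -/
def cellWeight (m p : ℕ) (x : ℚ) : ℚ := (cellSum m p (x.num.natAbs / 2) : ℚ) / 2 ^ (2 * m)

theorem cellWeight_nonneg (m p : ℕ) (x : ℚ) : 0 ≤ cellWeight m p x := by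
  unfold cellWeight
  positivity

theorem cellWeight_coord (m p l u : ℕ) :
    cellWeight m p (coord l u) = (cellSum m p (u / 2) : ℚ) / 2 ^ (2 * m) := by
  have hodd : Odd ((if u % 2 = 1 then (-1 : ℤ) else 1) * ((2 * (u / 2) + 1 : ℕ) : ℤ)) := by
    split_ifs
    · exact ⟨-(u / 2 : ℕ) - 1, by push_cast; ring⟩
    · exact ⟨(u / 2 : ℕ), by push_cast; ring⟩
  rw [cellWeight, coord_eq, (num_den_odd_div_two_pow _ hodd l).1, Int.natAbs_mul,
    Int.natAbs_natCast]
  have h3 : (if u % 2 = 1 then (-1 : ℤ) else 1).natAbs = 1 := by split_ifs <;> rfl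
  rw [h3, one_mul, show (2 * (u / 2) + 1) / 2 = u / 2 by omega]

/-- The weigher writes the product of the weights of the coordinates. -/
theorem runsIn_prog_prod (k N l c D m p : ℕ) (us : List ℕ)
    (hm : m = 2 * 2 ^ (20 * Nat.size k) * 2 ^ (20 * Nat.size N))
    (hp : p = 2 ^ (10 * Nat.size k) * 2 ^ (4 * Nat.size N))
    (hD : D = 2 * m * us.length)
    (hus : ∀ u ∈ us, Nat.size (u / 2) ≤ c) (hc : 2 * 2 ^ c * p ≤ m) :
    RunsIn prog (single .inp (encNat k ++ encNat N ++ encCoords l us))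
      ((Nat.size k + Nat.size N) * (12 * m + 12 * p + 64) +
        us.length * (((25 * (p * 2 ^ (c + 1)) + 7 * c + 2 * l + 27 * m + 17 * p + 29) +
        ((m * (60 * (D + 2 * p + 2 * m * (D + 1)) + 42 * D + 47) + 2) +
        ((m + 2 * 2 ^ c * p) * (8 * D + 4) + p * (54 * D + 52 * p + 33) +
          2 * (D + 2 * p + 2 * m * (D + 1)) + 16 * D + 16 * p + 8))) + 1) +
        (17 * D + 28 * p + 2 * m + 21))
      (single .out (encRat (us.map fun u => cellWeight m p (coord l u)).prod)) := by
  have hm1 : 1 ≤ m := by rw [hm]; exact Nat.mul_pos (by positivity) (by positivity)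
  have hp1 : 0 < p := by rw [hp]; exact Nat.mul_pos (by positivity) (by positivity)
  obtain ⟨h1, h2⟩ := bval_weighBits m p 0 [true] us hm1 (by simp [bval])
  have h3 : bval [true] = 1 := rfl
  rw [h3, one_mul] at h1
  rw [zero_add, ← hD] at h2
  -- The cap on the coordinates keeps the start of each block inside the row, so every cell sum
  -- contains a nonzero binomial coefficient; `finish` needs a nonzero number.
  have hpos : (us.map fun u => cellSum m p (u / 2)).prod ≠ 0 := by
    refine List.prod_ne_zero fun h => ?_
    obtain ⟨u, hu, h⟩ := List.mem_map.1 h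
    refine absurd h (cellSum_pos hp1 (le_trans ?_ hc)).ne'
    have := (Nat.size_le.1 (hus u hu)).le
    gcongr
  have h := runsIn_prog k N l c D m p us hm hp hD hus (by rw [h1]; exact hpos) h2
  convert h using 3
  rw [h1, hD]
  clear * -
  induction us with
  | nil => simp
  | cons u us ih =>
    rw [List.map_cons, List.prod_cons, ih, cellWeight_coord, List.map_cons, List.prod_cons,
      List.length_cons, Nat.mul_succ, pow_add]
    push_cast
    rw [mul_comm ((2 : ℚ) ^ (2 * m * us.length)), mul_div_mul_comm]

end Weigh
end GaussianNet

/-! ### The net: indices, cardinality, running times. -/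

namespace GaussianNet

/-- Half the spacing of the grid is `1 / 2 ^ gridBits N`. -/
def gridBits (N : ℕ) : ℕ := 6 * Nat.size N

/-- A bound for the size of the coordinates. -/
def capBits (k N : ℕ) : ℕ := 2 * Nat.size k + 8 * Nat.size N

/-- A bound for the length of the code of a point. -/
def codeBound (k N : ℕ) : ℕ := k * (32 * Nat.size N)

/-- The indices of the points of the net. -/
def Index (k N : ℕ) : Finset (Fin k → ℕ) :=
  {f ∈ Fintype.piFinset fun _ => Finset.range (2 * 2 ^ capBits k N) |
    ∑ i, cost (gridBits N) (f i) ≤ codeBound k N}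

theorem mem_Index {k N : ℕ} {f : Fin k → ℕ} : f ∈ Index k N ↔
    (∀ i, Nat.size (f i / 2) ≤ capBits k N) ∧ ∑ i, cost (gridBits N) (f i) ≤ codeBound k N := by
  simp only [Index, Finset.mem_filter, Fintype.mem_piFinset, Finset.mem_range, Nat.size_le]
  refine and_congr_left fun _ => forall_congr' fun i => ?_
  omega

theorem mem_Index_iff_adm {k N : ℕ} {f : Fin k → ℕ} :
    f ∈ Index k N ↔ Adm (gridBits N) (capBits k N) (codeBound k N) k (List.ofFn f) := by
  rw [mem_Index, Adm, costs, List.map_ofFn, List.sum_ofFn]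
  simp [List.mem_ofFn]

/-- The point with given indices. -/
def point {k : ℕ} (N : ℕ) (f : Fin k → ℕ) : Fin k → ℚ := fun i => coord (gridBits N) (f i)

theorem point_injective (k N : ℕ) : Function.Injective (point (k := k) N) := fun _ _ h =>
  funext fun i => coord_injective _ (congrFun h i)

/-- The net. -/
def net (k N : ℕ) : Finset (Fin k → ℚ) := (Index k N).image (point N)

/-- The spacing of the grid. -/
def spacing (N : ℕ) : ℚ := 2 / 2 ^ gridBits N

theorem spacing_pos (N : ℕ) : 0 < spacing N := by unfold spacing; positivity

theorem point_mem_grid {k : ℕ} (N : ℕ) (f : Fin k → ℕ) (i : Fin k) :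
    ∃ z : ℤ, point N f i = spacing N * ((z : ℚ) + 1 / 2) := by
  refine ⟨if f i % 2 = 1 then -(f i / 2 : ℕ) - 1 else (f i / 2 : ℕ), ?_⟩
  rw [point, coord, spacing]
  generalize f i / 2 = a
  split_ifs <;> push_cast <;> ring

/-- A Kraft inequality. As `u + 1 ≤ 2 * 2 ^ Nat.size (u / 2)`, the term `4 ^ (-cost l u)` is at most
`1/((u+1)(u+2))`, and these numbers telescope. -/
theorem sum_cost_le (l n : ℕ) :
    ∑ u ∈ Finset.range n, (1 / 4 : ℝ) ^ cost l u ≤ 1 := by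
  have h1 (u : ℕ) : (1 / 4 : ℝ) ^ cost l u ≤ 1 / (u + 1) - 1 / ((u + 1 : ℕ) + 1) := by
    have h2 : (u / 2 : ℕ) + 1 ≤ 2 ^ Nat.size (u / 2) := Nat.lt_size_self _
    have h3 : u + 1 ≤ 2 * 2 ^ Nat.size (u / 2) := by omega
    have h4 : ((u : ℝ) + 1) ≤ 2 * 2 ^ Nat.size (u / 2) := by exact_mod_cast h3
    have h5 : (1 / 4 : ℝ) ^ cost l u ≤ (1 / 4) ^ (Nat.size (u / 2) + 5) :=
      pow_le_pow_of_le_one (by norm_num) (by norm_num) (by unfold cost; omega)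
    refine h5.trans ?_
    have h6 : (1 : ℝ) / (u + 1) - 1 / ((u + 1 : ℕ) + 1) = 1 / ((u + 1) * (u + 2)) := by
      push_cast
      field_simp
      ring
    rw [h6, one_div_pow, show (4 : ℝ) = 2 ^ 2 by norm_num, ← pow_mul, mul_add, pow_add, mul_comm 2,
      pow_mul]
    refine one_div_le_one_div_of_le (by positivity) ?_
    nlinarith [h4]
  refine (Finset.sum_le_sum fun u _ => h1 u).trans ?_
  rw [Finset.sum_range_sub' (fun u : ℕ => (1 : ℝ) / (u + 1))]
  have : (0 : ℝ) ≤ 1 / (n + 1) := by positivity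
  simp only [Nat.cast_zero, zero_add, div_one]
  linarith

/-- Each index vector has total cost at most `codeBound k N`, so it contributes at least one to `4 ^
codeBound k N * ∑ ∏ 4 ^ (-cost)`. Summed over the whole product set, this factors into `k` sums that
are at most one. -/
theorem card_net_le (k N : ℕ) : ((net k N).card : ℝ) ≤ 4 ^ codeBound k N := by
  have h1 : ((net k N).card : ℝ) ≤ (Index k N).card := by
    exact_mod_cast Finset.card_image_le
  refine h1.trans ?_
  have h2 : ((Index k N).card : ℝ) ≤
      ∑ f ∈ Index k N, 4 ^ codeBound k N * ∏ i, (1 / 4 : ℝ) ^ cost (gridBits N) (f i) := by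
    rw [Finset.card_eq_sum_ones, Nat.cast_sum]
    refine Finset.sum_le_sum fun f hf => ?_
    rw [Finset.prod_pow_eq_pow_sum, one_div_pow, Nat.cast_one, ← div_eq_mul_one_div,
      one_le_div (by positivity)]
    exact pow_le_pow_right₀ (by norm_num) (mem_Index.1 hf).2
  refine h2.trans ?_
  rw [← Finset.mul_sum]
  refine mul_le_of_le_one_right (by positivity) ?_
  refine (Finset.sum_le_sum_of_subset_of_nonneg (Finset.filter_subset _ _)
    fun _ _ _ => by positivity).trans ?_
  rw [← Finset.prod_univ_sum (fun _ => Finset.range _)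
    (fun _ u => (1 / 4 : ℝ) ^ cost (gridBits N) u)]
  exact Finset.prod_le_one (fun _ _ => Finset.sum_nonneg fun _ _ => by positivity)
    fun _ _ => sum_cost_le _ _

theorem encPoint_point {k : ℕ} (N : ℕ) (f : Fin k → ℕ) :
    encPoint (point N f) = encCoords (gridBits N) (List.ofFn f) := by
  have : List.ofFn (point N f) = (List.ofFn f).map (coord (gridBits N)) := by
    rw [List.map_ofFn]
    rfl
  rw [encPoint, this, List.flatMap_map, encCoords]
  congr 1
  funext u
  exact encRat_coord _ u

/-- The number of rows of Pascal's triangle, halved. -/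
def pascalRows (k N : ℕ) : ℕ := 2 * 2 ^ (20 * Nat.size k) * 2 ^ (20 * Nat.size N)

/-- The number of binomial coefficients in a cell, halved. -/
def cellWidth (k N : ℕ) : ℕ := 2 ^ (10 * Nat.size k) * 2 ^ (4 * Nat.size N)

/-- The weight of a coordinate. -/
def weight (k N : ℕ) : ℚ → ℚ := Weigh.cellWeight (pascalRows k N) (cellWidth k N)

theorem weigh_time_le {B s k m p c l D e f : ℕ} (hB : 1 ≤ B) (hs : s ≤ B) (hk : k ≤ B) (hm : m ≤ B)
    (hp : p ≤ B) (hc : c ≤ B) (hl : l ≤ B) (hD : D ≤ B) (he : e ≤ B) (hf : f ≤ B) :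
    s * (12 * m + 12 * p + 64) +
        k * (((25 * e + 7 * c + 2 * l + 27 * m + 17 * p + 29) +
        ((m * (60 * (D + 2 * p + 2 * m * (D + 1)) + 42 * D + 47) + 2) +
        ((m + f) * (8 * D + 4) + p * (54 * D + 52 * p + 33) +
          2 * (D + 2 * p + 2 * m * (D + 1)) + 16 * D + 16 * p + 8))) + 1) +
        (17 * D + 28 * p + 2 * m + 21) + 1 ≤ 1000 * B ^ 4 := by
  have h : B * (12 * B + 12 * B + 64) +
        B * (((25 * B + 7 * B + 2 * B + 27 * B + 17 * B + 29) +
        ((B * (60 * (B + 2 * B + 2 * B * (B + 1)) + 42 * B + 47) + 2) +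
        ((B + B) * (8 * B + 4) + B * (54 * B + 52 * B + 33) +
          2 * (B + 2 * B + 2 * B * (B + 1)) + 16 * B + 16 * B + 8))) + 1) +
        (17 * B + 28 * B + 2 * B + 21) + 1 ≤ 1000 * B ^ 4 := by
    obtain ⟨b, rfl⟩ := Nat.exists_eq_add_of_le hB
    ring_nf
    nlinarith [Nat.zero_le b, Nat.zero_le (b ^ 2), Nat.zero_le (b ^ 3), Nat.zero_le (b ^ 4)]
  refine le_trans ?_ h
  gcongr

theorem weigh_time (k N : ℕ) (hk : 1 ≤ k) (hN : 2 ≤ N) (f : Fin k → ℕ) (hf : f ∈ Index k N) :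
    ∃ t ≤ 1000 * (2 ^ (Nat.size k + Nat.size N)) ^ 92,
      OutputsInTime (Cmd.machine Weigh.prog .inp .out) (encInput k N (some (point N f)))
        (encRat (∏ i, weight k N (point N f i))) t := by
  have hf' := mem_Index_iff_adm.1 hf
  obtain ⟨t, ht, h⟩ := Weigh.runsIn_prog_prod k N (gridBits N) (capBits k N)
    (2 * pascalRows k N * (List.ofFn f).length) (pascalRows k N) (cellWidth k N) (List.ofFn f) rfl
    rfl rfl hf'.2.1 (by
      rw [capBits, pascalRows, cellWidth, mul_assoc, mul_assoc, ← pow_add, ← pow_add, ← pow_add]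
      exact Nat.mul_le_mul_left _ (Nat.pow_le_pow_right (by omega) (by omega)))
  refine ⟨t + 1, ?_, ?_⟩
  · refine (Nat.add_le_add_right ht 1).trans ?_
    rw [List.length_ofFn]
    set σ := Nat.size k + Nat.size N with hσ
    have h2 : 2 ≤ Nat.size N := Nat.lt_size.2 hN
    have h3 : 1 ≤ Nat.size k := Nat.lt_size.2 hk
    have hk2 : k ≤ 2 ^ σ := (Nat.lt_size_self k).le.trans (Nat.pow_le_pow_right (by omega) (by omega))
    have hσ2 : σ ≤ 2 ^ σ := Nat.lt_two_pow_self.le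
    have ht8 : 8 ≤ 2 ^ σ := (Nat.pow_le_pow_right (n := 2) (by omega) (show 3 ≤ σ by omega))
    have hm : pascalRows k N = 2 * (2 ^ σ) ^ 20 := by
      rw [pascalRows, mul_assoc, ← pow_add, ← pow_mul, ← mul_add, mul_comm 20]
    have hpow (n : ℕ) (hn : n ≤ 23 * σ) : 2 ^ n ≤ (2 ^ σ) ^ 23 := by
      rw [← pow_mul, mul_comm σ]
      exact Nat.pow_le_pow_right (by omega) hn
    have hlin : 8 * 2 ^ σ ≤ (2 ^ σ) ^ 23 := by
      calc 8 * 2 ^ σ ≤ 2 ^ σ * 2 ^ σ := Nat.mul_le_mul_right _ ht8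
        _ = (2 ^ σ) ^ 2 := by ring
        _ ≤ _ := Nat.pow_le_pow_right (by omega) (by omega)
    -- All quantities are bounded by the 23rd power of `2 ^ σ`: the largest, `D = 2 m k`, is at most
    -- `4 * (2 ^ σ) ^ 21`, and `4` is absorbed by two more factors. The fourth power of `B` gives
    -- the exponent 92.
    refine (weigh_time_le (B := (2 ^ σ) ^ 23) (Nat.one_le_pow _ _ (by omega)) ?_ ?_ ?_ ?_ ?_ ?_ ?_ ?_
      ?_).trans (le_of_eq ?_)
    · omega
    · omega
    · rw [hm, show (2 ^ σ) ^ 23 = (2 ^ σ) ^ 3 * (2 ^ σ) ^ 20 by ring]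
      exact Nat.mul_le_mul_right _ (by nlinarith [Nat.pow_le_pow_left ht8 3])
    · rw [cellWidth, ← pow_add]
      exact hpow _ (by omega)
    · rw [capBits]; omega
    · rw [gridBits]; omega
    · rw [hm]
      calc 2 * (2 * (2 ^ σ) ^ 20) * k ≤ 2 * (2 * (2 ^ σ) ^ 20) * 2 ^ σ := Nat.mul_le_mul_left _ hk2
        _ = 4 * (2 ^ σ) ^ 21 := by ring
        _ ≤ (2 ^ σ) ^ 2 * (2 ^ σ) ^ 21 :=
          Nat.mul_le_mul_right _ (by nlinarith [Nat.pow_le_pow_left ht8 2])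
        _ = _ := by ring
    · rw [cellWidth, capBits, ← pow_add, ← pow_add]
      exact hpow _ (by omega)
    · rw [cellWidth, capBits, ← pow_add, mul_assoc, ← pow_add, ← pow_succ']
      exact hpow _ (by omega)
    · ring
  · have h1 := h.outputsInTime
    rw [encInput, encOptPoint, encPoint_point]
    convert h1 using 2
    rw [List.map_ofFn, List.prod_ofFn]
    rfl

theorem exists_enumeration (k N : ℕ) (hk : 1 ≤ k) (hN : 1 ≤ N) :
    ∃ L : List (Fin k → ℚ), L.Nodup ∧ (∀ x, x ∈ L ↔ x ∈ net k N) ∧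
      ∀ i ≤ L.length, ∃ t ≤ 3000 * (k * Nat.size N) + 1, ∃ s ≤ 4000 * (k * Nat.size N),
        OutputsInTime (Cmd.machine Enum.prog .inp .out) (encInput k N (prevEntry L i))
          (encOptPoint L[i]?) t ∧
        UsesSpace (Cmd.machine Enum.prog .inp .out) (encInput k N (prevEntry L i)) s := by
  have hN1 : 1 ≤ Nat.size N := Nat.lt_size.2 hN
  have hk1 : Nat.size k ≤ k := Enum.size_le_self k
  have hkN : k * 1 ≤ k * Nat.size N := Nat.mul_le_mul_left _ hN1
  have hkN' : 1 * Nat.size N ≤ k * Nat.size N := Nat.mul_le_mul_right _ hk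
  obtain ⟨L, hL, hmem⟩ := exists_orbit (gridBits N) (capBits k N) k (codeBound k N) (by
    rw [codeBound, cost, gridBits]
    exact Nat.mul_le_mul_left _ (by simp; omega))
  -- The default value `0` is never used, since the lists in the orbit have length `k`.
  set F : List ℕ → Fin k → ℚ := fun v => point N fun i => v.getD i 0 with hF
  have hofFn (v : List ℕ) (hv : v.length = k) : List.ofFn (fun i : Fin k => v.getD i 0) = v := by
    refine List.ext_getElem (by simp [hv]) fun i h1 h2 => ?_
    simp [h2]
  have henc (v : List ℕ) (hv : v ∈ L) : encPoint (F v) = encCoords (gridBits N) v := by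
    rw [hF, encPoint_point, hofFn v ((hmem v).1 hv).1]
  have hopt : ∀ o : Option (List ℕ), (∀ v, o = some v → v ∈ L) →
      encOptPoint (o.map F) = match o with
        | none => [Sym.noPoint]
        | some v => encCoords (gridBits N) v := by
    rintro (_ | v) ho
    · rfl
    · exact henc v (ho v rfl)
  refine ⟨L.map F, ?_, ?_, ?_⟩
  · refine List.Nodup.map_on ?_ hL.nodup
    intro v hv v' hv' h
    have h1 := point_injective k N h
    rw [← hofFn v ((hmem v).1 hv).1, ← hofFn v' ((hmem v').1 hv').1, h1]
  · intro x
    simp only [List.mem_map, net, Finset.mem_image]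
    constructor
    · rintro ⟨v, hv, rfl⟩
      refine ⟨fun i => v.getD i 0, ?_, rfl⟩
      rw [mem_Index_iff_adm, hofFn v ((hmem v).1 hv).1]
      exact (hmem v).1 hv
    · rintro ⟨f, hf, rfl⟩
      refine ⟨List.ofFn f, (hmem _).2 (mem_Index_iff_adm.1 hf), ?_⟩
      simp [hF]
  · intro i hi
    rw [List.length_map] at hi
    rw [List.getElem?_map, hopt _ (fun v hv => List.mem_of_getElem? hv)]
    rcases Nat.eq_zero_or_pos i with rfl | hi0
    · obtain ⟨t, ht, h⟩ := Enum.runsIn_prog_noPoint k N hk hN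
      refine ⟨t + 1, by omega, _, ?_, ?_, h.usesSpace⟩
      · simp [encNat, length_bits]
        omega
      · rw [hL.getElem?_zero]
        exact h.outputsInTime
    · obtain ⟨j, rfl⟩ : ∃ j, i = j + 1 := ⟨i - 1, by omega⟩
      have hj : j < L.length := by omega
      have hLj : L[j]? = some L[j] := List.getElem?_eq_getElem hj
      have hmj : L[j] ∈ L := List.getElem_mem hj
      obtain ⟨t, ht, h⟩ := Enum.runsIn_prog_point k N hk hN L[j] ((hmem _).1 hmj)
      have hprev : prevEntry (L.map F) (j + 1) = some (F L[j]) := by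
        simp [prevEntry, hj]
      have hinp : encInput k N (prevEntry (L.map F) (j + 1)) =
          encNat k ++ encNat N ++ encCoords (6 * Nat.size N) L[j] := by
        rw [hprev, encInput, encOptPoint, henc _ hmj, gridBits]
      rw [hinp, hL.getElem?_succ hLj]
      refine ⟨t + 1, by omega, _, ?_, h.outputsInTime, h.usesSpace⟩
      have hcost := ((hmem _).1 hmj).2.2
      rw [codeBound, gridBits] at hcost
      simp [encNat, length_bits, length_encCoords]
      have : k * (32 * Nat.size N) = 32 * (k * Nat.size N) := by ring
      omega

end GaussianNet

namespace GaussianNet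

/-! ### Central binomial coefficients and Gaussian cells -/

/-- The probability that `2 m` fair coins show `m + j` heads. -/
noncomputable def binomProb (m j : ℕ) : ℝ := ((2 * m).choose (m + j) : ℝ) / 4 ^ m

/-- The Wallis product is an exact expression for the central probability; its bounds around `π/2`
give `binomProb m 0 ≈ 1/√(π m)` up to a factor `exp (-1/m)`. -/
theorem binomProb_zero_sq (m : ℕ) : binomProb m 0 ^ 2 * (Real.Wallis.W m * (2 * m + 1)) = 1 := by
  have h : (((2 * m).choose m : ℕ) : ℝ) * (m.factorial : ℝ) * (m.factorial : ℝ) =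
      ((2 * m).factorial : ℝ) := by
    have := Nat.choose_mul_factorial_mul_factorial (n := 2 * m) (k := m) (by omega)
    rw [show 2 * m - m = m by omega] at this
    exact_mod_cast this
  have h1 : (m.factorial : ℝ) ≠ 0 := by positivity
  have h2 : ((2 * m).choose m : ℝ) ≠ 0 := by
    have := Nat.choose_pos (n := 2 * m) (k := m) (by omega)
    positivity
  rw [Real.Wallis.W_eq_factorial_ratio, ← h, binomProb, add_zero, pow_mul]
  have h3 : ((2 : ℝ) ^ 4) ^ m = 4 ^ m * 4 ^ m := by rw [← mul_pow]; norm_num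
  have h4 : (2 * (m : ℝ) + 1) ≠ 0 := by positivity
  rw [h3]
  field_simp

theorem binomProb_zero_le {m : ℕ} (hm : 1 ≤ m) : binomProb m 0 ≤ (√(Real.pi * m))⁻¹ := by
  have hm' : (1 : ℝ) ≤ m := by exact_mod_cast hm
  have h := binomProb_zero_sq m
  have hW := Real.Wallis.le_W m
  have hpi := Real.pi_pos
  have h1 : Real.pi * m ≤ Real.Wallis.W m * (2 * m + 1) := by
    have h2 : m ≤ (2 * (m : ℝ) + 1) / (2 * m + 2) / 2 * (2 * m + 1) := by
      rw [div_div, div_mul_eq_mul_div, le_div_iff₀ (by positivity)]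
      nlinarith
    calc Real.pi * m ≤ Real.pi * ((2 * (m : ℝ) + 1) / (2 * m + 2) / 2 * (2 * m + 1)) := by gcongr
      _ = (2 * (m : ℝ) + 1) / (2 * m + 2) * (Real.pi / 2) * (2 * m + 1) := by ring
      _ ≤ _ := by gcongr
  have h0 : 0 ≤ binomProb m 0 := by unfold binomProb; positivity
  rw [← pow_le_pow_iff_left₀ h0 (by positivity) two_ne_zero, inv_pow,
    Real.sq_sqrt (by positivity), ← one_div, le_div_iff₀ (by positivity), ← h]
  gcongr

theorem le_binomProb_zero {m : ℕ} (hm : 1 ≤ m) :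
    (√(Real.pi * m))⁻¹ * Real.exp (-(1 / m)) ≤ binomProb m 0 := by
  have hm' : (1 : ℝ) ≤ m := by exact_mod_cast hm
  have h := binomProb_zero_sq m
  have hW := Real.Wallis.W_le m
  have hpi := Real.pi_pos
  have h0 : 0 ≤ binomProb m 0 := by unfold binomProb; positivity
  have h1 : Real.Wallis.W m * (2 * m + 1) ≤ Real.pi * m * Real.exp (2 / m) := by
    have h2 : 1 + 2 / (m : ℝ) ≤ Real.exp (2 / m) := by
      rw [add_comm]; exact Real.add_one_le_exp _
    calc Real.Wallis.W m * (2 * m + 1) ≤ Real.pi / 2 * (2 * m + 1) := by gcongr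
      _ ≤ Real.pi * m * (1 + 2 / m) := by
        have : Real.pi * m * (1 + 2 / m) = Real.pi / 2 * (2 * m + 4) := by
          field_simp
          ring
        rw [this]
        gcongr
        norm_num
      _ ≤ _ := by gcongr
  rw [← pow_le_pow_iff_left₀ (by positivity) h0 two_ne_zero, mul_pow, inv_pow,
    Real.sq_sqrt (by positivity), ← Real.exp_nat_mul]
  have h3 : Real.exp ((2 : ℕ) * -(1 / (m : ℝ))) = (Real.exp (2 / m))⁻¹ := by
    rw [← Real.exp_neg]
    congr 1
    push_cast
    ring
  rw [h3, ← mul_inv]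
  refine inv_le_of_inv_le₀ (by by_contra hb; simp at hb; rw [hb] at h; simp at h) ?_
  exact (eq_inv_of_mul_eq_one_right h).symm.le.trans h1

theorem binomProb_succ (m j : ℕ) (hj : j ≤ m) :
    binomProb m (j + 1) = binomProb m j * (((m : ℝ) - j) / (m + j + 1)) := by
  have h := Nat.choose_succ_right_eq (2 * m) (m + j)
  rw [show 2 * m - (m + j) = m - j by omega] at h
  have h' : ((2 * m).choose (m + j + 1) : ℝ) * (m + j + 1) =
      (2 * m).choose (m + j) * ((m : ℝ) - j) := by
    rw [← Nat.cast_sub hj]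
    exact_mod_cast h
  rw [binomProb, binomProb, ← add_assoc]
  have : (m : ℝ) + j + 1 ≠ 0 := by positivity
  rw [div_mul_div_comm, ← h', mul_div_mul_right _ _ this]

/-- The ratio of successive terms is `(m - j)/(m + j + 1)`, which lies between `exp (-(2j+1)/(m-J))`
and `exp (-(2j+1)/(m+J))` by `1 + x ≤ exp x`. The exponents telescope, as `2 j + 1 = (j+1)^2 - j^2`.
-/
theorem binomProb_bounds {m J j : ℕ} (hJ : J < m) (hj : j ≤ J) :
    binomProb m j ≤ binomProb m 0 * Real.exp (-((j : ℝ) ^ 2 / (m + J))) ∧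
      binomProb m 0 * Real.exp (-((j : ℝ) ^ 2 / (m - J))) ≤ binomProb m j := by
  have hJ' : (J : ℝ) < m := by exact_mod_cast hJ
  induction j with
  | zero => simp
  | succ j ih =>
    obtain ⟨h1, h2⟩ := ih (by omega)
    have hj' : (j : ℝ) + 1 ≤ J := by exact_mod_cast hj
    have hb (i : ℕ) : 0 ≤ binomProb m i := by unfold binomProb; positivity
    have hmj : 0 < (m : ℝ) - j := by linarith
    have hmJ : 0 < (m : ℝ) - J := by linarith
    have hm0 : (0 : ℝ) ≤ m := by positivity
    have hJ0 : (0 : ℝ) ≤ J := by positivity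
    rw [binomProb_succ m j (by omega)]
    constructor
    · have h3 : ((m : ℝ) - j) / (m + j + 1) ≤ Real.exp (-((2 * j + 1) / (m + J))) := by
        calc ((m : ℝ) - j) / (m + j + 1) = -((2 * j + 1) / (m + j + 1)) + 1 := by
              field_simp
              ring
          _ ≤ Real.exp (-((2 * j + 1) / (m + j + 1))) := Real.add_one_le_exp _
          _ ≤ _ := by
              have : (2 * (j : ℝ) + 1) / (m + J) ≤ (2 * j + 1) / (m + j + 1) :=
                div_le_div_of_nonneg_left (by positivity) (by positivity) (by linarith)
              exact Real.exp_le_exp.2 (by linarith)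
      calc _ ≤ binomProb m 0 * Real.exp (-((j : ℝ) ^ 2 / (m + J))) *
            Real.exp (-((2 * j + 1) / (m + J))) := by gcongr; exact mul_nonneg (hb 0) (Real.exp_pos _).le
        _ = _ := by
          rw [mul_assoc, ← Real.exp_add]
          congr 2
          push_cast
          ring
    · have h3 : Real.exp (-((2 * j + 1) / (m - J))) ≤ ((m : ℝ) - j) / (m + j + 1) := by
        rw [Real.exp_neg, show ((m : ℝ) - j) / (m + j + 1) = (((m : ℝ) + j + 1) / (m - j))⁻¹ from
          (inv_div _ _).symm]
        refine inv_anti₀ (by positivity) ?_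
        calc ((m : ℝ) + j + 1) / (m - j) = (2 * j + 1) / (m - j) + 1 := by
              field_simp
              ring
          _ ≤ (2 * j + 1) / (m - J) + 1 := by
              gcongr
              linarith
          _ ≤ _ := Real.add_one_le_exp _
      calc _ = binomProb m 0 * Real.exp (-((j : ℝ) ^ 2 / (m - J))) *
            Real.exp (-((2 * j + 1) / (m - J))) := by
            rw [mul_assoc, ← Real.exp_add]
            congr 2
            push_cast
            ring
        _ ≤ _ := by gcongr; exact hb j

/-- The number of heads has standard deviation `√(m/2)`, so one step has standardized length `h =
√(2/m)`. At the end points of the interval the density times `h` is `exp (-j^2/m)/√(π m)` and `exp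
(-(j+1)^2/m)/√(π m)`, and between them the density decreases. -/
theorem fine_cell_bounds {m : ℕ} (hm : 1 ≤ m) (j : ℕ) :
    (√(Real.pi * m))⁻¹ * Real.exp (-(((j : ℝ) + 1) ^ 2 / m)) ≤
      ∫ x in (j * √(2 / m))..((j + 1 : ℕ) * √(2 / m)), gaussianPDFReal 0 1 x ∧
    ∫ x in (j * √(2 / m))..((j + 1 : ℕ) * √(2 / m)), gaussianPDFReal 0 1 x ≤
      (√(Real.pi * m))⁻¹ * Real.exp (-((j : ℝ) ^ 2 / m)) := by
  have hm' : (0 : ℝ) < m := by exact_mod_cast hm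
  set h := √(2 / (m : ℝ)) with hh
  have h0 : 0 ≤ h := Real.sqrt_nonneg _
  have hsq : h ^ 2 = 2 / m := Real.sq_sqrt (by positivity)
  have hle : (j : ℝ) * h ≤ (j + 1 : ℕ) * h := by
    push_cast
    nlinarith
  have hint (a b : ℝ) : IntervalIntegrable (gaussianPDFReal 0 1) volume a b :=
    (integrable_gaussianPDFReal 0 1).intervalIntegrable
  have hconst : (√(2 * Real.pi * (1 : NNReal)))⁻¹ * h = (√(Real.pi * m))⁻¹ := by
    rw [hh, NNReal.coe_one, mul_one, ← Real.sqrt_inv, ← Real.sqrt_mul (by positivity),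
      ← Real.sqrt_inv]
    congr 1
    field_simp
  have hlen : ((j + 1 : ℕ) * h) - j * h = h := by push_cast; ring
  constructor
  · have h1 := intervalIntegral.integral_mono_on (μ := volume) (f := fun _ =>
      (√(2 * Real.pi * (1 : NNReal)))⁻¹ * Real.exp (-(((j : ℝ) + 1) ^ 2 / m))) hle
      (by simp) (hint _ _) (by
        intro x hx
        rw [gaussianPDFReal_def]
        refine mul_le_mul_of_nonneg_left (Real.exp_le_exp.2 ?_) (by positivity)
        have hx0 : 0 ≤ x := le_trans (by positivity) hx.1
        have hx1 : x ^ 2 ≤ ((j + 1 : ℕ) * h) ^ 2 := pow_le_pow_left₀ hx0 hx.2 2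
        rw [mul_pow, hsq] at hx1
        push_cast at hx1 ⊢
        have e : ((j : ℝ) + 1) ^ 2 * (2 / m) = 2 * (((j : ℝ) + 1) ^ 2 / m) := by ring
        simp only [sub_zero, mul_one]
        linarith)
    refine le_trans (le_of_eq ?_) h1
    rw [intervalIntegral.integral_const, hlen, smul_eq_mul, ← hconst]
    ring
  · have h1 := intervalIntegral.integral_mono_on (μ := volume) (g := fun _ =>
      (√(2 * Real.pi * (1 : NNReal)))⁻¹ * Real.exp (-((j : ℝ) ^ 2 / m))) hle
      (hint _ _) (by simp) (by
        intro x hx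
        rw [gaussianPDFReal_def]
        refine mul_le_mul_of_nonneg_left (Real.exp_le_exp.2 ?_) (by positivity)
        have hx1 : (j * h) ^ 2 ≤ x ^ 2 := pow_le_pow_left₀ (by positivity) hx.1 2
        rw [mul_pow, hsq] at hx1
        push_cast
        have e : (j : ℝ) ^ 2 * (2 / m) = 2 * ((j : ℝ) ^ 2 / m) := by ring
        simp only [sub_zero, mul_one]
        linarith)
    refine h1.trans (le_of_eq ?_)
    rw [intervalIntegral.integral_const, hlen, smul_eq_mul, ← hconst]
    ring

/-- The three error terms come from replacing `m ± J` by `m` in the exponent, from the passage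
between the two ends of the interval (`2 j + 1 ≤ 3 J`), and from Wallis' product. The probability is
compared with the interval starting at `j h`, not with one centred there; the shift is part of the
second term. -/
theorem binomProb_fine_cell {m J j : ℕ} (hJ : 2 * J ≤ m) (hj : j < J) :
    binomProb m j ≤ Real.exp (2 * (J : ℝ) ^ 3 / m ^ 2 + 3 * J / m + 1 / m) *
      ∫ x in (j * √(2 / m))..((j + 1 : ℕ) * √(2 / m)), gaussianPDFReal 0 1 x ∧
    Real.exp (-(2 * (J : ℝ) ^ 3 / m ^ 2 + 3 * J / m + 1 / m)) *
      ∫ x in (j * √(2 / m))..((j + 1 : ℕ) * √(2 / m)), gaussianPDFReal 0 1 x ≤ binomProb m j := by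
  have hm : 1 ≤ m := by omega
  obtain ⟨h1, h2⟩ := binomProb_bounds (m := m) (by omega) hj.le
  obtain ⟨h3, h4⟩ := fine_cell_bounds hm j
  have h5 := binomProb_zero_le hm
  have h6 := le_binomProb_zero hm
  have hm' : (0 : ℝ) < m := by exact_mod_cast hm
  have hj0 : (0 : ℝ) ≤ j := by positivity
  have hj' : (j : ℝ) + 1 ≤ J := by exact_mod_cast hj
  have hJ' : 2 * (J : ℝ) ≤ m := by exact_mod_cast hJ
  have hJ0 : (0 : ℝ) ≤ J := by positivity
  have hj2 : (j : ℝ) ^ 2 ≤ J ^ 2 := pow_le_pow_left₀ hj0 (by linarith) 2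
  set η := 2 * (J : ℝ) ^ 3 / m ^ 2 + 3 * J / m + 1 / m with hη
  have hs : 0 ≤ (√(Real.pi * m))⁻¹ := by positivity
  constructor
  · calc binomProb m j ≤ (√(Real.pi * m))⁻¹ * Real.exp (-((j : ℝ) ^ 2 / (m + J))) :=
          h1.trans (by gcongr)
      _ ≤ (√(Real.pi * m))⁻¹ * Real.exp (η + -(((j : ℝ) + 1) ^ 2 / m)) := by
          refine mul_le_mul_of_nonneg_left (Real.exp_le_exp.2 ?_) hs
          have e1 : (j : ℝ) ^ 2 / m - j ^ 2 / (m + J) ≤ (J : ℝ) ^ 3 / m ^ 2 := by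
            have : (j : ℝ) ^ 2 / m - j ^ 2 / (m + J) = j ^ 2 * J / (m * (m + J)) := by
              field_simp
              ring
            rw [this]
            refine div_le_div₀ (by positivity) ?_ (by positivity) (by nlinarith)
            rw [pow_succ (J : ℝ) 2]
            gcongr
          have e2 : ((j : ℝ) + 1) ^ 2 / m ≤ j ^ 2 / m + 3 * J / m := by
            rw [← add_div]
            gcongr
            nlinarith
          have e3 : (J : ℝ) ^ 3 / m ^ 2 ≤ 2 * (J : ℝ) ^ 3 / m ^ 2 := by
            gcongr
            linarith [show (0 : ℝ) ≤ (J : ℝ) ^ 3 by positivity]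
          have e4 : (0 : ℝ) ≤ 1 / m := by positivity
          linarith
      _ = Real.exp η * ((√(Real.pi * m))⁻¹ * Real.exp (-(((j : ℝ) + 1) ^ 2 / m))) := by
          rw [Real.exp_add]; ring
      _ ≤ _ := by gcongr
  · calc _ ≤ Real.exp (-η) * ((√(Real.pi * m))⁻¹ * Real.exp (-((j : ℝ) ^ 2 / m))) := by gcongr
      _ = (√(Real.pi * m))⁻¹ * Real.exp (-η + -((j : ℝ) ^ 2 / m)) := by rw [Real.exp_add]; ring
      _ ≤ (√(Real.pi * m))⁻¹ * Real.exp (-(1 / m) + -((j : ℝ) ^ 2 / (m - J))) := by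
          refine mul_le_mul_of_nonneg_left (Real.exp_le_exp.2 ?_) hs
          have hmJ : 0 < (m : ℝ) - J := by linarith
          have e1 : (j : ℝ) ^ 2 / (m - J) - j ^ 2 / m ≤ 2 * (J : ℝ) ^ 3 / m ^ 2 := by
            have : (j : ℝ) ^ 2 / (m - J) - j ^ 2 / m = j ^ 2 * J / (m * (m - J)) := by
              field_simp
              ring
            rw [this, show 2 * (J : ℝ) ^ 3 / m ^ 2 = J ^ 3 / (m * (m / 2)) by field_simp]
            refine div_le_div₀ (by positivity) ?_ (by positivity) ?_
            · rw [pow_succ (J : ℝ) 2]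
              gcongr
            · gcongr
              linarith
          have e4 : (0 : ℝ) ≤ 3 * J / m := by positivity
          linarith
      _ = (√(Real.pi * m))⁻¹ * Real.exp (-(1 / m)) * Real.exp (-((j : ℝ) ^ 2 / (m - J))) := by
          rw [Real.exp_add]; ring
      _ ≤ _ := le_trans (by gcongr) h2

/-- The relative error is the same for each of the `2 p` fine intervals, so it passes to their
union. -/
theorem cellSum_bounds {m p a J : ℕ} (hJ : 2 * J ≤ m) (ha : 2 * (a + 1) * p ≤ J) :
    (Weigh.cellSum m p a : ℝ) / 2 ^ (2 * m) ≤
      Real.exp (2 * (J : ℝ) ^ 3 / m ^ 2 + 3 * J / m + 1 / m) *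
        ∫ x in (a * (2 * p * √(2 / m)))..((a + 1) * (2 * p * √(2 / m))), gaussianPDFReal 0 1 x ∧
    Real.exp (-(2 * (J : ℝ) ^ 3 / m ^ 2 + 3 * J / m + 1 / m)) *
        (∫ x in (a * (2 * p * √(2 / m)))..((a + 1) * (2 * p * √(2 / m))), gaussianPDFReal 0 1 x) ≤
      (Weigh.cellSum m p a : ℝ) / 2 ^ (2 * m) := by
  have h1 : (Weigh.cellSum m p a : ℝ) / 2 ^ (2 * m) =
      ∑ i ∈ Finset.range (2 * p), binomProb m (2 * a * p + i) := by
    rw [Weigh.cellSum, Nat.cast_sum, Finset.sum_div, pow_mul]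
    refine Finset.sum_congr rfl fun i _ => ?_
    rw [binomProb, add_assoc]
    norm_num
  have h2 := intervalIntegral.sum_integral_adjacent_intervals (f := gaussianPDFReal 0 1)
    (μ := volume) (a := fun i : ℕ => ((2 * a * p + i : ℕ) : ℝ) * √(2 / m)) (n := 2 * p)
    fun k _ => (integrable_gaussianPDFReal 0 1).intervalIntegrable
  have h3 : ((2 * a * p + 0 : ℕ) : ℝ) * √(2 / m) = a * (2 * p * √(2 / m)) := by push_cast; ring
  have h4 : ((2 * a * p + 2 * p : ℕ) : ℝ) * √(2 / m) = (a + 1) * (2 * p * √(2 / m)) := by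
    push_cast; ring
  rw [h3, h4] at h2
  have hlt (i : ℕ) (hi : i ∈ Finset.range (2 * p)) : 2 * a * p + i < J := by
    have := Finset.mem_range.1 hi
    have : 2 * (a + 1) * p = 2 * a * p + 2 * p := by ring
    omega
  rw [h1, ← h2, Finset.mul_sum, Finset.mul_sum]
  exact ⟨Finset.sum_le_sum fun i hi => (binomProb_fine_cell hJ (hlt i hi)).1,
    Finset.sum_le_sum fun i hi => (binomProb_fine_cell hJ (hlt i hi)).2⟩

end GaussianNet

namespace GaussianNet

/-! ### Unconditional semi-norms -/

section Unconditional

variable {k : ℕ}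

/-- Change the signs of the coordinates. -/
def flip (s : Fin k → ℤˣ) : (Fin k → ℝ) →ₗ[ℝ] (Fin k → ℝ) :=
  LinearMap.pi fun i => ((s i : ℤ) : ℝ) • LinearMap.proj i

@[simp] theorem flip_apply (s : Fin k → ℤˣ) (x : Fin k → ℝ) (i : Fin k) :
    flip s x i = ((s i : ℤ) : ℝ) * x i := rfl

theorem flip_flip (s s' : Fin k → ℤˣ) (x : Fin k → ℝ) :
    flip s (flip s' x) = flip (s * s') x := by
  funext i
  simp [mul_assoc]

/-- A semi-norm that ignores the signs of the coordinates. -/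
def Unconditional (φ : Seminorm ℝ (Fin k → ℝ)) : Prop := ∀ s x, φ (flip s x) = φ x

/-- The sum over all changes of signs. -/
noncomputable def symmetrize (φ : Seminorm ℝ (Fin k → ℝ)) : Seminorm ℝ (Fin k → ℝ) :=
  ∑ s : Fin k → ℤˣ, φ.comp (flip s)

theorem symmetrize_apply (φ : Seminorm ℝ (Fin k → ℝ)) (x : Fin k → ℝ) :
    symmetrize φ x = ∑ s, φ (flip s x) := by
  have h (T : Finset (Fin k → ℤˣ)) : (∑ s ∈ T, φ.comp (flip s)) x = ∑ s ∈ T, φ (flip s x) := by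
    induction T using Finset.cons_induction with
    | empty => simp
    | cons s T hs ih => rw [Finset.sum_cons, Finset.sum_cons, add_apply, ih]; rfl
  exact h _

theorem unconditional_symmetrize (φ : Seminorm ℝ (Fin k → ℝ)) : Unconditional (symmetrize φ) := by
  intro s x
  rw [symmetrize_apply, symmetrize_apply]
  simp_rw [flip_flip]
  exact Fintype.sum_equiv (Equiv.mulRight s) _ _ fun _ => rfl

namespace Unconditional

variable {φ : Seminorm ℝ (Fin k → ℝ)}

/-- Replacing the `i`th coordinate `d` by `c` gives a convex combination of the vector and its
reflection in that coordinate, and both have the same semi-norm. -/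
theorem update_le (hφ : Unconditional φ) (x : Fin k → ℝ) (i : Fin k) {c d : ℝ} (h : |c| ≤ d) :
    φ (Function.update x i c) ≤ φ (Function.update x i d) := by
  rcases eq_or_ne d 0 with rfl | hd
  · rw [abs_nonpos_iff.1 h]
  · have hd0 : 0 < d := lt_of_le_of_ne ((abs_nonneg c).trans h) hd.symm
    obtain ⟨h1, h2⟩ := abs_le.1 h
    have hc1 : -1 ≤ c / d := by rw [le_div_iff₀ hd0]; linarith
    have hc2 : c / d ≤ 1 := by rw [div_le_iff₀ hd0]; linarith
    have h3 := φ.convexOn.2 (Set.mem_univ (Function.update x i d))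
      (Set.mem_univ (flip (Function.update 1 i (-1)) (Function.update x i d)))
      (show 0 ≤ (1 + c / d) / 2 by linarith) (show 0 ≤ (1 - c / d) / 2 by linarith) (by ring)
    rw [hφ, ← add_smul, show (1 + c / d) / 2 + (1 - c / d) / 2 = 1 by ring, one_smul] at h3
    refine le_of_eq_of_le (congrArg φ ?_) h3
    funext j
    rcases eq_or_ne j i with rfl | hj
    · simp
      field_simp
      ring
    · simp [hj]
      ring

theorem mono (hφ : Unconditional φ) {x y : Fin k → ℝ} (h : ∀ i, |x i| ≤ y i) : φ x ≤ φ y := by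
  have h1 (T : Finset (Fin k)) : φ x ≤ φ (T.piecewise y x) := by
    induction T using Finset.induction_on with
    | empty => simp
    | insert i T hi ih =>
      rw [Finset.piecewise_insert]
      refine ih.trans ?_
      have h2 := hφ.update_le (T.piecewise y x) i (h i)
      rwa [show Function.update (T.piecewise y x) i (x i) = T.piecewise y x by
        rw [Function.update_eq_self_iff, Finset.piecewise_eq_of_notMem _ _ _ hi]] at h2
  simpa using h1 Finset.univ

/-- The triangle inequality over the coordinates; each unit vector lies below the vector of ones, so
monotonicity applies. -/
theorem le_one_norm (hφ : Unconditional φ) (x : Fin k → ℝ) : φ x ≤ (∑ i, |x i|) * φ 1 := by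
  have h1 : x = ∑ i, Pi.single i (x i) := (Finset.univ_sum_single x).symm
  calc φ x ≤ ∑ i, φ (Pi.single i (x i)) := by
        conv_lhs => rw [h1]
        exact Finset.le_sum_of_subadditive φ (map_zero φ).le (map_add_le_add φ) _ _
    _ ≤ ∑ i, |x i| * φ 1 := by
        refine Finset.sum_le_sum fun i _ => ?_
        have h2 : |x i| * φ 1 = φ (|x i| • (1 : Fin k → ℝ)) := by
          rw [map_smul_eq_mul, Real.norm_eq_abs, abs_abs]
        rw [h2]
        refine hφ.mono fun j => ?_
        rcases eq_or_ne j i with rfl | hj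
        · simp
        · simp [hj]
    _ = _ := (Finset.sum_mul _ _ _).symm

end Unconditional

end Unconditional

/-! ### Gaussian integrals -/

theorem continuous_seminorm {k : ℕ} (φ : Seminorm ℝ (Fin k → ℝ)) : Continuous φ :=
  continuousOn_univ.1 (φ.convexOn.continuousOn isOpen_univ)

theorem integrable_abs_gaussianReal : Integrable (fun x : ℝ => |x|) (gaussianReal 0 1) :=
  ((memLp_id_gaussianReal 1).integrable (by simp)).abs

theorem integrable_exp_abs_gaussianReal :
    Integrable (fun x : ℝ => Real.exp (2 * |x|)) (gaussianReal 0 1) := by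
  refine ((integrable_exp_mul_gaussianReal 2).add (integrable_exp_mul_gaussianReal (-2))).mono'
    (by fun_prop) (Filter.Eventually.of_forall fun x => ?_)
  rw [Real.norm_eq_abs, Real.abs_exp, Pi.add_apply]
  rcases abs_cases x with ⟨h, _⟩ | ⟨h, _⟩ <;> rw [h]
  · linarith [Real.exp_pos (-2 * x)]
  · rw [mul_neg, ← neg_mul]
    linarith [Real.exp_pos (2 * x)]

theorem integral_exp_abs_gaussianReal_le :
    ∫ x, Real.exp (2 * |x|) ∂(gaussianReal 0 1) ≤ 2 * Real.exp 2 := by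
  have h (t : ℝ) : ∫ x, Real.exp (t * x) ∂(gaussianReal 0 1) = Real.exp (t ^ 2 / 2) := by
    have := mgf_gaussianReal (p := gaussianReal 0 1) (X := id) (μ := 0) (v := 1) (by simp) t
    simpa [mgf] using this
  calc ∫ x, Real.exp (2 * |x|) ∂(gaussianReal 0 1)
      ≤ ∫ x, (Real.exp (2 * x) + Real.exp (-2 * x)) ∂(gaussianReal 0 1) := by
        refine integral_mono integrable_exp_abs_gaussianReal
          ((integrable_exp_mul_gaussianReal 2).add (integrable_exp_mul_gaussianReal (-2)))
          fun x => ?_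
        simp only
        rcases abs_cases x with ⟨h, _⟩ | ⟨h, _⟩ <;> rw [h]
        · linarith [Real.exp_pos (-2 * x)]
        · rw [mul_neg, ← neg_mul]
          linarith [Real.exp_pos (2 * x)]
    _ = 2 * Real.exp 2 := by
        rw [integral_add (integrable_exp_mul_gaussianReal 2) (integrable_exp_mul_gaussianReal (-2)),
          h, h]
        norm_num
        ring

theorem half_le_integral_abs_gaussianReal : 1 / 2 ≤ ∫ x, |x| ∂(gaussianReal 0 1) := by
  have h1 : ∫ x, |x| ∂(gaussianReal 0 1) = 2 * (√(2 * Real.pi))⁻¹ := by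
    rw [integral_gaussianReal_eq_integral_smul one_ne_zero]
    have h2 := integral_comp_abs (f := fun r => (√(2 * Real.pi))⁻¹ *
      (r ^ (1 : ℝ) * Real.exp (-(1 / 2) * r ^ (2 : ℝ))))
    have h3 := integral_rpow_mul_exp_neg_mul_rpow (p := 2) (q := 1) (b := 1 / 2) (by norm_num)
      (by norm_num) (by norm_num)
    have h4 : (1 / 2 : ℝ) ^ (-(1 + 1) / 2 : ℝ) * (1 / 2) * Real.Gamma ((1 + 1) / 2) = 1 := by
      norm_num [Real.rpow_neg_one]
    rw [integral_const_mul (μ := volume.restrict (Set.Ioi 0)), h3, h4, mul_one] at h2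
    rw [← h2]
    refine integral_congr_ae (Filter.Eventually.of_forall fun x => ?_)
    simp only [gaussianPDFReal_def, smul_eq_mul, NNReal.coe_one, mul_one, sub_zero, Real.rpow_one,
      Real.rpow_two, sq_abs]
    ring_nf
  rw [h1]
  have h3 : √(2 * Real.pi) ≤ 4 := by
    rw [Real.sqrt_le_left (by norm_num)]
    linarith [Real.pi_le_four]
  have h4 : 0 < √(2 * Real.pi) := by positivity
  rw [← div_eq_mul_inv, div_le_div_iff₀ (by norm_num) h4]
  linarith

instance (k : ℕ) : IsProbabilityMeasure (stdGaussianPow k) := by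
  unfold stdGaussianPow
  infer_instance

theorem measurePreserving_flip {k : ℕ} (s : Fin k → ℤˣ) :
    MeasurePreserving (flip s) (stdGaussianPow k) (stdGaussianPow k) := by
  refine measurePreserving_pi (fun _ => gaussianReal 0 1) (fun _ => gaussianReal 0 1)
    (f := fun i x => ((s i : ℤ) : ℝ) * x) fun i => ⟨by fun_prop, ?_⟩
  rcases Int.units_eq_one_or (s i) with h | h <;> rw [gaussianReal_map_const_mul, h] <;> simp

theorem integrable_one_norm (k : ℕ) :
    Integrable (fun x : Fin k → ℝ => ∑ i, |x i|) (stdGaussianPow k) :=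
  integrable_finsetSum _ fun _ _ => integrable_comp_eval integrable_abs_gaussianReal

/-- One term of the symmetrization is `φ` itself, so `φ` is dominated by an unconditional semi-norm
and thus by a multiple of the 1-norm. -/
theorem integrable_seminorm {k : ℕ} (φ : Seminorm ℝ (Fin k → ℝ)) :
    Integrable (fun x => φ x) (stdGaussianPow k) := by
  have h : Integrable (fun x => symmetrize φ x) (stdGaussianPow k) := by
    refine ((integrable_one_norm k).mul_const (symmetrize φ 1)).mono'
      (continuous_seminorm _).aestronglyMeasurable (Filter.Eventually.of_forall fun x => ?_)
    rw [Real.norm_eq_abs, abs_of_nonneg (apply_nonneg _ _)]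
    exact (unconditional_symmetrize φ).le_one_norm x
  refine h.mono' (continuous_seminorm _).aestronglyMeasurable
    (Filter.Eventually.of_forall fun x => ?_)
  rw [Real.norm_eq_abs, abs_of_nonneg (apply_nonneg _ _), symmetrize_apply]
  refine le_trans (le_of_eq ?_) (Finset.single_le_sum (f := fun s => φ (flip s x))
    (fun s _ => apply_nonneg _ _) (Finset.mem_univ 1))
  congr 1
  funext i
  simp

theorem integral_symmetrize {k : ℕ} (φ : Seminorm ℝ (Fin k → ℝ)) :
    ∫ x, symmetrize φ x ∂(stdGaussianPow k) =
      Fintype.card (Fin k → ℤˣ) * ∫ x, φ x ∂(stdGaussianPow k) := by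
  have h (s : Fin k → ℤˣ) : ∫ x, φ (flip s x) ∂(stdGaussianPow k) = ∫ x, φ x ∂(stdGaussianPow k) := by
    conv_rhs => rw [← (measurePreserving_flip s).map_eq]
    rw [integral_map (measurePreserving_flip s).measurable.aemeasurable
      (continuous_seminorm φ).aestronglyMeasurable]
  have hint (s : Fin k → ℤˣ) : Integrable (fun x => φ (flip s x)) (stdGaussianPow k) :=
    (measurePreserving_flip s).integrable_comp_of_integrable (integrable_seminorm φ)
  simp_rw [symmetrize_apply]
  rw [integral_finsetSum _ fun s _ => hint s]
  simp [h]

/-- Jensen's inequality for the vector of absolute values: its mean has all coordinates at least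
`1/2`, and by monotonicity `φ` of the mean is at least `φ 1 / 2`. -/
theorem Unconditional.apply_one_le {k : ℕ} {φ : Seminorm ℝ (Fin k → ℝ)} (hφ : Unconditional φ) :
    φ 1 ≤ 2 * ∫ x, φ x ∂(stdGaussianPow k) := by
  have habs (x : Fin k → ℝ) : φ (fun i => |x i|) = φ x := by
    rw [← hφ (fun i => if x i < 0 then -1 else 1) x]
    congr 1
    funext i
    rcases lt_or_ge (x i) 0 with h | h
    · simp [h, abs_of_neg h]
    · simp [not_lt.2 h, abs_of_nonneg h]
  have hint (i : Fin k) : Integrable (fun x : Fin k → ℝ => |x i|) (stdGaussianPow k) :=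
    integrable_comp_eval integrable_abs_gaussianReal
  have h1 := φ.convexOn.map_integral_le (μ := stdGaussianPow k)
    (f := fun x : Fin k → ℝ => fun i => |x i|) (continuous_seminorm φ).continuousOn isClosed_univ
    (by simp) (Integrable.of_eval hint) (by simpa [Function.comp_def, habs] using integrable_seminorm φ)
  simp only [habs] at h1
  have h2 : φ ((1 / 2 : ℝ) • (1 : Fin k → ℝ)) ≤
      φ (∫ x, (fun i => |x i|) ∂(stdGaussianPow k)) := by
    refine hφ.mono fun i => ?_
    rw [eval_integral hint]
    have h3 : ∫ x : Fin k → ℝ, |x i| ∂(stdGaussianPow k) = ∫ x, |x| ∂(gaussianReal 0 1) :=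
      integral_comp_eval (X := fun _ : Fin k => ℝ) (μ := fun _ => gaussianReal 0 1) (i := i)
        (f := fun x : ℝ => |x|) (by fun_prop)
    rw [h3]
    have := half_le_integral_abs_gaussianReal
    simpa [abs_of_pos] using this
  rw [map_smul_eq_mul, Real.norm_eq_abs, abs_of_pos (by norm_num)] at h2
  linarith

/-- Let `s` be the 1-norm of `x`. On `A` one has `s ≤ exp s ≤ exp (2 s - k R)`, and the integral of
`exp (2 s)` factors over the coordinates. -/
theorem Unconditional.setIntegral_le {k : ℕ} {φ : Seminorm ℝ (Fin k → ℝ)} (hφ : Unconditional φ)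
    {A : Set (Fin k → ℝ)} (hA : MeasurableSet A) {R : ℝ} (hR : ∀ x ∈ A, k * R ≤ ∑ i, |x i|) :
    ∫ x in A, φ x ∂(stdGaussianPow k) ≤ (Real.exp (-R) * (2 * Real.exp 2)) ^ k * φ 1 := by
  have h0 : 0 ≤ φ 1 := apply_nonneg _ _
  have hprod (x : Fin k → ℝ) : Real.exp (2 * ∑ i, |x i|) = ∏ i, Real.exp (2 * |x i|) := by
    rw [Finset.mul_sum, Real.exp_sum]
  have hint : Integrable (fun x : Fin k → ℝ => Real.exp (-(k * R)) * (∏ i, Real.exp (2 * |x i|)) * φ 1)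
      (stdGaussianPow k) :=
    ((Integrable.fintype_prod fun _ => integrable_exp_abs_gaussianReal).const_mul _).mul_const _
  calc ∫ x in A, φ x ∂(stdGaussianPow k)
      ≤ ∫ x in A, Real.exp (-(k * R)) * (∏ i, Real.exp (2 * |x i|)) * φ 1 ∂(stdGaussianPow k) := by
        refine setIntegral_mono_on (integrable_seminorm φ).integrableOn hint.integrableOn hA
          fun x hx => (hφ.le_one_norm x).trans ?_
        refine mul_le_mul_of_nonneg_right ?_ h0
        rw [← hprod, ← Real.exp_add]
        have h1 := hR x hx
        have h2 := Real.add_one_le_exp (∑ i, |x i|)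
        have h3 : Real.exp (∑ i, |x i|) ≤ Real.exp (-(k * R) + 2 * ∑ i, |x i|) :=
          Real.exp_le_exp.2 (by linarith)
        linarith
    _ ≤ ∫ x, Real.exp (-(k * R)) * (∏ i, Real.exp (2 * |x i|)) * φ 1 ∂(stdGaussianPow k) :=
        setIntegral_le_integral hint (Filter.Eventually.of_forall fun x => by positivity)
    _ = Real.exp (-(k * R)) * (∫ x, Real.exp (2 * |x|) ∂(gaussianReal 0 1)) ^ k * φ 1 := by
        rw [integral_mul_const, integral_const_mul, stdGaussianPow,
          integral_fintype_prod_eq_pow (fun x : ℝ => Real.exp (2 * |x|)), Fintype.card_fin]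
    _ ≤ Real.exp (-(k * R)) * (2 * Real.exp 2) ^ k * φ 1 :=
        mul_le_mul_of_nonneg_right (mul_le_mul_of_nonneg_left (pow_le_pow_left₀
          (integral_nonneg fun x => (Real.exp_pos _).le) integral_exp_abs_gaussianReal_le _)
          (Real.exp_pos _).le) h0
    _ = _ := by
        rw [mul_pow (Real.exp (-R)), ← Real.exp_nat_mul, mul_neg]

end GaussianNet

namespace GaussianNet

/-! ### Rounding -/

/-- The index of the cell of a real number. -/
noncomputable def cellIndex (N : ℕ) (x : ℝ) : ℕ :=
  2 * ⌊|x| * 2 ^ gridBits N / 2⌋₊ + if x < 0 then 1 else 0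

theorem measurable_cellIndex (N : ℕ) : Measurable (cellIndex N) := by
  have h1 : Measurable fun x : ℝ => ⌊|x| * 2 ^ gridBits N / 2⌋₊ :=
    Nat.measurable_floor.comp (by fun_prop)
  have h2 : Measurable fun x : ℝ => if x < 0 then (1 : ℕ) else 0 :=
    Measurable.ite measurableSet_Iio measurable_const measurable_const
  exact (h1.const_mul 2).add h2

theorem cellIndex_div_two (N : ℕ) (x : ℝ) :
    cellIndex N x / 2 = ⌊|x| * 2 ^ gridBits N / 2⌋₊ := by
  unfold cellIndex
  split_ifs <;> omega

theorem abs_sub_coord_cellIndex_le (N : ℕ) (x : ℝ) :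
    |x - (coord (gridBits N) (cellIndex N x) : ℚ)| ≤ 1 / 2 ^ gridBits N := by
  have h2 : (0 : ℝ) < 2 ^ gridBits N := by positivity
  set a := ⌊|x| * 2 ^ gridBits N / 2⌋₊ with ha
  have h3 : (a : ℝ) ≤ |x| * 2 ^ gridBits N / 2 := Nat.floor_le (by positivity)
  have h4 : |x| * 2 ^ gridBits N / 2 < a + 1 := Nat.lt_floor_add_one _
  have h5 : |(|x| - (2 * a + 1) / 2 ^ gridBits N)| ≤ 1 / 2 ^ gridBits N := by
    have e : |x| - (2 * a + 1) / 2 ^ gridBits N =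
        (|x| * 2 ^ gridBits N - (2 * a + 1)) / 2 ^ gridBits N := by field_simp
    rw [e, abs_div, abs_of_pos h2]
    gcongr
    rw [abs_le]
    constructor <;> linarith
  rw [coord, cellIndex_div_two, ← ha]
  rcases lt_or_ge x 0 with h | h
  · have h6 : cellIndex N x % 2 = 1 := by simp [cellIndex, h]
    rw [if_pos h6]
    rw [abs_of_neg h, ← abs_neg] at h5
    push_cast
    convert h5 using 2
    ring
  · have h6 : cellIndex N x % 2 ≠ 1 := by simp [cellIndex, not_lt.2 h]
    rw [if_neg h6]
    rw [abs_of_nonneg h] at h5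
    push_cast
    convert h5 using 2
    ring

/-- Since `|x| < 2 ^ ⌊|x|⌋₊ * 2`, the cell number has at most `⌊|x|⌋₊` bits more than the grid
resolution. The linear bound in `|x|` lets the code budget be compared with the 1-norm. -/
theorem size_cellIndex_le (N : ℕ) (x : ℝ) :
    (Nat.size (cellIndex N x / 2) : ℝ) ≤ gridBits N + |x| := by
  have h1 : Nat.size (cellIndex N x / 2) ≤ gridBits N + ⌊|x|⌋₊ := by
    rw [Nat.size_le, cellIndex_div_two, Nat.floor_lt (by positivity)]
    have h2 : |x| < ⌊|x|⌋₊ + 1 := Nat.lt_floor_add_one _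
    have h3 : ((⌊|x|⌋₊ + 1 : ℕ) : ℝ) ≤ (2 ^ ⌊|x|⌋₊ : ℕ) := by
      exact_mod_cast Nat.lt_two_pow_self
    push_cast at h3 ⊢
    rw [pow_add]
    have h4 : (0 : ℝ) < 2 ^ gridBits N := by positivity
    have h5 : |x| * 2 ^ gridBits N ≤ 2 ^ gridBits N * 2 ^ ⌊|x|⌋₊ := by
      rw [mul_comm]
      gcongr
      linarith
    have h6 : (0 : ℝ) < 2 ^ gridBits N * 2 ^ ⌊|x|⌋₊ := by positivity
    linarith
  calc (Nat.size (cellIndex N x / 2) : ℝ) ≤ (gridBits N + ⌊|x|⌋₊ : ℕ) := by exact_mod_cast h1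
    _ = gridBits N + (⌊|x|⌋₊ : ℝ) := by push_cast; ring
    _ ≤ _ := by
      gcongr
      exact Nat.floor_le (abs_nonneg x)

/-- The Gaussian probability of a cell. -/
noncomputable def cellProb (N u : ℕ) : ℝ := (gaussianReal 0 1).real {x | cellIndex N x = u}

theorem cellProb_eq (N u : ℕ) :
    cellProb N u = ∫ x in ((u / 2 : ℕ) * (2 / 2 ^ gridBits N : ℝ))..
      (((u / 2 : ℕ) + 1) * (2 / 2 ^ gridBits N)), gaussianPDFReal 0 1 x := by
  have h2 : (0 : ℝ) < 2 / 2 ^ gridBits N := by positivity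
  set δ : ℝ := 2 / 2 ^ gridBits N with hδ
  have hdiv (y : ℝ) : |y| * 2 ^ gridBits N / 2 = |y| / δ := by rw [hδ]; field_simp
  have hac : gaussianReal 0 1 ≪ volume := gaussianReal_absolutelyContinuous 0 one_ne_zero
  have hpos : ∀ v : ℕ, v % 2 = 0 → (gaussianReal 0 1).real {x | cellIndex N x = v} =
      ∫ x in ((v / 2 : ℕ) * δ)..(((v / 2 : ℕ) + 1) * δ), gaussianPDFReal 0 1 x := by
    intro v hv
    have hset : {x | cellIndex N x = v} = Set.Ico ((v / 2 : ℕ) * δ) (((v / 2 : ℕ) + 1) * δ) := by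
      ext x
      simp only [Set.mem_ofPred_eq, Set.mem_Ico]
      rcases lt_or_ge x 0 with h | h
      · refine iff_of_false ?_ ?_
        · simp only [cellIndex, h, if_true]
          omega
        · rintro ⟨h', _⟩
          have : 0 ≤ ((v / 2 : ℕ) : ℝ) * δ := by positivity
          linarith
      · have e : cellIndex N x = v ↔ ⌊|x| * 2 ^ gridBits N / 2⌋₊ = v / 2 := by
          simp only [cellIndex, not_lt.2 h, if_false]
          omega
        rw [e, Nat.floor_eq_iff (by positivity), hdiv, le_div_iff₀ h2, div_lt_iff₀ h2,
          abs_of_nonneg h]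
    rw [hset, measureReal_def, gaussianReal_apply_eq_integral _ one_ne_zero,
      ENNReal.toReal_ofReal (setIntegral_nonneg measurableSet_Ico
        fun x _ => gaussianPDFReal_nonneg _ _ _),
      intervalIntegral.integral_of_le (by nlinarith), integral_Ico_eq_integral_Ioc]
  rcases Nat.mod_two_eq_zero_or_one u with hu | hu
  · exact hpos u hu
  · have h3 := hpos (u - 1) (by omega)
    rw [show (u - 1) / 2 = u / 2 by omega] at h3
    rw [← h3, cellProb]
    have hms : MeasurableSet {x | cellIndex N x = u} :=
      measurable_cellIndex N (measurableSet_singleton u)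
    have hmap : (gaussianReal 0 1).map (fun x => -x) = gaussianReal 0 1 := by
      rw [gaussianReal_map_neg, neg_zero]
    have h4 : (gaussianReal 0 1).real {x | cellIndex N x = u} =
        (gaussianReal 0 1).real {x | cellIndex N (-x) = u} := by
      conv_lhs => rw [← hmap]
      exact map_measureReal_apply measurable_neg hms
    rw [h4]
    -- Reflection exchanges the two cells except at `0`, which counts as positive; a single point
    -- has measure zero.
    refine measureReal_congr (hac.ae_le ?_)
    have h0 : ∀ᵐ x : ℝ, x ≠ 0 := by simp [ae_iff]
    filter_upwards [h0] with x hx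
    refine propext ?_
    change cellIndex N (-x) = u ↔ cellIndex N x = u - 1
    simp only [cellIndex, abs_neg, Left.neg_neg_iff]
    rcases lt_or_gt_of_ne hx with h | h
    · simp only [h, not_lt.2 h.le, if_true, if_false]
      omega
    · simp only [h, not_lt.2 h.le, if_true, if_false]
      omega

/-- The error per coordinate has a factor `1/k` so that the product of `k` weights is still
accurate. With `T = 2 ^ (Nat.size k + Nat.size N)` one has `m = 2 T^20`, and blocks up to the cap
end before `J = 2 T^12`; then `J^3/m^2` is of order `T^(-4)`. -/
theorem weight_bounds {k N u : ℕ} (hk : 1 ≤ k) (hN : 2 ≤ N)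
    (hu : Nat.size (u / 2) ≤ capBits k N) :
    ((weight k N (coord (gridBits N) u) : ℚ) : ℝ) ≤
        Real.exp (1 / (4 * (k * N))) * cellProb N u ∧
      Real.exp (-(1 / (4 * (k * N)))) * cellProb N u ≤
        (weight k N (coord (gridBits N) u) : ℚ) := by
  set T : ℝ := 2 ^ Nat.size k * 2 ^ Nat.size N with hT
  have hkT : (k : ℝ) ≤ 2 ^ Nat.size k := by exact_mod_cast (Nat.lt_size_self k).le
  have hNT : (N : ℝ) ≤ 2 ^ Nat.size N := by exact_mod_cast (Nat.lt_size_self N).le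
  have hk1 : (1 : ℝ) ≤ k := by exact_mod_cast hk
  have hN2 : (2 : ℝ) ≤ N := by exact_mod_cast hN
  have hT8 : 8 ≤ T := by
    have h1 : 1 ≤ Nat.size k := Nat.lt_size.2 hk
    have h2 : 2 ≤ Nat.size N := Nat.lt_size.2 hN
    have h3 : (2 : ℝ) ^ 1 ≤ 2 ^ Nat.size k := pow_le_pow_right₀ (by norm_num) h1
    have h4 : (2 : ℝ) ^ 2 ≤ 2 ^ Nat.size N := pow_le_pow_right₀ (by norm_num) h2
    nlinarith
  have hkN : (k : ℝ) * N ≤ T := mul_le_mul hkT hNT (by positivity) (by positivity)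
  set J := 2 * 2 ^ capBits k N * cellWidth k N with hJ
  have hm : (pascalRows k N : ℝ) = 2 * T ^ 20 := by
    rw [pascalRows, hT]
    push_cast
    ring
  have hJT : (J : ℝ) = 2 * T ^ 12 := by
    rw [hJ, capBits, cellWidth, hT]
    push_cast
    ring
  have hJm : 2 * J ≤ pascalRows k N := by
    have : (2 * J : ℝ) ≤ pascalRows k N := by
      rw [hm, hJT]
      have h1 : (1 : ℝ) ≤ T := by linarith
      have h2 : T ^ 12 * T ≤ T ^ 20 := by
        rw [← pow_succ]
        exact pow_le_pow_right₀ h1 (by norm_num)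
      have h3 : 0 < T ^ 12 := by positivity
      nlinarith
    exact_mod_cast this
  have ha : 2 * (u / 2 + 1) * cellWidth k N ≤ J := by
    rw [hJ]
    have := Nat.size_le.1 hu
    gcongr
    omega
  obtain ⟨h1, h2⟩ := cellSum_bounds hJm ha
  -- `√(2/m) = T^(-10)`, and `cellWidth` cancels the dependence on `k`: `2 p` binomial steps make
  -- exactly one grid cell.
  have hδ : 2 * (cellWidth k N : ℝ) * √(2 / pascalRows k N) = 2 / 2 ^ gridBits N := by
    have e1 : (2 : ℝ) / pascalRows k N = (1 / T ^ 10) ^ 2 := by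
      rw [hm]
      field_simp
    rw [e1, Real.sqrt_sq (by positivity), cellWidth, gridBits, hT]
    push_cast
    field_simp
    ring
  have hw : ((weight k N (coord (gridBits N) u) : ℚ) : ℝ) =
      (Weigh.cellSum (pascalRows k N) (cellWidth k N) (u / 2) : ℝ) / 2 ^ (2 * pascalRows k N) := by
    rw [weight, Weigh.cellWeight_coord]
    push_cast
    rfl
  rw [hδ, ← cellProb_eq] at h1 h2
  have hη : 2 * (J : ℝ) ^ 3 / pascalRows k N ^ 2 + 3 * J / pascalRows k N + 1 / pascalRows k N ≤
      1 / (4 * (k * N)) := by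
    rw [hm, hJT]
    have e1 : 2 * (2 * T ^ 12) ^ 3 / (2 * T ^ 20) ^ 2 = 4 / T ^ 4 := by field_simp; ring
    have e2 : 3 * (2 * T ^ 12) / (2 * T ^ 20) = 3 / T ^ 8 := by field_simp
    have hpow (n : ℕ) (hn : 4 ≤ n) : T ^ 4 ≤ T ^ n := pow_le_pow_right₀ (by linarith) hn
    have e3 : 3 / T ^ 8 ≤ 3 / T ^ 4 := div_le_div_of_nonneg_left (by norm_num) (by positivity)
      (hpow 8 (by norm_num))
    have e4 : 1 / (2 * T ^ 20) ≤ 1 / T ^ 4 := div_le_div_of_nonneg_left (by norm_num)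
      (by positivity) (by linarith [hpow 20 (by norm_num), show 0 < T ^ 20 by positivity])
    have e5 : 8 / T ^ 4 ≤ 1 / (4 * T) := by
      rw [div_le_div_iff₀ (by positivity) (by positivity)]
      have : (8 : ℝ) ^ 3 ≤ T ^ 3 := pow_le_pow_left₀ (by norm_num) hT8 3
      have : T ^ 4 = T ^ 3 * T := by ring
      nlinarith
    have e6 : 1 / (4 * T) ≤ 1 / (4 * (k * N)) :=
      div_le_div_of_nonneg_left (by norm_num) (by positivity) (by linarith)
    rw [e1, e2]
    have e7 : 8 / T ^ 4 = 4 / T ^ 4 + 3 / T ^ 4 + 1 / T ^ 4 := by ring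
    linarith
  have hq : 0 ≤ cellProb N u := measureReal_nonneg
  rw [hw]
  exact ⟨h1.trans (mul_le_mul_of_nonneg_right (Real.exp_le_exp.2 hη) hq),
    (mul_le_mul_of_nonneg_right (Real.exp_le_exp.2 (neg_le_neg hη)) hq).trans h2⟩

/-- If the cap is violated, a single coordinate has absolute value at least `2 * 2^(2 size k) * 2^(2
size N)`, which exceeds the whole bound. If the budget is violated, the cost of each coordinate is
at most `|x i| + 12 size N + 5`, so the 1-norm exceeds `k (20 size N - 5)`, and `size N ≥ 2`
suffices. -/
theorem le_one_norm_of_notMem_Index {k N : ℕ} (hk : 1 ≤ k) (hN : 2 ≤ N) (x : Fin k → ℝ)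
    (hx : (fun i => cellIndex N (x i)) ∉ Index k N) :
    k * (16 * Nat.size N : ℝ) ≤ ∑ i, |x i| := by
  have hs2 : 2 ≤ Nat.size N := Nat.lt_size.2 hN
  have hs2' : (2 : ℝ) ≤ Nat.size N := by exact_mod_cast hs2
  have hk1 : (1 : ℝ) ≤ k := by exact_mod_cast hk
  rw [mem_Index, not_and_or, not_forall] at hx
  rcases hx with ⟨i, hi⟩ | hx
  · have h1 : 2 ^ capBits k N ≤ cellIndex N (x i) / 2 := by
      by_contra h
      exact hi (Nat.size_le.2 (not_le.1 h))
    rw [cellIndex_div_two, Nat.le_floor_iff (by positivity)] at h1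
    push_cast at h1
    have h2 : (2 : ℝ) * (2 ^ Nat.size k) ^ 2 * (2 ^ Nat.size N) ^ 2 ≤ |x i| := by
      have e : (2 : ℝ) ^ capBits k N =
          (2 ^ Nat.size k) ^ 2 * (2 ^ Nat.size N) ^ 2 * 2 ^ gridBits N := by
        rw [capBits, gridBits]
        ring
      rw [e] at h1
      have h3 : (0 : ℝ) < 2 ^ gridBits N := by positivity
      refine le_of_mul_le_mul_right ?_ h3
      linarith
    have h3 : (k : ℝ) ≤ 2 ^ Nat.size k := by exact_mod_cast (Nat.lt_size_self k).le
    have h4 : (2 : ℝ) ≤ 2 ^ Nat.size k := by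
      have : (2 : ℝ) ^ 1 ≤ 2 ^ Nat.size k := pow_le_pow_right₀ (by norm_num) (Nat.lt_size.2 hk)
      linarith
    have h5 : (4 : ℝ) * Nat.size N ≤ (2 ^ Nat.size N) ^ 2 := by
      have h6 (s : ℕ) (hs : 2 ≤ s) : 4 * s ≤ (2 ^ s) ^ 2 := by
        induction s, hs using Nat.le_induction with
        | base => norm_num
        | succ s hs ih =>
          rw [pow_succ 2 s, mul_pow]
          omega
      exact_mod_cast h6 _ hs2
    have h7 : 2 * (k : ℝ) ≤ (2 ^ Nat.size k) ^ 2 := by nlinarith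
    calc (k : ℝ) * (16 * Nat.size N) = 2 * (2 * k) * (4 * Nat.size N) := by ring
      _ ≤ 2 * (2 ^ Nat.size k) ^ 2 * (2 ^ Nat.size N) ^ 2 := by gcongr
      _ ≤ |x i| := h2
      _ ≤ _ := Finset.single_le_sum (f := fun i => |x i|) (fun _ _ => abs_nonneg _)
        (Finset.mem_univ i)
  · have h1 : (codeBound k N : ℝ) < ∑ i, (cost (gridBits N) (cellIndex N (x i)) : ℝ) := by
      exact_mod_cast not_le.1 hx
    have h2 : ∑ i, (cost (gridBits N) (cellIndex N (x i)) : ℝ) ≤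
        ∑ i, (|x i| + (2 * gridBits N + 5)) := by
      refine Finset.sum_le_sum fun i _ => ?_
      have := size_cellIndex_le N (x i)
      rw [cost]
      push_cast
      linarith
    rw [Finset.sum_add_distrib, Finset.sum_const, Finset.card_univ, Fintype.card_fin,
      nsmul_eq_mul] at h2
    rw [codeBound] at h1
    have h3 : (gridBits N : ℝ) = 6 * Nat.size N := by rw [gridBits]; push_cast; ring
    rw [h3] at h2
    push_cast at h1
    nlinarith [mul_le_mul hk1 hs2' (by norm_num) (by linarith)]

end GaussianNet

/-! ### Comparison of the weighted sum with the Gaussian expectation. -/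

namespace GaussianNet

/-- A point of the net, with real coordinates. -/
noncomputable def realPoint {k : ℕ} (N : ℕ) (f : Fin k → ℕ) : Fin k → ℝ := fun i => (point N f i : ℝ)

/-- The estimate given by the net when cells are weighted by their Gaussian probabilities. -/
noncomputable def cellSumOf (k N : ℕ) (φ : Seminorm ℝ (Fin k → ℝ)) : ℝ :=
  ∑ f ∈ Index k N, (∏ i, cellProb N (f i)) * φ (realPoint N f)

/-- The estimate given by the net. -/
noncomputable def netSum (k N : ℕ) (φ : Seminorm ℝ (Fin k → ℝ)) : ℝ :=
  ∑ f ∈ Index k N, ((∏ i, weight k N (point N f i) : ℚ) : ℝ) * φ (realPoint N f)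

theorem cellProb_nonneg (N u : ℕ) : 0 ≤ cellProb N u := measureReal_nonneg

theorem netSum_bounds {k N : ℕ} (hk : 1 ≤ k) (hN : 2 ≤ N) (φ : Seminorm ℝ (Fin k → ℝ)) :
    netSum k N φ ≤ Real.exp (1 / (4 * N)) * cellSumOf k N φ ∧
      Real.exp (-(1 / (4 * N))) * cellSumOf k N φ ≤ netSum k N φ := by
  have hk0 : (0 : ℝ) < k := by exact_mod_cast hk
  have hN0 : (0 : ℝ) < N := by positivity
  have e1 : Real.exp (1 / (4 * N)) = Real.exp (1 / (4 * (k * N))) ^ k := by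
    rw [← Real.exp_nat_mul]
    congr 1
    field_simp
  have e2 : Real.exp (-(1 / (4 * N))) = Real.exp (-(1 / (4 * (k * N)))) ^ k := by
    rw [← Real.exp_nat_mul]
    congr 1
    field_simp
  have hprod (c : ℝ) (f : Fin k → ℕ) : c ^ k * ∏ i, cellProb N (f i) =
      ∏ i, (c * cellProb N (f i)) := by
    rw [Finset.prod_mul_distrib, Finset.prod_const, Finset.card_univ, Fintype.card_fin]
  rw [netSum, cellSumOf, Finset.mul_sum, Finset.mul_sum, e1, e2]
  constructor
  · refine Finset.sum_le_sum fun f hf => ?_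
    rw [← mul_assoc, hprod]
    refine mul_le_mul_of_nonneg_right ?_ (apply_nonneg _ _)
    push_cast
    refine Finset.prod_le_prod (fun i _ => ?_) fun i _ => ?_
    · exact_mod_cast Weigh.cellWeight_nonneg _ _ _
    · exact (weight_bounds hk hN ((mem_Index.1 hf).1 i)).1
  · refine Finset.sum_le_sum fun f hf => ?_
    rw [← mul_assoc, hprod]
    refine mul_le_mul_of_nonneg_right ?_ (apply_nonneg _ _)
    push_cast
    refine Finset.prod_le_prod (fun i _ => ?_) fun i _ => ?_
    · exact mul_nonneg (Real.exp_pos _).le (cellProb_nonneg _ _)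
    · exact (weight_bounds hk hN ((mem_Index.1 hf).1 i)).2

/-- The cell sum is the integral of the step function `E` that takes the value of `φ` at the centre
of each cell of the net and vanishes elsewhere. On those cells monotonicity bounds `|φ - E|` by `2 ^
(-gridBits N) * φ 1`; elsewhere the error is `φ`, which the tail bound controls. -/
theorem abs_integral_sub_cellSumOf_le {k N : ℕ} (hk : 1 ≤ k) (hN : 2 ≤ N)
    {φ : Seminorm ℝ (Fin k → ℝ)} (hφ : Unconditional φ) :
    |∫ x, φ x ∂(stdGaussianPow k) - cellSumOf k N φ| ≤ (1 / 2 ^ gridBits N +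
      (Real.exp (-(16 * Nat.size N)) * (2 * Real.exp 2)) ^ k) * φ 1 := by
  set A : (Fin k → ℕ) → Set (Fin k → ℝ) := fun f =>
    Set.pi Set.univ fun i => {y | cellIndex N y = f i} with hA
  have hmeas (f : Fin k → ℕ) : MeasurableSet (A f) :=
    MeasurableSet.univ_pi fun i => measurable_cellIndex N (measurableSet_singleton _)
  have hmem (f : Fin k → ℕ) (x : Fin k → ℝ) : x ∈ A f ↔ (fun i => cellIndex N (x i)) = f := by
    simp [hA, Set.mem_pi, funext_iff]
  have hreal (f : Fin k → ℕ) : (stdGaussianPow k).real (A f) = ∏ i, cellProb N (f i) := by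
    rw [hA, stdGaussianPow, measureReal_def, Measure.pi_pi, ENNReal.toReal_prod]
    rfl
  set E : (Fin k → ℝ) → ℝ := fun x =>
    ∑ f ∈ Index k N, (A f).indicator (fun _ => φ (realPoint N f)) x with hE
  have hEint : Integrable E (stdGaussianPow k) :=
    integrable_finsetSum _ fun f _ => (integrable_const _).indicator (hmeas f)
  have hEsum : ∫ x, E x ∂(stdGaussianPow k) = cellSumOf k N φ := by
    rw [hE, integral_finsetSum _ fun f _ => (integrable_const _).indicator (hmeas f), cellSumOf]
    refine Finset.sum_congr rfl fun f _ => ?_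
    rw [integral_indicator_const _ (hmeas f), hreal, smul_eq_mul]
  set B : Set (Fin k → ℝ) := {x | (fun i => cellIndex N (x i)) ∉ Index k N} with hB
  have hBmeas : MeasurableSet B := by
    have h1 : Measurable fun x : Fin k → ℝ => fun i => cellIndex N (x i) :=
      measurable_pi_lambda _ fun i => (measurable_cellIndex N).comp (measurable_pi_apply i)
    exact h1 ((Index k N : Set (Fin k → ℕ)).to_countable.measurableSet.compl)
  have hpt (x : Fin k → ℝ) : |φ x - E x| ≤ 1 / 2 ^ gridBits N * φ 1 + B.indicator (fun x => φ x) x := by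
    by_cases hx : (fun i => cellIndex N (x i)) ∈ Index k N
    · have h1 : E x = φ (realPoint N fun i => cellIndex N (x i)) := by
        rw [hE]
        simp only
        rw [Finset.sum_eq_single_of_mem _ hx fun f _ hf => ?_]
        · exact Set.indicator_of_mem ((hmem _ x).2 rfl) _
        · exact Set.indicator_of_notMem (fun h => hf ((hmem f x).1 h).symm) _
      have h2 : x ∉ B := fun h => h hx
      rw [h1, Set.indicator_of_notMem h2, add_zero]
      refine (abs_sub_map_le_sub φ _ _).trans ?_
      have h3 : 1 / 2 ^ gridBits N * φ 1 = φ ((1 / 2 ^ gridBits N : ℝ) • (1 : Fin k → ℝ)) := by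
        rw [map_smul_eq_mul, Real.norm_eq_abs, abs_of_pos (by positivity)]
      rw [h3]
      refine hφ.mono fun i => ?_
      simpa [realPoint, point] using abs_sub_coord_cellIndex_le N (x i)
    · have h1 : E x = 0 := Finset.sum_eq_zero fun f hf =>
        Set.indicator_of_notMem (fun h => hx (by rw [(hmem f x).1 h]; exact hf)) _
      rw [h1, sub_zero, Set.indicator_of_mem (show x ∈ B from hx), abs_of_nonneg (apply_nonneg _ _)]
      have : 0 ≤ 1 / 2 ^ gridBits N * φ 1 := mul_nonneg (by positivity) (apply_nonneg _ _)
      linarith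
  rw [← hEsum, ← integral_sub (integrable_seminorm φ) hEint]
  refine (abs_integral_le_integral_abs).trans ?_
  have hBint := (integrable_seminorm φ).indicator hBmeas
  refine (integral_mono ((integrable_seminorm φ).sub hEint).abs
    ((integrable_const (1 / 2 ^ gridBits N * φ 1)).add hBint) hpt).trans ?_
  simp only [Pi.add_apply]
  rw [integral_add (integrable_const _) hBint, integral_const, integral_indicator hBmeas, add_mul]
  have h4 := hφ.setIntegral_le hBmeas (R := 16 * Nat.size N)
    fun x hx => le_one_norm_of_notMem_Index hk hN x hx
  simpa using h4

/-- With `ν = 2 ^ Nat.size N ≥ max 4 N`, the grid error equals `ν^(-6)` and the tail is at most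
that, even for `k = 1`. The factor 2 in front comes from `φ 1 ≤ 2 E φ`. -/
theorem error_le {k N : ℕ} (hk : 1 ≤ k) (hN : 2 ≤ N) :
    2 * (1 / 2 ^ gridBits N + (Real.exp (-(16 * Nat.size N)) * (2 * Real.exp 2)) ^ k) ≤
      1 / (8 * (N : ℝ)) := by
  have hs2 : 2 ≤ Nat.size N := Nat.lt_size.2 hN
  have hs2' : (2 : ℝ) ≤ Nat.size N := by exact_mod_cast hs2
  have hN2 : (2 : ℝ) ≤ N := by exact_mod_cast hN
  set ν : ℝ := 2 ^ Nat.size N with hν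
  have hNν : (N : ℝ) ≤ ν := by rw [hν]; exact_mod_cast (Nat.lt_size_self N).le
  have hν4 : 4 ≤ ν := by
    have : (2 : ℝ) ^ 2 ≤ 2 ^ Nat.size N := pow_le_pow_right₀ (by norm_num) hs2
    linarith
  have hg : (2 : ℝ) ^ gridBits N = ν ^ 6 := by
    rw [gridBits, hν, ← pow_mul, mul_comm]
  have he : Real.exp (-(16 * Nat.size N)) * (2 * Real.exp 2) ≤ 1 / ν ^ 6 := by
    have h2 : (2 : ℝ) ≤ Real.exp 1 := by linarith [Real.add_one_le_exp (1 : ℝ)]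
    have h3 : ν ≤ Real.exp (Nat.size N) := by
      rw [hν, ← mul_one (Nat.size N : ℝ), Real.exp_nat_mul]
      gcongr
    calc Real.exp (-(16 * Nat.size N)) * (2 * Real.exp 2)
        ≤ Real.exp (-(16 * Nat.size N)) * (Real.exp 1 * Real.exp 2) := by gcongr
      _ = Real.exp (-(16 * Nat.size N) + (1 + 2)) := by rw [Real.exp_add, Real.exp_add 1 2]
      _ ≤ Real.exp (-(6 * Nat.size N)) := Real.exp_le_exp.2 (by linarith)
      _ = 1 / Real.exp (Nat.size N) ^ 6 := by
        rw [Real.exp_neg, ← Real.exp_nat_mul, one_div]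
        norm_num
      _ ≤ 1 / ν ^ 6 := by gcongr
  have he1 : 1 / ν ^ 6 ≤ 1 := by
    rw [div_le_one (by positivity)]
    exact one_le_pow₀ (by linarith)
  have hek : (Real.exp (-(16 * Nat.size N)) * (2 * Real.exp 2)) ^ k ≤ 1 / ν ^ 6 := by
    refine le_trans (pow_le_of_le_one (by positivity) (he.trans he1) (by omega)) he
  have h6 : 4 * (1 / ν ^ 6) ≤ 1 / (8 * (N : ℝ)) := by
    rw [mul_one_div, div_le_div_iff₀ (by positivity) (by positivity)]
    have h5 : (4 : ℝ) ^ 5 ≤ ν ^ 5 := pow_le_pow_left₀ (by norm_num) hν4 5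
    have : ν ^ 6 = ν ^ 5 * ν := by ring
    nlinarith
  rw [hg]
  linarith

theorem netSum_approx_of_unconditional {k N : ℕ} (hk : 1 ≤ k) (hN : 2 ≤ N)
    {φ : Seminorm ℝ (Fin k → ℝ)} (hφ : Unconditional φ) :
    (1 - 1 / N) * netSum k N φ ≤ ∫ x, φ x ∂(stdGaussianPow k) ∧
      ∫ x, φ x ∂(stdGaussianPow k) ≤ (1 + 1 / N) * netSum k N φ := by
  have hN2 : (2 : ℝ) ≤ N := by exact_mod_cast hN
  set I := ∫ x, φ x ∂(stdGaussianPow k) with hI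
  have hI0 : 0 ≤ I := integral_nonneg fun x => apply_nonneg φ x
  have h1 := abs_integral_sub_cellSumOf_le hk hN hφ
  have h2 := hφ.apply_one_le
  have h3 := error_le hk hN
  obtain ⟨h4, h5⟩ := netSum_bounds hk hN φ
  rw [← hI] at h1 h2
  set G := cellSumOf k N φ
  set P := netSum k N φ
  -- The allowed error is `8 y = 1/N`, of which the weights use a factor `exp (2 y)` and rounding
  -- and truncation a relative error `y`. The rest pays for passing between `exp` and `1 ± 8 y`.
  set y : ℝ := 1 / (8 * N) with hy
  have hy0 : 0 < y := by positivity
  have hy1 : y ≤ 1 / 16 := by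
    rw [hy, div_le_div_iff₀ (by positivity) (by norm_num)]
    linarith
  have e1 : 1 / (4 * (N : ℝ)) = 2 * y := by rw [hy]; field_simp; norm_num
  have e2 : 1 / (N : ℝ) = 8 * y := by rw [hy]; field_simp
  have h6 : |I - G| ≤ y * I := by
    refine h1.trans ?_
    set τ := 1 / 2 ^ gridBits N + (Real.exp (-(16 * Nat.size N)) * (2 * Real.exp 2)) ^ k with hτ
    have hτ0 : 0 ≤ τ := by positivity
    calc τ * φ 1 ≤ τ * (2 * I) := by gcongr
      _ = 2 * τ * I := by ring
      _ ≤ y * I := by gcongr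
  obtain ⟨h7, h8⟩ := abs_le.1 h6
  rw [e1] at h4 h5
  rw [e2]
  have hexp (z : ℝ) : 1 + z ≤ Real.exp z := by rw [add_comm]; exact Real.add_one_le_exp z
  constructor
  · have h9 : P ≤ Real.exp (8 * y) * I := by
      calc P ≤ Real.exp (2 * y) * ((1 + y) * I) := h4.trans (by gcongr; linarith)
        _ ≤ Real.exp (2 * y) * (Real.exp y * I) := by gcongr; exact hexp y
        _ = Real.exp (3 * y) * I := by rw [← mul_assoc, ← Real.exp_add]; ring_nf
        _ ≤ _ := by gcongr; linarith
    calc (1 - 8 * y) * P ≤ (1 - 8 * y) * (Real.exp (8 * y) * I) :=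
          mul_le_mul_of_nonneg_left h9 (by linarith)
      _ ≤ Real.exp (-(8 * y)) * (Real.exp (8 * y) * I) := by
          gcongr
          have := hexp (-(8 * y))
          linarith
      _ = I := by rw [← mul_assoc, ← Real.exp_add]; simp
  · have h9 : I ≤ Real.exp (4 * y) * P := by
      calc I ≤ Real.exp (2 * y) * ((1 - y) * I) := by
            have h10 : 1 ≤ Real.exp (2 * y) * (1 - y) := by
              have := hexp (2 * y)
              nlinarith
            calc I = 1 * I := (one_mul I).symm
              _ ≤ Real.exp (2 * y) * (1 - y) * I := by gcongr
              _ = _ := by ring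
        _ ≤ Real.exp (2 * y) * G := by gcongr; linarith
        _ = Real.exp (4 * y) * (Real.exp (-(2 * y)) * G) := by
            rw [← mul_assoc, ← Real.exp_add]; ring_nf
        _ ≤ _ := by gcongr
    have hP0 : 0 ≤ P := Finset.sum_nonneg fun f _ => mul_nonneg
      (by exact_mod_cast Finset.prod_nonneg fun i _ => Weigh.cellWeight_nonneg _ _ _)
      (apply_nonneg _ _)
    refine h9.trans (mul_le_mul_of_nonneg_right ?_ hP0)
    have h11 := hexp (-(4 * y))
    have h12 : Real.exp (4 * y) * Real.exp (-(4 * y)) = 1 := by rw [← Real.exp_add]; simp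
    have h13 := Real.exp_pos (4 * y)
    nlinarith

/-- The index of the opposite coordinate. -/
def negIndex (u : ℕ) : ℕ := if u % 2 = 0 then u + 1 else u - 1

theorem negIndex_negIndex (u : ℕ) : negIndex (negIndex u) = u := by
  unfold negIndex
  split_ifs <;> omega

theorem negIndex_div_two (u : ℕ) : negIndex u / 2 = u / 2 := by
  unfold negIndex
  split_ifs <;> omega

theorem coord_negIndex (l u : ℕ) : coord l (negIndex u) = -coord l u := by
  rw [coord, coord, negIndex_div_two]
  have h : negIndex u % 2 = 1 ↔ ¬ u % 2 = 1 := by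
    unfold negIndex
    split_ifs <;> omega
  by_cases hu : u % 2 = 1
  · rw [if_pos hu, if_neg (by rw [h]; simpa using hu)]
    ring
  · rw [if_neg hu, if_pos (h.2 hu)]
    ring

/-- Opposite coordinates have indices with the same half, hence equal cost and equal weight. So a
sign change is an involution of the index set that preserves the weights. -/
theorem netSum_symmetrize (k N : ℕ) (φ : Seminorm ℝ (Fin k → ℝ)) :
    netSum k N (symmetrize φ) = Fintype.card (Fin k → ℤˣ) * netSum k N φ := by
  have h (s : Fin k → ℤˣ) :
      ∑ f ∈ Index k N, ((∏ i, weight k N (point N f i) : ℚ) : ℝ) * φ (flip s (realPoint N f)) =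
        netSum k N φ := by
    set g : (Fin k → ℕ) → Fin k → ℕ := fun f i => if s i = 1 then f i else negIndex (f i) with hg
    have hg2 (f : Fin k → ℕ) (i : Fin k) : g f i / 2 = f i / 2 := by
      simp only [hg]
      split_ifs
      · rfl
      · exact negIndex_div_two _
    have hgg (f : Fin k → ℕ) : g (g f) = f := by
      funext i
      simp only [hg]
      split_ifs
      · rfl
      · exact negIndex_negIndex _
    have hgI (f : Fin k → ℕ) (hf : f ∈ Index k N) : g f ∈ Index k N := by
      rw [mem_Index] at hf ⊢
      simpa only [hg2, cost] using hf
    refine Finset.sum_nbij' g g hgI hgI (fun f _ => hgg f) (fun f _ => hgg f) fun f _ => ?_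
    congr 2
    · refine Finset.prod_congr rfl fun i _ => ?_
      rw [weight, point, point, Weigh.cellWeight_coord, Weigh.cellWeight_coord, hg2]
    · funext i
      rw [flip_apply, realPoint, realPoint, point, point]
      simp only [hg]
      rcases Int.units_eq_one_or (s i) with h | h
      · simp [h]
      · rw [if_neg (by rw [h]; decide), coord_negIndex, h]
        simp
  have h2 : netSum k N (symmetrize φ) = ∑ s : Fin k → ℤˣ,
      ∑ f ∈ Index k N, ((∏ i, weight k N (point N f i) : ℚ) : ℝ) * φ (flip s (realPoint N f)) := by
    rw [Finset.sum_comm, netSum]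
    simp_rw [symmetrize_apply, Finset.mul_sum]
  rw [h2]
  simp_rw [h]
  simp

theorem netSum_approx {k N : ℕ} (hk : 1 ≤ k) (hN : 2 ≤ N) (φ : Seminorm ℝ (Fin k → ℝ)) :
    (1 - 1 / N) * netSum k N φ ≤ ∫ x, φ x ∂(stdGaussianPow k) ∧
      ∫ x, φ x ∂(stdGaussianPow k) ≤ (1 + 1 / N) * netSum k N φ := by
  obtain ⟨h1, h2⟩ := netSum_approx_of_unconditional hk hN (unconditional_symmetrize φ)
  rw [netSum_symmetrize, integral_symmetrize] at h1 h2
  have hc : (0 : ℝ) < Fintype.card (Fin k → ℤˣ) := by exact_mod_cast Fintype.card_pos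
  constructor
  · refine le_of_mul_le_mul_left ?_ hc
    linarith
  · refine le_of_mul_le_mul_left ?_ hc
    linarith

theorem sum_net_eq (k N : ℕ) (φ : Seminorm ℝ (Fin k → ℝ)) :
    ∑ x ∈ net k N, ((∏ i, weight k N (x i) : ℚ) : ℝ) * φ (fun i => (x i : ℝ)) = netSum k N φ := by
  rw [net, Finset.sum_image fun f _ g _ h => point_injective k N h]
  rfl

end GaussianNet

/-! ### Bounds in terms of the precision, and the conclusion. -/

namespace GaussianNet

theorem two_pow_size_le {n : ℕ} (hn : 1 ≤ n) : 2 ^ Nat.size n ≤ 2 * n := by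
  obtain ⟨s, hs⟩ : ∃ s, Nat.size n = s + 1 := ⟨Nat.size n - 1, by
    have := Nat.lt_size.2 (show 2 ^ 0 ≤ n from hn)
    omega⟩
  have : 2 ^ s ≤ n := Nat.lt_size.1 (by omega)
  rw [hs, pow_succ]
  omega

section Precision

variable {M : ℝ}

theorem two_pow_size_ceil_le (hM : 2 ≤ M) : (2 : ℝ) ^ Nat.size ⌈M⌉₊ ≤ M ^ 3 := by
  have h1 : (⌈M⌉₊ : ℝ) < M + 1 := Nat.ceil_lt_add_one (by linarith)
  have h2 : (2 : ℝ) ^ Nat.size ⌈M⌉₊ ≤ 2 * (⌈M⌉₊ : ℝ) := by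
    exact_mod_cast two_pow_size_le (Nat.one_le_ceil_iff.2 (by linarith))
  have h3 : 4 * M ≤ M ^ 3 := by
    have : 2 * 2 ≤ M * M := mul_le_mul hM hM (by norm_num) (by linarith)
    nlinarith
  linarith

theorem size_ceil_le_log (hM : 2 ≤ M) : (Nat.size ⌈M⌉₊ : ℝ) ≤ 5 * Real.log M := by
  have h1 := Real.log_le_log (by positivity) (two_pow_size_ceil_le hM)
  rw [Real.log_pow, Real.log_pow] at h1
  have h2 := Real.log_two_gt_d9
  have h3 : 0 ≤ Real.log M := Real.log_nonneg (by linarith)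
  have h4 : (0 : ℝ) ≤ Nat.size ⌈M⌉₊ := by positivity
  push_cast at h1
  nlinarith

theorem card_net_le_pow (k : ℕ) (hM : 2 ≤ M) :
    ((net k ⌈M⌉₊).card : ℝ) ≤ M ^ (20000 * k) := by
  calc ((net k ⌈M⌉₊).card : ℝ) ≤ 4 ^ codeBound k ⌈M⌉₊ := card_net_le _ _
    _ = (2 ^ Nat.size ⌈M⌉₊) ^ (64 * k) := by
      rw [codeBound, show (4 : ℝ) = 2 ^ 2 by norm_num, ← pow_mul, ← pow_mul]
      congr 1
      ring
    _ ≤ (M ^ 3) ^ (64 * k) := pow_le_pow_left₀ (by positivity) (two_pow_size_ceil_le hM) _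
    _ = M ^ (3 * (64 * k)) := (pow_mul _ _ _).symm
    _ ≤ _ := pow_le_pow_right₀ (by linarith) (by omega)

theorem two_pow_size_add_size_le {k : ℕ} (hk : 1 ≤ k) (hM : 2 ≤ M) :
    (2 : ℝ) ^ (Nat.size k + Nat.size ⌈M⌉₊) ≤ (k * M) ^ 4 := by
  have hk1 : (1 : ℝ) ≤ k := by exact_mod_cast hk
  have h1 : (⌈M⌉₊ : ℝ) < M + 1 := Nat.ceil_lt_add_one (by linarith)
  have h2 : (2 : ℝ) ^ Nat.size ⌈M⌉₊ ≤ 2 * (⌈M⌉₊ : ℝ) := by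
    exact_mod_cast two_pow_size_le (Nat.one_le_ceil_iff.2 (by linarith))
  have h3 : (2 : ℝ) ^ Nat.size k ≤ 2 * k := by exact_mod_cast two_pow_size_le hk
  have h4 : 2 ≤ k * M := by nlinarith
  have h5 : (2 : ℝ) ^ 3 ≤ (k * M) ^ 3 := pow_le_pow_left₀ (by norm_num) h4 3
  calc (2 : ℝ) ^ (Nat.size k + Nat.size ⌈M⌉₊) = 2 ^ Nat.size k * 2 ^ Nat.size ⌈M⌉₊ := pow_add _ _ _
    _ ≤ (2 * k) * (4 * M) := mul_le_mul h3 (by linarith) (by positivity) (by positivity)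
    _ = 2 ^ 3 * (k * M) := by ring
    _ ≤ (k * M) ^ 3 * (k * M) := by gcongr
    _ = _ := by ring

theorem weigh_time_le_pow {k : ℕ} (hk : 1 ≤ k) (hM : 2 ≤ M) {t : ℕ}
    (ht : t ≤ 1000 * (2 ^ (Nat.size k + Nat.size ⌈M⌉₊)) ^ 92) :
    (t : ℝ) ≤ (20000 : ℕ) * (k * M) ^ 20000 := by
  have hk1 : (1 : ℝ) ≤ k := by exact_mod_cast hk
  have h4 : 1 ≤ k * M := by nlinarith
  calc (t : ℝ) ≤ 1000 * (2 ^ (Nat.size k + Nat.size ⌈M⌉₊)) ^ 92 := by exact_mod_cast ht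
    _ ≤ 1000 * ((k * M) ^ 4) ^ 92 := by
      gcongr
      exact two_pow_size_add_size_le hk hM
    _ = 1000 * (k * M) ^ (4 * 92) := by rw [← pow_mul]
    _ ≤ (20000 : ℕ) * (k * M) ^ 20000 := by
      push_cast
      refine mul_le_mul (by norm_num) (pow_le_pow_right₀ h4 (by norm_num)) (by positivity)
        (by norm_num)

theorem enum_time_le_pow {k : ℕ} (hk : 1 ≤ k) (hM : 2 ≤ M) {t : ℕ}
    (ht : t ≤ 3000 * (k * Nat.size ⌈M⌉₊) + 1) : (t : ℝ) ≤ (20000 : ℕ) * (k * M) ^ 20000 := by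
  have hk1 : (1 : ℝ) ≤ k := by exact_mod_cast hk
  have h1 : (⌈M⌉₊ : ℝ) < M + 1 := Nat.ceil_lt_add_one (by linarith)
  have h2 : (Nat.size ⌈M⌉₊ : ℝ) ≤ ⌈M⌉₊ := by exact_mod_cast Enum.size_le_self _
  have h4 : 1 ≤ k * M := by nlinarith
  calc (t : ℝ) ≤ 3000 * (k * Nat.size ⌈M⌉₊) + 1 := by exact_mod_cast ht
    _ ≤ 3000 * (k * (2 * M)) + k * M := by
      gcongr
      linarith
    _ ≤ 20000 * (k * M) ^ 1 := by linarith
    _ ≤ (20000 : ℕ) * (k * M) ^ 20000 := by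
      push_cast
      gcongr
      norm_num

theorem enum_space_le {k : ℕ} (hM : 2 ≤ M) {s : ℕ} (hs : s ≤ 4000 * (k * Nat.size ⌈M⌉₊)) :
    (s : ℝ) ≤ (20000 : ℕ) * (k * Real.log M) := by
  calc (s : ℝ) ≤ 4000 * (k * Nat.size ⌈M⌉₊) := by exact_mod_cast hs
    _ ≤ 4000 * (k * (5 * Real.log M)) := by
      gcongr
      exact size_ceil_le_log hM
    _ = _ := by push_cast; ring

end Precision

end GaussianNet

open GaussianNet in
theorem theorem4p1 :
    ∃ (C : ℕ) (weightTM enumTM : Turing.TM2ComputableAux GaussianNet.Sym GaussianNet.Sym),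
    ∀ k : ℕ, 1 ≤ k → ∀ ε : ℝ, 0 < ε →
    ∃ (δ : ℚ) (S : Finset (Fin k → ℚ)) (w : ℚ → ℚ) (p : (Fin k → ℚ) → ℚ),
      -- `S` consists of points of the grid `(δ(ℤ + 1/2))^k`, and `|S| = (1/ε)^{O(k)}`
      0 < δ ∧
      (∀ x ∈ S, ∀ i, ∃ z : ℤ, x i = δ * ((z : ℚ) + 1 / 2)) ∧
      (S.card : ℝ) ≤ GaussianNet.invEps ε ^ (C * k) ∧
      -- `p` is a nonnegative product weight
      (∀ a, 0 ≤ w a) ∧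
      (∀ x, p x = ∏ i, w (x i)) ∧
      -- `p` is computable in `poly(k, 1/ε)` time
      (∀ x ∈ S, ∃ t : ℕ,
        (t : ℝ) ≤ C * ((k : ℝ) * GaussianNet.invEps ε) ^ C ∧
        GaussianNet.OutputsInTime weightTM
          (GaussianNet.encInput k ⌈GaussianNet.invEps ε⌉₊ (some x))
          (GaussianNet.encRat (p x)) t) ∧
      -- the weighted sum over `S` estimates the Gaussian expectation of every semi-norm
      (∀ φ : Seminorm ℝ (Fin k → ℝ),
        MeasureTheory.Integrable (fun x => φ x) (GaussianNet.stdGaussianPow k) ∧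
        (1 - ε) * (∑ x ∈ S, (p x : ℝ) * φ (fun i => (x i : ℝ))) ≤
          ∫ x, φ x ∂(GaussianNet.stdGaussianPow k) ∧
        ∫ x, φ x ∂(GaussianNet.stdGaussianPow k) ≤
          (1 + ε) * (∑ x ∈ S, (p x : ℝ) * φ (fun i => (x i : ℝ)))) ∧
      -- successive elements of `S` are enumerated in `poly(k, 1/ε)` time and
      -- `O(k log(1/ε))` space
      (∃ L : List (Fin k → ℚ), L.Nodup ∧ (∀ x, x ∈ L ↔ x ∈ S) ∧
        ∀ i ≤ L.length, ∃ t s : ℕ,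
          (t : ℝ) ≤ C * ((k : ℝ) * GaussianNet.invEps ε) ^ C ∧
          (s : ℝ) ≤ C * ((k : ℝ) * Real.log (GaussianNet.invEps ε)) ∧
          GaussianNet.OutputsInTime enumTM
            (GaussianNet.encInput k ⌈GaussianNet.invEps ε⌉₊ (GaussianNet.prevEntry L i))
            (GaussianNet.encOptPoint L[i]?) t ∧
          GaussianNet.UsesSpace enumTM
            (GaussianNet.encInput k ⌈GaussianNet.invEps ε⌉₊ (GaussianNet.prevEntry L i)) s) := by
  -- The space bound fixes the constant: `4000 k size N` cells and `size N ≤ 5 log M`. All other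
  -- bounds need less.
  refine ⟨20000, Cmd.machine Weigh.prog .inp .out, Cmd.machine Enum.prog .inp .out, ?_⟩
  intro k hk ε hε
  have hM : 2 ≤ invEps ε := le_max_left _ _
  have hεM : 1 / ε ≤ invEps ε := le_max_right _ _
  generalize invEps ε = M at hM hεM ⊢
  have hNM : M ≤ (⌈M⌉₊ : ℝ) := Nat.le_ceil M
  have hN : 2 ≤ ⌈M⌉₊ := by exact_mod_cast hM.trans hNM
  have hNε : 1 / (⌈M⌉₊ : ℝ) ≤ ε := by
    rw [div_le_comm₀ (by linarith) hε]
    exact hεM.trans hNM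
  refine ⟨spacing ⌈M⌉₊, net k ⌈M⌉₊, weight k ⌈M⌉₊, fun x => ∏ i, weight k ⌈M⌉₊ (x i),
    spacing_pos _, ?_, card_net_le_pow k hM, Weigh.cellWeight_nonneg _ _, fun _ => rfl, ?_, ?_, ?_⟩
  · intro x hx i
    obtain ⟨f, -, rfl⟩ := Finset.mem_image.1 hx
    exact point_mem_grid _ f i
  · intro x hx
    obtain ⟨f, hf, rfl⟩ := Finset.mem_image.1 hx
    obtain ⟨t, ht, h⟩ := weigh_time k ⌈M⌉₊ hk hN f hf
    exact ⟨t, weigh_time_le_pow hk hM ht, h⟩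
  · intro φ
    obtain ⟨h1, h2⟩ := netSum_approx hk hN φ
    have hP : 0 ≤ netSum k ⌈M⌉₊ φ := Finset.sum_nonneg fun f _ => mul_nonneg
      (by exact_mod_cast Finset.prod_nonneg fun i _ => Weigh.cellWeight_nonneg _ _ _)
      (apply_nonneg _ _)
    simp only [sum_net_eq]
    exact ⟨integrable_seminorm φ, le_trans (by gcongr) h1, h2.trans (by gcongr)⟩
  · obtain ⟨L, hL, hmem, h⟩ := exists_enumeration k ⌈M⌉₊ hk (by omega)
    refine ⟨L, hL, hmem, fun i hi => ?_⟩
    obtain ⟨t, ht, s, hs, h1, h2⟩ := h i hi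
    exact ⟨t, s, enum_time_le_pow hk hM ht, enum_space_le hM hs, h1, h2⟩
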